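/- Let $n\ge 1$, $r\ge 0$, $m=2r$, and let $V$ be the complex superspace of dimension $n|m$ with homogeneous basis $e_1,\dots,e_n$ (even), $e_{\bar 1},\dots,e_{\bar m}$ (odd), indexed by the ordered set $R=\{1<\dots<n<\bar 1<\dots<\bar m\}$; $p(i)$ is the parity of $i\in R$. Put $\tilde i=n-i+1$ for even $i$, $\tilde{\bar\jmath}=\overline{m-j+1}$ for odd $\bar\jmath$, and $c(i)=1$ if $i$ is even or $i<\tilde i$, $c(i)=-1$ otherwise. Let $\mathfrak{osp}(V)$ be the Lie superalgebra of the $X\in\mathfrak{gl}(V)$ that preserve, in the super sense, the even bilinear form with $B(e_i,e_{\tilde i})=c(\tilde i)$ and $B(e_i,e_j)=0$ for $j\ne\tilde i$ (that is, $B(Xu,v)+(-1)^{p(X)p(u)}B(u,Xv)=0$); it acts on $V^{\otimes k}$ by the Leibniz rule with signs. For a sequence $I=i_1\dots i_k$ in $R$ let $v_I=e_{i_1}\otimes\dots\otimes e_{i_k}$. The group $\mathfrak S_k$ acts on $V^{\otimes k}$ by permuting tensor factors with the sign rule, $\sigma v_I=\pm v_{\sigma I}$, the sign being $-1$ to the number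 of pairs of odd factors whose order is reversed. For a tableau $t$ with $k$ cells, numbered $1,\dots,k$, put $e_t=\sum_{\tau\in C_t,\,\sigma\in R_t}\varepsilon(\tau)\,\sigma\tau$, where $C_t$ and $R_t$ are the column and row stabilizers. Let $s$ be the $n\times(m+1)$ tableau filled consecutively along columns, and $I_1=1,2,\dots,n$. Identify a sequence $I$ of length $nm$ in $R$ with the filling of the $n\times m$ rectangle obtained by writing $I$ along columns, from left to right. In each row the entries in columns $2q-1,2q$ ($1\le q\le r$) form a pair, which is called conjugate if it is of the form $(i,\tilde i)$. Let $\mathcal T$ be the set of those $I$ such that all pairs in all rows but the last are conjugate, and such that the entries $k_1,\dots,k_{2p}$ (from left to right) of the non-conjugate pairs of the last row are odd and pairwise distinct, and form a set stable under $i\mapsto\tilde i$. For $I\in\mathcal T$ define: * $d(I)=\prod_{q=1}^r(-1)^{\alpha_q}$, where $\alpha_q$ is the number of two-element sets of cells of column $2q-1$ whose entries are both odd; * $\hat c(I)=\operatorname{sign}(k_1,\dots,k_{2p})\prod c(i)$, where $\operatorname{sign}$ is $-1$ to the number of inversions of the sequence and the product is over all conjugate pairs $(i,\tilde i)$ in all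 rows of $I$; * $K(I)=\sum_{q=p}^{p+\nu}(n+1)^r\,2^{r-q}\,(r-q)!\,n^q\,\sigma_{q-p}(n_1,\dots,n_\nu)$, where $\nu$ is the number of unordered pairs $\{a,\tilde a\}$ of odd elements, disjoint from $\{k_1,\dots,k_{2p}\}$, that occur as conjugate pairs (in either order) in the last row, $n_1,\dots,n_\nu$ are the numbers of their occurrences, and $\sigma_l$ is the $l$-th elementary symmetric function. **Theorem 5.1.** The element $$\nabla_{m+1}=\sum_{I\in\mathcal T}\hat c(I)\,d(I)\,K(I)\,e_s(v_{I_1}\otimes v_I)\in V^{\otimes n(m+1)}$$ is $\mathfrak{osp}(V)$-invariant. Up to a nonzero constant factor it is obtained by applying an $\mathfrak{osp}(V)$-invariant operator to an $\mathfrak{osp}(V)$-invariant power of the form, as follows. Let $t$ be the $(n+1)\times m$ tableau in which first the first $n$ rows are filled, consecutively along columns, and then the last row, from left to right. Let $\mathcal L=e_s\circ(v_{I_1}\otimes D)\circ e_t:V^{\otimes(n+1)m}\to V^{\otimes n(m+1)}$, where $D:V^{\otimes (n+1)m}\to V^{\otimes nm}$ is given by $D(v_A\otimes v_B)=v_A$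 if $B=\bar 1\,\bar 2\dots\bar m$, and $D(v_A\otimes v_B)=0$ for every other sequence $B$ of length $m$. Let $\tilde\theta\in V^{\otimes(n+1)m}$ be the tensor $\bigl(\sum_{i\in R}c(i)\,e_i\otimes e_{\tilde i}\bigr)^{\otimes (n+1)r}$ whose factors are moved, with the sign rule, so that, row by row, its successive two-fold factors occupy the pairs of cells of $t$ in columns $2q-1,2q$, $1\le q\le r$. Then $\mathcal L$ commutes with the action of $\mathfrak{osp}(V)$, $\tilde\theta$ is $\mathfrak{osp}(V)$-invariant, and $\mathcal L(\tilde\theta)=\kappa\,\nabla_{m+1}$ for some nonzero $\kappa\in\mathbb C$. -/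

import Mathlib

open scoped TensorProduct

noncomputable section

namespace OspInv

/-! ### The superspace `V` of dimension `n | m` -/

/-- The index set `R_V = {1, …, n; 1̄, …, m̄}` of a homogeneous basis of `V` in the standard format:
`Sum.inl` are the even indices, `Sum.inr` the odd ones. -/
abbrev Idx (n m : ℕ) := Fin n ⊕ Fin m

variable {n m k l : ℕ}

/-- The parity of an index. -/
def par : Idx n m → ZMod 2
  | Sum.inl _ => 0
  | Sum.inr _ => 1

/-- The place of an index in the total order of `R_V` (even indices come before odd ones). -/
def place : Idx n m → ℕ
  | Sum.inl i => i
  | Sum.inr j => n + j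

/-- The conjugation `i ↦ ĩ`: it sends `i` to `n - i + 1` and `ī` to the bar of `m - i + 1`
(indices start at `0` here, so both are `Fin.rev`). -/
def conj : Idx n m → Idx n m
  | Sum.inl i => Sum.inl i.rev
  | Sum.inr j => Sum.inr j.rev

/-- The sign `c(i, ĩ)`. -/
def cSign (i : Idx n m) : ℤ :=
  if par i = 0 ∨ place i < place (conj i) then 1 else -1

/-- `(-1) ^ a` for a parity `a`. -/
def sgn (a : ZMod 2) : ℤ := if a = 0 then 1 else -1

/-- The superspace `V` of dimension `n | m`, with its standard homogeneous basis. -/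
abbrev V (n m : ℕ) := Idx n m → ℂ

/-- The basis vector `e_i`. -/
def e (i : Idx n m) : V n m := Pi.single i 1

/-- The homogeneous component of `V` of parity `a`. -/
def part (n m : ℕ) (a : ZMod 2) : Submodule ℂ (V n m) :=
  Submodule.span ℂ (e '' {i | par i = a})

/-- The invariant bilinear form on `V`,
`∑ e_i^* ⊗ e_{n-i+1}^* + ∑_{j ≤ r} (e_{m-j+1 bar}^* ⊗ e_{j bar}^* - e_{j bar}^* ⊗ e_{m-j+1 bar}^*)`
when `m = 2 r`. -/
def form (u v : V n m) : ℂ := ∑ i, (cSign (conj i) : ℂ) * u i * v (conj i)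

/-- `X` belongs to the component of parity `a` of the orthosymplectic Lie superalgebra
`osp(V)`: it is homogeneous of parity `a` and preserves the form in the super sense. -/
structure IsOsp (a : ZMod 2) (X : V n m →ₗ[ℂ] V n m) : Prop where
  homogeneous : ∀ b, ∀ u ∈ part n m b, X u ∈ part n m (a + b)
  preserves : ∀ b, ∀ u ∈ part n m b, ∀ v, form (X u) v + (sgn (a * b) : ℂ) * form u (X v) = 0

/-! ### Tensor powers, the action of `gl(V)` and the sign action of permutations -/

/-- The tensor power `V^{⊗ k}`. -/
abbrev T (n m k : ℕ) := ⨂[ℂ] _ : Fin k, V n m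

/-- The vector `v_I = e_{i_1} ⊗ … ⊗ e_{i_k}`. -/
def vec (I : Fin k → Idx n m) : T n m k := PiTensorProduct.tprod ℂ fun α => e (I α)

/-- The basis of `V^{⊗ k}` that consists of the `v_I`. -/
def vecBasis (n m k : ℕ) : Module.Basis (Fin k → Idx n m) ℂ (T n m k) :=
  Basis.piTensorProduct fun _ => Pi.basisFun ℂ (Idx n m)

theorem vecBasis_apply (I : Fin k → Idx n m) : vecBasis n m k I = vec I := by
  simp [vecBasis, vec, Basis.piTensorProduct_apply, e]

/-- The operator `u ↦ (-1) ^ (a p(u)) u` on `V`. -/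
def parityOp (n m : ℕ) (a : ZMod 2) : V n m →ₗ[ℂ] V n m :=
  LinearMap.pi fun i => (sgn (a * par i) : ℂ) • LinearMap.proj i

/-- The action on `V^{⊗ k}` of a homogeneous `X ∈ gl(V)` of parity `a`:
`X (v_1 ⊗ … ⊗ v_k) = ∑_α (-1) ^ (a (p(v_1) + … + p(v_{α-1}))) v_1 ⊗ … ⊗ X v_α ⊗ … ⊗ v_k`. -/
def act (a : ZMod 2) (X : V n m →ₗ[ℂ] V n m) : T n m k →ₗ[ℂ] T n m k :=
  ∑ α : Fin k, PiTensorProduct.map fun β =>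
    if β < α then parityOp n m a else if β = α then X else LinearMap.id

/-- The sign that appears when odd factors of the monomial with indices `I` are moved past each
other while the factor in position `α` is moved to position `σ α`. -/
def permSign (σ : Fin k ≃ Fin l) (I : Fin k → Idx n m) : ℤ :=
  ∏ α, ∏ β, if α < β ∧ σ β < σ α ∧ par (I α) = 1 ∧ par (I β) = 1 then -1 else 1

/-- The sign action of a bijection of positions on tensors, `σ v_I = ± v_{σ I}`; for `k = l` this is
the action of the symmetric group on `V^{⊗ k}`. -/
def permAct (n m : ℕ) (σ : Fin k ≃ Fin l) : T n m k →ₗ[ℂ] T n m l :=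
  (vecBasis n m k).constr ℂ fun I => (permSign σ I : ℂ) • vec (I ∘ σ.symm)

/-! ### Rectangular tableaux and their Young symmetrizers -/

/-- The column stabilizer of a tableau with `a` rows and `b` columns; the tableau is given by the
numbering of its cells (row, column). -/
def colStab {a b : ℕ} (t : Fin a × Fin b ≃ Fin k) : Finset (Equiv.Perm (Fin k)) :=
  {τ | ∀ x, (t.symm (τ x)).2 = (t.symm x).2}

/-- The row stabilizer of a tableau. -/
def rowStab {a b : ℕ} (t : Fin a × Fin b ≃ Fin k) : Finset (Equiv.Perm (Fin k)) :=
  {σ | ∀ x, (t.symm (σ x)).1 = (t.symm x).1}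

/-- The operator `e_t = ∑ ε(τ) σ τ` on tensors, over `τ` in the column stabilizer and `σ` in the row
stabilizer of `t`. -/
def young (n m : ℕ) {a b : ℕ} (t : Fin a × Fin b ≃ Fin k) : T n m k →ₗ[ℂ] T n m k :=
  ∑ τ ∈ colStab t, ∑ σ ∈ rowStab t,
    ((Equiv.Perm.sign τ : ℤ) : ℂ) • (permAct n m σ ∘ₗ permAct n m τ)

/-- The `a × b` tableau filled consecutively along columns: cell `(i, j)` carries `i + a j`. -/
def colTab (a b : ℕ) : Fin a × Fin b ≃ Fin (a * b) :=
  ((Equiv.prodComm _ _).trans finProdFinEquiv).trans (finCongr (Nat.mul_comm b a))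

/-- The tableau with `n + 1` rows and `m` columns in which the first `n` rows are filled first,
consecutively along columns, and then the last row from left to right. -/
def bordTab (n m : ℕ) : Fin (n + 1) × Fin m ≃ Fin (n * m + m) :=
  ((finSumFinEquiv.symm.prodCongr (Equiv.refl (Fin m))).trans
    (Equiv.sumProdDistrib (Fin n) (Fin 1) (Fin m))).trans
    ((Equiv.sumCongr (colTab n m) (Equiv.uniqueProd (Fin m) (Fin 1))).trans finSumFinEquiv)

/-! ### The invariant operator -/

/-- The sequence `I_1 * L`, where `I_1 = 1, 2, …, n` lists the even indices. -/
def prependSeq (L : Fin (n * m) → Idx n m) : Fin (n * (m + 1)) → Idx n m :=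
  fun x => Fin.append (Sum.inl : Fin n → Idx n m) L (Fin.cast (by ring) x)

/-- The map `w ↦ v_{I_1} ⊗ w`. -/
def prepend (n m : ℕ) : T n m (n * m) →ₗ[ℂ] T n m (n * (m + 1)) :=
  (vecBasis n m (n * m)).constr ℂ fun L => vec (prependSeq L)

/-- The contraction of the last `m` tensor factors with the covector `v_{J_1}^*`, where
`J_1 = 1̄, 2̄, …, m̄` lists the odd indices. -/
def contract (n m : ℕ) : T n m (n * m + m) →ₗ[ℂ] T n m (n * m) :=
  (vecBasis n m (n * m + m)).constr ℂ fun L =>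
    if ∀ j : Fin m, L (Fin.natAdd (n * m) j) = Sum.inr j then
      vec fun α => L (Fin.castAdd m α) else 0

/-- The operator `𝓛 = e_s ∘ (v_{I_1} ⊗ v_{J_1}^*) ∘ e_t : V^{⊗ (n+1)m} → V^{⊗ n(m+1)}`. -/
def invOp (n m : ℕ) : T n m (n * m + m) →ₗ[ℂ] T n m (n * (m + 1)) :=
  young n m (colTab n (m + 1)) ∘ₗ prepend n m ∘ₗ contract n m ∘ₗ young n m (bordTab n m)

/-- The power `(∑_i c(i, ĩ) e_i ⊗ e_ĩ)^{⊗ N}` in `V^{⊗ 2N}` of the tensor of the form. -/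
def formPower (n m N : ℕ) : T n m (N * 2) :=
  ∑ z : Fin N → Idx n m, ((∏ b, cSign (z b) : ℤ) : ℂ) • vec fun x =>
    if (finProdFinEquiv.symm x).2 = 0 then z (finProdFinEquiv.symm x).1
    else conj (z (finProdFinEquiv.symm x).1)

/-- The bijection that puts the `2 (n+1) r` tensor factors of a power of the form in the cells of the
`(n+1) × 2r` tableau row by row, and so in the positions which that tableau gives to the cells:
each factor `∑_i c(i, ĩ) e_i ⊗ e_ĩ` occupies two adjacent cells of a row, in the columns
`2q - 1` and `2q`. -/
def rowArrange (n r : ℕ) : Fin ((n + 1) * r * 2) ≃ Fin (n * (2 * r) + 2 * r) :=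
  ((finCongr (by ring)).trans
    (finProdFinEquiv (m := n + 1) (n := 2 * r)).symm).trans (bordTab n (2 * r))

/-- The power `θ̃` of the invariant form, arranged along the rows of the `(n+1) × 2r` tableau. -/
def formTensor (n r : ℕ) : T n (2 * r) (n * (2 * r) + 2 * r) :=
  permAct n (2 * r) (rowArrange n r) (formPower n (2 * r) ((n + 1) * r))

/-! ### The explicit element -/

variable {r : ℕ}

/-- The left column of the `q`-th pair of adjacent columns. -/
def lc (q : Fin r) : Fin (2 * r) := ⟨2 * q, by omega⟩

/-- The right column of the `q`-th pair of adjacent columns. -/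
def rc (q : Fin r) : Fin (2 * r) := ⟨2 * q + 1, by omega⟩

/-- The pair of columns to which a column belongs. -/
def pairOf (x : Fin (2 * r)) : Fin r := ⟨x / 2, by omega⟩

/-- The `q`-th pair of entries of a row is conjugate. -/
abbrev ConjPair (J : Fin (2 * r) → Idx n m) (q : Fin r) : Prop := J (rc q) = conj (J (lc q))

/-- The columns of the entries of a row that belong to non-conjugate pairs. -/
def badCols (J : Fin (2 * r) → Idx n m) : Finset (Fin (2 * r)) := {x | ¬ ConjPair J (pairOf x)}

/-- The condition on the last row: the entries of its non-conjugate pairs are odd, pairwise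
distinct, and their set is stable under conjugation. -/
def LastRowAdm (J : Fin (2 * r) → Idx n m) : Prop :=
  (∀ x ∈ badCols J, par (J x) = 1) ∧
  (∀ x ∈ badCols J, ∀ y ∈ badCols J, J x = J y → x = y) ∧
  ∀ x ∈ badCols J, ∃ y ∈ badCols J, J y = conj (J x)

instance (J : Fin (2 * r) → Idx n m) : Decidable (LastRowAdm J) := by
  unfold LastRowAdm; infer_instance

/-- The last row of a filling. -/
def lastRow [NeZero n] (F : Fin n → Fin (2 * r) → Idx n m) : Fin (2 * r) → Idx n m :=
  F ⟨n - 1, Nat.sub_lt (NeZero.pos n) one_pos⟩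

/-- The set `𝒯` of fillings of the `n × 2r` rectangle: all the rows but the last one are of the form
`i_1 ĩ_1 … i_r ĩ_r`, and the last row is admissible. -/
def fillings (n r : ℕ) [NeZero n] : Finset (Fin n → Fin (2 * r) → Idx n (2 * r)) :=
  {F | (∀ i : Fin n, (i : ℕ) + 1 < n → ∀ q, ConjPair (F i) q) ∧ LastRowAdm (lastRow F)}

/-- The sequence `I` of a filling `F`: the entries of `F`, read along columns. -/
def seqOf (F : Fin n → Fin m → Idx n m) : Fin (n * m) → Idx n m :=
  fun x => F ((colTab n m).symm x).1 ((colTab n m).symm x).2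

/-- `d(J) = (-1) ^ ∑_{i < i'} p(j_i) p(j_{i'})` for a column `J`. -/
def dCol (J : Fin n → Idx n m) : ℤ :=
  ∏ i, ∏ i', if i < i' ∧ par (J i) = 1 ∧ par (J i') = 1 then -1 else 1

/-- `d(I) = d(I_1) d(I_3) ⋯ d(I_{2r-1})`, where `I_1, …, I_{2r}` are the columns. -/
def dSign (F : Fin n → Fin (2 * r) → Idx n m) : ℤ := ∏ q : Fin r, dCol fun i => F i (lc q)

/-- The sign of the sequence `k_1, …, k_{2p}` of the entries of the non-conjugate pairs of a row. -/
def badSign (J : Fin (2 * r) → Idx n m) : ℤ :=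
  ∏ x ∈ badCols J, ∏ y ∈ badCols J, if x < y ∧ place (J y) < place (J x) then -1 else 1

/-- The sign `ĉ(I)`: the sign of `k_1, …, k_{2p}` in the last row times the product of the signs
`c(i, ĩ)` over all the conjugate pairs of the filling. -/
def cHat [NeZero n] (F : Fin n → Fin (2 * r) → Idx n m) : ℤ :=
  badSign (lastRow F) *
    ∏ i, ∏ q : Fin r, if ConjPair (F i) q then cSign (F i (lc q)) else 1

/-- The number of the conjugate pairs of a row that are `(a, ã)` or `(ã, a)`. -/
def mult (J : Fin (2 * r) → Idx n m) (a : Idx n m) : ℕ :=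
  ({q : Fin r | ConjPair J q ∧ (J (lc q) = a ∨ J (lc q) = conj a)} : Finset (Fin r)).card

/-- The types `{a, ã}` of the odd conjugate pairs of a row whose members do not occur in the
non-conjugate pairs; a type is represented by its smaller member. -/
def types (J : Fin (2 * r) → Idx n m) : Finset (Idx n m) :=
  {a | par a = 1 ∧ place a < place (conj a) ∧ 0 < mult J a ∧ ∀ x ∈ badCols J, J x ≠ a}

/-- The elementary symmetric function `σ_l(n_1, …, n_ν)` of the multiplicities of the types. -/
def esymmMult (J : Fin (2 * r) → Idx n m) (l : ℕ) : ℕ :=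
  ∑ S ∈ (types J).powersetCard l, ∏ a ∈ S, mult J a

/-- The number of the non-conjugate pairs of a row. -/
def numBad (J : Fin (2 * r) → Idx n m) : ℕ :=
  ({q : Fin r | ¬ ConjPair J q} : Finset (Fin r)).card

/-- The coefficient
`K(I) = ∑_{q=p}^{p+ν} (n+1)^r 2^{r-q} (r-q)! n^q σ_{q-p}(n_1, …, n_ν)`; here `p + ν ≤ r`. -/
def kCoeff [NeZero n] (F : Fin n → Fin (2 * r) → Idx n m) : ℕ :=
  ∑ q ∈ Finset.Icc (numBad (lastRow F)) (numBad (lastRow F) + (types (lastRow F)).card),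
    (n + 1) ^ r * 2 ^ (r - q) * (r - q).factorial * n ^ q *
      esymmMult (lastRow F) (q - numBad (lastRow F))

/-- The element `∇_{m+1} = ∑_{I ∈ 𝒯} ĉ(I) d(I) K(I) e_s(v_{I_1} ⊗ v_I)` of `V^{⊗ n(m+1)}`, where
`m = 2r` and `s` is the `n × (m+1)` tableau filled along columns. -/
def nabla (n r : ℕ) [NeZero n] : T n (2 * r) (n * (2 * r + 1)) :=
  ∑ F ∈ fillings n r, ((cHat F * dSign F * kCoeff F : ℤ) : ℂ) •
    young n (2 * r) (colTab n (2 * r + 1)) (vec (prependSeq (seqOf F)))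

end OspInv

end

namespace OspInv

/-! ### Sign calculus; the commuting actions of permutations and of gl(V) on tensors. -/

section


variable {n m k l : ℕ}

/-! ### Coordinates -/

/-! The tensor `formTensor` is a rearranged power of the invariant tensor dual to the form, so it is
killed by osp(V) (`act_formTensor`), and so is its image under any operator that commutes with
osp(V). It remains to show that `invOp` commutes with osp(V) (`invOp_act`) and that its value at
`formTensor` is a nonzero multiple of `nabla` (`exists_invOp_formTensor_eq`).

Commutation. Expand X in matrix units E_ij. Unless i is odd and j is even, E_ij commutes with
`invOp` up to a scalar multiple of `invOp`, which is 0 for i ≠ j and the sign of p(i) for i = j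
(`gact_invOp`): a repeated even letter in v_{I_1} is killed by the antisymmetry of the first column
of s, a repeated odd letter in the last row by the symmetry of that row of t. The scalars add up to
the supertrace of X, which vanishes on osp(V). For i odd and j even let f be the commutator of E_ij
with `invOp` (`gact_invOp_neg`). It anticommutes with all E_pq with p even and q odd, and its values
have the symmetry of the n × (m+1) rectangle. A tensor of that symmetry killed by all these E_pq has
no odd factors (`coord_eq_zero_of_killed`): on it a sum of operators E*E equals minus the number of
odd factors. But f lowers the number of odd factors by m - 1 and kills tensors with fewer than m of
them, because n + 1 rows exceed the number of even letters; so it never produces a tensor without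
odd factors. An induction on the number of odd factors gives f = 0.

Value. Rectangular Young symmetrizers are quasi-idempotent, so e_s absorbs the symmetrization of the
first n rows; up to a scalar, `invOp` antisymmetrizes the columns of t, symmetrizes the last row,
contracts it and applies e_s (`exists_invOp_eq`). Column permutations that act equally on both
columns of a pair fix `formTensor`, and those that fix the last row act afterwards by their sign.
Hence for each pair of columns only a double coset of S_n in S_{n+1} matters: the trivial one, or
the n times larger one of the interchange of the last two rows in the left column. The value is thus
a sum over sets S of pairs of columns with weights n^|S| (`exists_invOp_formTensor`). In the term of
S the last row must become a word in all the odd letters; its sign together with the signs of the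
form gives ĉ d (`exch_sign_eq`), and a filling F of the upper rows arises from 2^(r-|S|) (r-|S|)!
such words (`card_preFill`). A set S is compatible with F if it consists of the non-conjugate pairs
of the last row of F and of at most one conjugate pair of each type; the number of such S of a given
size is an elementary symmetric function of the multiplicities (`sum_admOn`). This is K up to the
factor (n+1)^r, which goes into κ. -/

theorem hom_ext {M : Type*} [AddCommMonoid M] [Module ℂ M] {f g : T n m k →ₗ[ℂ] M}
    (h : ∀ I, f (vec I) = g (vec I)) : f = g :=
  (vecBasis n m k).ext fun I => by simpa [vecBasis_apply] using h I

/-- The coordinate of a tensor at the basis vector `v_I`. -/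
noncomputable def coord (I : Fin k → Idx n m) : T n m k →ₗ[ℂ] ℂ := (vecBasis n m k).coord I

theorem coord_vec (I K : Fin k → Idx n m) : coord I (vec K) = if K = I then 1 else 0 := by
  rw [coord, ← vecBasis_apply, Module.Basis.coord_apply, Module.Basis.repr_self,
    Finsupp.single_apply]

theorem tensor_ext {z w : T n m k} (h : ∀ I, coord I z = coord I w) : z = w :=
  (vecBasis n m k).ext_elem h

theorem sum_coord (z : T n m k) : ∑ I, coord I z • vec I = z := by
  have := (vecBasis n m k).sum_repr z
  simp only [vecBasis_apply] at this
  exact this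

/-! ### Signs of inversions of odd elements -/

/-- `-1` to the number of pairs of odd elements that the orders given by `f` and `g` order
differently. -/
def invSign {ι : Type*} [Fintype ι] (P : ι → ZMod 2) (f g : ι → ℕ) : ℤ :=
  ∏ a, ∏ b, if f a < f b ∧ g b < g a ∧ P a = 1 ∧ P b = 1 then -1 else 1

theorem permSign_eq (σ : Fin k ≃ Fin l) (I : Fin k → Idx n m) :
    permSign σ I = invSign (fun α => par (I α)) Fin.val (fun α => (σ α).val) := by
  simp only [permSign, invSign, Fin.lt_def]

/-- Turns a product over ordered pairs into one over unordered pairs, each listed once in the order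
given by an arbitrary injective `f`. -/
theorem prod_prod_eq_prod_lt {ι M : Type*} [Fintype ι] [CommMonoid M] {f : ι → ℕ}
    (hf : Function.Injective f) (D : ι → ι → M) (hD : ∀ a, D a a = 1) :
    ∏ a, ∏ b, D a b = ∏ a, ∏ b, if f a < f b then D a b * D b a else 1 := by
  have h1 : ∀ a b, D a b = (if f a < f b then D a b else 1) * (if f b < f a then D a b else 1) := by
    intro a b
    rcases lt_trichotomy (f a) (f b) with h | h | h
    · simp [h, h.not_gt]
    · have := hf h
      subst this
      simp [hD]
    · simp [h, h.not_gt]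
  have h2 : ∏ a, ∏ b, D a b = (∏ a, ∏ b, if f a < f b then D a b else 1) *
      ∏ a, ∏ b, if f b < f a then D a b else 1 := by
    simp only [← Finset.prod_mul_distrib]
    exact Finset.prod_congr rfl fun a _ => Finset.prod_congr rfl fun b _ => h1 a b
  rw [h2, Finset.prod_comm (f := fun a b => if f b < f a then D a b else 1)]
  simp only [← Finset.prod_mul_distrib]
  refine Finset.prod_congr rfl fun a _ => Finset.prod_congr rfl fun b _ => ?_
  split_ifs <;> simp

/-- Whether `g` and `h` order a pair differently does not depend on the order `f` in which the pairs
are listed. The same `f` can therefore serve for several signs at once, which is what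
`invSign_trans` needs. -/
theorem invSign_eq_prod_lt {ι : Type*} [Fintype ι] (P : ι → ZMod 2) {f g h : ι → ℕ}
    (hf : Function.Injective f) (hg : Function.Injective g) (hh : Function.Injective h) :
    invSign P g h = ∏ a, ∏ b, if f a < f b ∧ P a = 1 ∧ P b = 1 ∧ ¬ (g a < g b ↔ h a < h b)
      then -1 else 1 := by
  rw [invSign, prod_prod_eq_prod_lt hf _ (by simp)]
  refine Finset.prod_congr rfl fun a _ => Finset.prod_congr rfl fun b _ => ?_
  by_cases hab : f a < f b
  · have hne : a ≠ b := by rintro rfl; exact lt_irrefl _ hab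
    have h1 := hg.ne hne
    have h2 := hh.ne hne
    by_cases hP : P a = 1 ∧ P b = 1
    · obtain ⟨hPa, hPb⟩ := hP
      simp only [hab, hPa, hPb, and_true, true_and, if_true]
      rcases lt_or_gt_of_ne h1 with h1 | h1 <;> rcases lt_or_gt_of_ne h2 with h2 | h2 <;>
        simp [h1, h2, h1.not_gt, h2.not_gt]
    · have e1 : ¬ (P b = 1 ∧ P a = 1) := fun h => hP h.symm
      simp only [hP, e1, hab, and_false, if_false, if_true, mul_one, true_and]
      rw [if_neg (fun h => hP ⟨h.1, h.2.1⟩)]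
  · simp [hab]

/-- For each pair, disagreement of `f` and `h` is the exclusive or of the disagreements of `f`, `g`
and of `g`, `h`. This cocycle identity makes `permAct` an action. -/
theorem invSign_trans {ι : Type*} [Fintype ι] (P : ι → ZMod 2) {f g h : ι → ℕ}
    (hf : Function.Injective f) (hg : Function.Injective g) (hh : Function.Injective h) :
    invSign P f h = invSign P f g * invSign P g h := by
  rw [invSign_eq_prod_lt P hf hf hh, invSign_eq_prod_lt P hf hf hg,
    invSign_eq_prod_lt P hf hg hh]
  simp only [← Finset.prod_mul_distrib]
  refine Finset.prod_congr rfl fun a _ => Finset.prod_congr rfl fun b _ => ?_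
  by_cases h1 : f a < f b <;> by_cases h2 : g a < g b <;> by_cases h3 : h a < h b <;>
    by_cases h4 : P a = 1 <;> by_cases h5 : P b = 1 <;> simp [h1, h2, h3, h4, h5]

theorem invSign_comp {ι κ : Type*} [Fintype ι] [Fintype κ] (σ : ι ≃ κ) (P : κ → ZMod 2)
    (f g : κ → ℕ) : invSign (P ∘ σ) (f ∘ σ) (g ∘ σ) = invSign P f g := by
  unfold invSign
  rw [← Equiv.prod_comp σ]
  refine Finset.prod_congr rfl fun a _ => ?_
  rw [← Equiv.prod_comp σ]
  rfl

theorem invSign_self {ι : Type*} [Fintype ι] (P : ι → ZMod 2) (f : ι → ℕ) :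
    invSign P f f = 1 := by
  unfold invSign
  refine Finset.prod_eq_one fun a _ => Finset.prod_eq_one fun b _ => ?_
  rw [if_neg]
  rintro ⟨h1, h2, -⟩
  exact lt_asymm h1 h2

theorem invSign_mul_self {ι : Type*} [Fintype ι] (P : ι → ZMod 2) (f g : ι → ℕ) :
    invSign P f g * invSign P f g = 1 := by
  unfold invSign
  simp only [← Finset.prod_mul_distrib]
  refine Finset.prod_eq_one fun a _ => Finset.prod_eq_one fun b _ => ?_
  split_ifs <;> norm_num

/-- Meant for the quotient of two signs whose data differ only at `x`: only the row and the column
of `x` contribute. -/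
theorem prod_prod_eq_prod_cross {ι M : Type*} [Fintype ι] [DecidableEq ι] [CommMonoid M]
    (x : ι) (D : ι → ι → M) (hD : ∀ a b, a ≠ x → b ≠ x → D a b = 1) (hx : D x x = 1) :
    ∏ a, ∏ b, D a b = ∏ b, D x b * D b x := by
  rw [Fintype.prod_eq_mul_prod_compl x, Finset.prod_mul_distrib]
  congr 1
  have h : ∏ b, D b x = ∏ b ∈ ({x}ᶜ : Finset ι), D b x := by
    rw [Fintype.prod_eq_mul_prod_compl x, hx, one_mul]
  rw [h]
  refine Finset.prod_congr rfl fun a ha => ?_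
  refine Fintype.prod_eq_single x fun b hb => ?_
  exact hD a b (by simpa using ha) hb

theorem sgn_mul_self (a : ZMod 2) : sgn a * sgn a = 1 := by
  unfold sgn; split_ifs <;> norm_num

theorem zmod_two_cases (a : ZMod 2) : a = 0 ∨ a = 1 := by
  revert a; decide

theorem sgn_add (a b : ZMod 2) : sgn (a + b) = sgn a * sgn b := by
  rcases zmod_two_cases a with rfl | rfl <;> rcases zmod_two_cases b with rfl | rfl <;> decide

/-- The effect on the sign of changing the parity of one element. -/
theorem invSign_update {ι : Type*} [Fintype ι] [DecidableEq ι] (P : ι → ZMod 2) (f g : ι → ℕ)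
    (x : ι) (c : ZMod 2) :
    invSign (Function.update P x c) f g = invSign P f g *
      ∏ b, if (f x < f b ∧ g b < g x) ∨ (f b < f x ∧ g x < g b) then
        sgn ((c + P x) * P b) else 1 := by
  -- A sign is its own inverse, so the quotient of the two signs is their product.
  have key : invSign (Function.update P x c) f g * invSign P f g =
      ∏ b, if (f x < f b ∧ g b < g x) ∨ (f b < f x ∧ g x < g b) then
        sgn ((c + P x) * P b) else 1 := by
    unfold invSign
    simp only [← Finset.prod_mul_distrib]
    rw [prod_prod_eq_prod_cross x]
    · refine Finset.prod_congr rfl fun b _ => ?_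
      by_cases hb : b = x
      · subst hb; simp
      · simp only [Function.update_self, Function.update_of_ne hb]
        by_cases h1 : f x < f b <;> by_cases h2 : g b < g x <;>
          by_cases h3 : f b < f x <;> by_cases h4 : g x < g b <;>
          first
          | omega
          | (rcases zmod_two_cases c with rfl | rfl <;> rcases zmod_two_cases (P x) with h5 | h5 <;>
              rcases zmod_two_cases (P b) with h6 | h6 <;> simp [h1, h2, h3, h4, h5, h6] <;> decide)
    · intro a b ha hb
      simp only [Function.update_of_ne ha, Function.update_of_ne hb]
      split_ifs <;> norm_num
    · simp
  rw [← key, mul_comm (invSign (Function.update P x c) f g), ← mul_assoc, invSign_mul_self, one_mul]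

/-! ### The sign action of bijections -/

theorem permSign_trans {j : ℕ} (σ : Fin k ≃ Fin l) (τ : Fin l ≃ Fin j) (I : Fin k → Idx n m) :
    permSign (σ.trans τ) I = permSign τ (I ∘ σ.symm) * permSign σ I := by
  rw [permSign_eq, permSign_eq τ, permSign_eq σ, mul_comm,
    invSign_trans (g := fun α => (σ α).val) (h := fun α => (σ.trans τ α).val) _ Fin.val_injective
      (Fin.val_injective.comp σ.injective) (Fin.val_injective.comp (σ.trans τ).injective)]
  congr 1
  rw [← invSign_comp σ (fun α => par ((I ∘ σ.symm) α))]
  simp [Function.comp_def]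

theorem permAct_vec (σ : Fin k ≃ Fin l) (I : Fin k → Idx n m) :
    permAct n m σ (vec I) = (permSign σ I : ℂ) • vec (I ∘ σ.symm) := by
  rw [permAct, ← vecBasis_apply, Module.Basis.constr_basis]

theorem permAct_trans {j : ℕ} (σ : Fin k ≃ Fin l) (τ : Fin l ≃ Fin j) :
    permAct n m (σ.trans τ) = permAct n m τ ∘ₗ permAct n m σ := by
  refine hom_ext fun I => ?_
  rw [LinearMap.comp_apply, permAct_vec, permAct_vec, map_smul, permAct_vec, smul_smul,
    permSign_trans]
  push_cast
  rw [mul_comm]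
  rfl

theorem permAct_mul (σ τ : Equiv.Perm (Fin k)) :
    permAct n m (σ * τ) = permAct n m σ ∘ₗ permAct n m τ :=
  permAct_trans τ σ

theorem permAct_refl : permAct n m (Equiv.refl (Fin k)) = LinearMap.id := by
  refine hom_ext fun I => ?_
  rw [permAct_vec, permSign_eq]
  simp [invSign_self]

theorem coord_permAct (σ : Fin k ≃ Fin l) (z : T n m k) (K : Fin l → Idx n m) :
    coord K (permAct n m σ z) = permSign σ (K ∘ σ) * coord (K ∘ σ) z := by
  have : coord K ∘ₗ permAct n m σ = (permSign σ (K ∘ σ) : ℂ) • coord (K ∘ σ) := by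
    refine hom_ext fun I => ?_
    rw [LinearMap.comp_apply, permAct_vec, map_smul, LinearMap.smul_apply, coord_vec, coord_vec]
    have : I ∘ σ.symm = K ↔ I = K ∘ σ := by
      constructor
      · rintro rfl; ext; simp
      · rintro rfl; ext; simp
    simp only [this]
    split_ifs with h
    · rw [h]
    · simp
  exact LinearMap.congr_fun this z

end

section


variable {n m k l : ℕ}

/-! ### The action of `gl(V)` in coordinates -/

/-- The sign that appears when an operator of parity `a` is moved past the factors before the
position `α`. -/
def preSign (a : ZMod 2) (I : Fin k → Idx n m) (α : Fin k) : ℤ :=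
  ∏ β, if β < α then sgn (a * par (I β)) else 1

theorem sgn_zero : sgn 0 = 1 := rfl

theorem sgn_one : sgn 1 = -1 := rfl

theorem preSign_zero (I : Fin k → Idx n m) (α : Fin k) : preSign 0 I α = 1 := by
  simp [preSign, sgn_zero]

theorem preSign_mul_self (a : ZMod 2) (I : Fin k → Idx n m) (α : Fin k) :
    preSign a I α * preSign a I α = 1 := by
  unfold preSign
  simp only [← Finset.prod_mul_distrib]
  refine Finset.prod_eq_one fun b _ => ?_
  split_ifs
  · exact sgn_mul_self _
  · norm_num

theorem preSign_update_self (a : ZMod 2) (I : Fin k → Idx n m) (α : Fin k) (i : Idx n m) :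
    preSign a (Function.update I α i) α = preSign a I α := by
  refine Finset.prod_congr rfl fun β _ => ?_
  by_cases h : β < α
  · rw [Function.update_of_ne h.ne]
  · simp [h]

theorem preSign_update (a : ZMod 2) (I : Fin k → Idx n m) (α β : Fin k) (i : Idx n m) :
    preSign a (Function.update I α i) β =
      preSign a I β * if α < β then sgn (a * (par i + par (I α))) else 1 := by
  have h : preSign a (Function.update I α i) β * preSign a I β =
      if α < β then sgn (a * (par i + par (I α))) else 1 := by
    unfold preSign
    simp only [← Finset.prod_mul_distrib]
    rw [Fintype.prod_eq_single α]
    · simp only [Function.update_self]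
      split_ifs
      · rw [← sgn_add, mul_add]
      · simp
    · intro γ hγ
      rw [Function.update_of_ne hγ]
      split_ifs
      · exact sgn_mul_self _
      · norm_num
  rw [← h, mul_comm (preSign a (Function.update I α i) β), ← mul_assoc, preSign_mul_self, one_mul]

theorem e_apply (i j : Idx n m) : e i j = if j = i then 1 else 0 := by
  simp [e, Pi.single_apply]

theorem sum_smul_e (v : V n m) : ∑ i, v i • e i = v := by
  ext j
  simp [Finset.sum_apply, e_apply]

theorem parityOp_e (a : ZMod 2) (i : Idx n m) :
    parityOp n m a (e i) = (sgn (a * par i) : ℂ) • e i := by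
  ext j
  by_cases h : j = i
  · subst h; simp [parityOp, e_apply]
  · simp [parityOp, e_apply, h]

theorem act_vec (a : ZMod 2) (X : V n m →ₗ[ℂ] V n m) (I : Fin k → Idx n m) :
    act a X (vec I) =
      ∑ α, ∑ i, (X (e (I α)) i * preSign a I α) • vec (Function.update I α i) := by
  rw [act, LinearMap.sum_apply]
  refine Finset.sum_congr rfl fun α _ => ?_
  rw [vec, PiTensorProduct.map_tprod]
  have h : (fun β => (if β < α then parityOp n m a else if β = α then X else LinearMap.id)
      (e (I β))) = fun β => (if β < α then (sgn (a * par (I β)) : ℂ) else 1) •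
        Function.update (fun β => e (I β)) α (X (e (I α))) β := by
    funext β
    by_cases h1 : β < α
    · simp only [h1, if_true, Function.update_of_ne h1.ne, parityOp_e]
    · by_cases h2 : β = α
      · subst h2; simp
      · simp [h1, h2]
  rw [h, MultilinearMap.map_smul_univ]
  have h3 : (∏ β, if β < α then (sgn (a * par (I β)) : ℂ) else 1) = preSign a I α := by
    rw [preSign]; push_cast
    refine Finset.prod_congr rfl fun β _ => ?_
    split_ifs <;> simp
  have h4 : (PiTensorProduct.tprod ℂ) (Function.update (fun β => e (I β)) α (X (e (I α)))) =
      ∑ i, X (e (I α)) i • vec (Function.update I α i) := by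
    conv_lhs => rw [← sum_smul_e (X (e (I α)))]
    rw [MultilinearMap.map_update_sum]
    refine Finset.sum_congr rfl fun i _ => ?_
    rw [MultilinearMap.map_update_smul, vec]
    congr 2
    funext β
    by_cases h2 : β = α
    · subst h2; simp
    · simp [h2]
  rw [h3, h4, Finset.smul_sum]
  refine Finset.sum_congr rfl fun i _ => ?_
  rw [smul_smul, mul_comm]

theorem update_eq_iff (I K : Fin k → Idx n m) (α : Fin k) (i : Idx n m) :
    Function.update I α i = K ↔ i = K α ∧ I = Function.update K α (I α) := by
  constructor
  · rintro rfl; simp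
  · rintro ⟨rfl, h⟩
    rw [h]; simp

theorem coord_act (a : ZMod 2) (X : V n m →ₗ[ℂ] V n m) (z : T n m k) (K : Fin k → Idx n m) :
    coord K (act a X z) =
      ∑ α, ∑ j, X (e j) (K α) * preSign a K α * coord (Function.update K α j) z := by
  have h : coord K ∘ₗ act a X =
      ∑ α, ∑ j, (X (e j) (K α) * preSign a K α) • coord (Function.update K α j) := by
    refine hom_ext fun I => ?_
    simp only [LinearMap.comp_apply, act_vec, map_sum, map_smul, LinearMap.sum_apply,
      LinearMap.smul_apply, coord_vec, smul_eq_mul]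
    refine Finset.sum_congr rfl fun α _ => ?_
    by_cases hI : I = Function.update K α (I α)
    · rw [Fintype.sum_eq_single (K α), Fintype.sum_eq_single (I α)]
      · rw [← hI, if_pos rfl, if_pos ((update_eq_iff I K α _).2 ⟨rfl, hI⟩)]
        conv_lhs => rw [hI]
        rw [preSign_update_self]
        simp
      · intro j hj
        rw [if_neg, mul_zero]
        intro h; apply hj; rw [h]; simp
      · intro i hi
        rw [if_neg, mul_zero]
        intro h; exact hi ((update_eq_iff I K α i).1 h).1
    · rw [Finset.sum_eq_zero, Finset.sum_eq_zero]
      · intro j _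
        rw [if_neg, mul_zero]
        intro h; apply hI; conv_rhs => rw [h]
        simpa using h
      · intro i _
        rw [if_neg, mul_zero]
        intro h; exact hI ((update_eq_iff I K α i).1 h).2
  have := LinearMap.congr_fun h z
  simpa only [LinearMap.comp_apply, LinearMap.sum_apply, LinearMap.smul_apply, smul_eq_mul]
    using this

/-- `X` is homogeneous of parity `a`, in terms of matrix entries. -/
def Homog (a : ZMod 2) (X : V n m →ₗ[ℂ] V n m) : Prop :=
  ∀ i j, X (e j) i ≠ 0 → par i = a + par j

theorem par_eq_of_mem_part {b : ZMod 2} {u : V n m} (hu : u ∈ part n m b) {i : Idx n m}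
    (hi : u i ≠ 0) : par i = b := by
  have : ∀ i, par i ≠ b → u i = 0 := by
    refine Submodule.span_induction (p := fun u _ => ∀ i, par i ≠ b → u i = 0) ?_ ?_ ?_ ?_ hu
    · rintro _ ⟨j, hj, rfl⟩ i hi
      rw [e_apply, if_neg]
      rintro rfl
      exact hi hj
    · intro i _; rfl
    · intro x y _ _ hx hy i hi
      simp [hx i hi, hy i hi]
    · intro c x _ hx i hi
      simp [hx i hi]
  by_contra h
  exact hi (this i h)

theorem IsOsp.homog {a : ZMod 2} {X : V n m →ₗ[ℂ] V n m} (h : IsOsp a X) : Homog a X := by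
  intro i j hij
  exact par_eq_of_mem_part (h.homogeneous (par j) (e j)
    (Submodule.subset_span ⟨j, rfl, rfl⟩)) hij

/-- Replacing the letter at `α` changes its parity by `a`, which changes `permSign` by the signs of
the odd letters that cross `α`. These are the letters that lie before `α` on exactly one side of
`σ`, so the change equals the quotient of the two values of `preSign`. -/
theorem permAct_act {a : ZMod 2} {X : V n m →ₗ[ℂ] V n m} (hX : Homog a X) (σ : Fin k ≃ Fin l) :
    permAct n m σ ∘ₗ act a X = act a X ∘ₗ permAct n m σ := by
  refine hom_ext fun I => ?_
  rw [LinearMap.comp_apply, LinearMap.comp_apply, permAct_vec, map_smul, act_vec, act_vec,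
    ← Equiv.sum_comp σ, Finset.smul_sum]
  simp only [map_sum, map_smul]
  refine Finset.sum_congr rfl fun α _ => ?_
  rw [Finset.smul_sum]
  refine Finset.sum_congr rfl fun i _ => ?_
  rw [permAct_vec, smul_smul, smul_smul]
  have h1 : Function.update I α i ∘ σ.symm = Function.update (I ∘ σ.symm) (σ α) i := by
    funext β
    by_cases h : β = σ α
    · subst h; simp
    · have : σ.symm β ≠ α := by rintro rfl; simp at h
      simp [h, this]
  rw [h1]
  simp only [Function.comp_apply, Equiv.symm_apply_apply]
  by_cases h0 : X (e (I α)) i = 0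
  · simp [h0]
  refine congrArg (· • _) ?_
  have hp := hX i (I α) h0
  have key : preSign a I α * permSign σ (Function.update I α i) =
      permSign σ I * preSign a (I ∘ σ.symm) (σ α) := by
    rw [permSign_eq, permSign_eq]
    have h2 : (fun β => par (Function.update I α i β)) =
        Function.update (fun β => par (I β)) α (par i) := by
      funext β
      by_cases h : β = α
      · subst h; simp
      · simp [h]
    have h4 : par i + par (I α) = a := by
      rw [hp, add_assoc, CharTwo.add_self_eq_zero, add_zero]
    rw [h2, invSign_update, h4, mul_left_comm]
    congr 1
    unfold preSign
    rw [← Equiv.prod_comp σ (fun β => if β < σ α then sgn (a * par ((I ∘ σ.symm) β)) else 1),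
      ← Finset.prod_mul_distrib]
    refine Finset.prod_congr rfl fun β _ => ?_
    simp only [Function.comp_apply, Equiv.symm_apply_apply]
    have h5 : σ α = σ β ↔ α = β := σ.injective.eq_iff
    rcases lt_trichotomy α β with h | h | h <;> rcases lt_trichotomy (σ α) (σ β) with h' | h' | h' <;>
      first
      | (subst h; simp at h'; done)
      | (rw [h5] at h'; subst h'; simp at h; done)
      | (subst h; simp)
      | simp [h, h', h.not_gt, h'.not_gt, sgn_mul_self]
  have keyC := congrArg (Int.cast : ℤ → ℂ) key
  push_cast at keyC
  linear_combination X (e (I α)) i * keyC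

/-! ### Matrix units -/

/-- The matrix unit that sends `e_j` to `e_i`. -/
def matUnit (i j : Idx n m) : V n m →ₗ[ℂ] V n m :=
  LinearMap.smulRight (LinearMap.proj j) (e i)

theorem matUnit_e (i j p q : Idx n m) :
    matUnit i j (e q) p = if q = j ∧ p = i then 1 else 0 := by
  simp only [matUnit, LinearMap.smulRight_apply, LinearMap.proj_apply, e_apply, Pi.smul_apply,
    smul_eq_mul]
  by_cases h1 : q = j
  · subst h1; simp
  · simp [h1, Ne.symm h1]

/-- The action of a matrix unit on tensors. -/
noncomputable def gact (i j : Idx n m) : T n m k →ₗ[ℂ] T n m k := act (par i + par j) (matUnit i j)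

theorem homog_matUnit (i j : Idx n m) : Homog (par i + par j) (matUnit i j) := by
  intro p q h
  rw [matUnit_e] at h
  have : q = j ∧ p = i := by by_contra h'; simp [h'] at h
  rw [this.1, this.2, add_assoc, CharTwo.add_self_eq_zero, add_zero]

theorem gact_vec (i j : Idx n m) (I : Fin k → Idx n m) :
    gact i j (vec I) = ∑ α, if I α = j then
      (preSign (par i + par j) I α : ℂ) • vec (Function.update I α i) else 0 := by
  rw [gact, act_vec]
  refine Finset.sum_congr rfl fun α _ => ?_
  rw [Fintype.sum_eq_single i]
  · rw [matUnit_e]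
    by_cases h : I α = j <;> simp [h]
  · intro p hp
    rw [matUnit_e]
    simp [hp]

theorem coord_gact (i j : Idx n m) (z : T n m k) (K : Fin k → Idx n m) :
    coord K (gact i j z) = ∑ α, if K α = i then
      (preSign (par i + par j) K α : ℂ) * coord (Function.update K α j) z else 0 := by
  rw [gact, coord_act]
  refine Finset.sum_congr rfl fun α _ => ?_
  rw [Fintype.sum_eq_single j]
  · rw [matUnit_e]
    by_cases h : K α = i <;> simp [h]
  · intro p hp
    rw [matUnit_e]
    simp [hp]

theorem permAct_gact (σ : Fin k ≃ Fin l) (i j : Idx n m) :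
    permAct n m σ ∘ₗ gact i j = gact i j ∘ₗ permAct n m σ :=
  permAct_act (homog_matUnit i j) σ

/-- `act a X` computes its signs with the parity `a`, `gact i j` with the parity of the matrix unit;
they agree wherever the homogeneous `X` has a nonzero entry. -/
theorem act_eq_sum_gact {a : ZMod 2} {X : V n m →ₗ[ℂ] V n m} (hX : Homog a X) :
    (act a X : T n m k →ₗ[ℂ] T n m k) = ∑ i, ∑ j, X (e j) i • gact i j := by
  refine hom_ext fun I => ?_
  simp only [act_vec, LinearMap.sum_apply, LinearMap.smul_apply, gact_vec, Finset.smul_sum]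
  rw [Finset.sum_comm]
  refine Finset.sum_congr rfl fun i _ => ?_
  rw [Finset.sum_comm]
  refine Finset.sum_congr rfl fun α _ => ?_
  rw [Fintype.sum_eq_single (I α)]
  · rw [if_pos rfl, smul_smul]
    by_cases h0 : X (e (I α)) i = 0
    · simp [h0]
    · rw [hX i (I α) h0, add_assoc, CharTwo.add_self_eq_zero, add_zero]
  · intro j hj
    rw [if_neg (Ne.symm hj), smul_zero]

theorem permAct_young_comm {A : T n m k →ₗ[ℂ] T n m k} {a b : ℕ} (t : Fin a × Fin b ≃ Fin k)
    (hA : ∀ σ : Equiv.Perm (Fin k), permAct n m σ ∘ₗ A = A ∘ₗ permAct n m σ) :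
    young n m t ∘ₗ A = A ∘ₗ young n m t := by
  have h : ∀ σ z, permAct n m σ (A z) = A (permAct n m σ z) :=
    fun σ z => LinearMap.congr_fun (hA σ) z
  refine LinearMap.ext fun z => ?_
  simp only [young, LinearMap.comp_apply, LinearMap.sum_apply, LinearMap.smul_apply, map_sum,
    map_smul, h]

theorem young_gact {a b : ℕ} (t : Fin a × Fin b ≃ Fin k) (i j : Idx n m) :
    young n m t ∘ₗ gact i j = gact i j ∘ₗ young n m t :=
  permAct_young_comm t fun σ => permAct_gact σ i j

end

/-! ### Casimir operators, and positivity on tensors with rectangular symmetry. -/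

section


variable {n m k l : ℕ}

/-! ### Transpositions and quadratic Casimir operators -/

/-- With both moved elements made even the sign is 1; restoring their parities one after the other
with `invSign_update` produces the stated factors. -/
theorem invSign_swap (P : Fin k → ZMod 2) {x y : Fin k} (hxy : x ≠ y) :
    invSign P Fin.val (fun α => (Equiv.swap x y α).val) = sgn (P x * P y) *
      ∏ b, if (x < b ∧ b < y) ∨ (y < b ∧ b < x) then sgn ((P x + P y) * P b) else 1 := by
  set P0 := Function.update (Function.update P x 0) y 0 with hP0
  have h0 : invSign P0 Fin.val (fun α => (Equiv.swap x y α).val) = 1 := by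
    refine Finset.prod_eq_one fun a _ => Finset.prod_eq_one fun b _ => if_neg ?_
    rintro ⟨h1, h2, h3, h4⟩
    beta_reduce at h2
    have key : ∀ c, P0 c = 1 → c ≠ x ∧ c ≠ y := by
      intro c hc
      constructor
      · rintro rfl
        rw [hP0, Function.update_of_ne hxy, Function.update_self] at hc
        exact zero_ne_one hc
      · rintro rfl
        rw [hP0, Function.update_self] at hc
        exact zero_ne_one hc
    rw [Equiv.swap_apply_of_ne_of_ne (key a h3).1 (key a h3).2,
      Equiv.swap_apply_of_ne_of_ne (key b h4).1 (key b h4).2] at h2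
    omega
  have h1 : P = Function.update (Function.update P0 y (P y)) x (P x) := by
    funext c
    by_cases hx : c = x
    · subst hx; simp
    · by_cases hy : c = y
      · subst hy; simp [hx]
      · simp [hP0, hx, hy]
  conv_lhs => rw [h1]
  rw [invSign_update, invSign_update, h0, one_mul, ← Finset.prod_mul_distrib]
  have h2 : sgn (P x * P y) = ∏ b, if b = y then sgn (P x * P y) else 1 := by simp
  rw [h2, ← Finset.prod_mul_distrib]
  refine Finset.prod_congr rfl fun b _ => ?_
  have e1 : P0 y = 0 := by simp [hP0]
  have e2 : Function.update P0 y (P y) x = 0 := by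
    rw [Function.update_of_ne hxy]; simp [hP0, hxy]
  rw [e1, e2, add_zero, add_zero, Equiv.swap_apply_left, Equiv.swap_apply_right]
  by_cases hbx : b = x
  · subst hbx
    have : P0 b = 0 := by simp [hP0, hxy]
    simp [this, hxy, sgn_zero]
  by_cases hby : b = y
  · subst hby
    rw [Equiv.swap_apply_right]
    rcases lt_or_gt_of_ne hbx with h | h <;> simp [h, h.not_gt]
  · have e3 : P0 b = P b := by simp [hP0, hbx, hby]
    rw [Equiv.swap_apply_of_ne_of_ne hbx hby, Function.update_of_ne hby, e3, add_mul, sgn_add,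
      mul_comm (sgn (P x * P b)), if_neg hby, one_mul]
    simp only [← Fin.lt_def]
    by_cases c1 : x < b <;> by_cases c2 : b < y <;> by_cases c3 : y < b <;>
      by_cases c4 : b < x <;> first | omega | simp [c1, c2, c3, c4]

theorem permSign_swap (I : Fin k → Idx n m) {x y : Fin k} (hxy : x ≠ y) :
    permSign (Equiv.swap x y) I = sgn (par (I x) * par (I y)) *
      ∏ b, if (x < b ∧ b < y) ∨ (y < b ∧ b < x) then
        sgn ((par (I x) + par (I y)) * par (I b)) else 1 := by
  rw [permSign_eq, invSign_swap _ hxy]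

theorem permSign_swap_of_par_eq (I : Fin k → Idx n m) {x y : Fin k} (hxy : x ≠ y)
    (h : par (I x) = par (I y)) : permSign (Equiv.swap x y) I = sgn (par (I x)) := by
  rw [permSign_swap I hxy, h, CharTwo.add_self_eq_zero]
  rcases zmod_two_cases (par (I y)) with h | h <;> simp [h, sgn_zero]

/-- Matrix units that exchange the letters in two positions do so with the sign of the
transposition, up to the parity of the letter at `x`: the letters before both positions count twice,
those between them once. -/
theorem preSign_mul_preSign_swap (I : Fin k → Idx n m) {x y : Fin k} (hxy : x ≠ y)
    {p : Idx n m} (hp : par p = par (I x)) :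
    preSign (par (I x) + par (I y)) I y *
      preSign (par (I x) + par (I y)) (Function.update I y p) x =
      sgn (par (I x)) * permSign (Equiv.swap x y) I := by
  rw [preSign_update, permSign_swap I hxy, hp, ← mul_assoc]
  have h1 : preSign (par (I x) + par (I y)) I y * preSign (par (I x) + par (I y)) I x =
      sgn ((par (I x) + par (I y)) * (if x < y then par (I x) else par (I y))) *
      ∏ b, if (x < b ∧ b < y) ∨ (y < b ∧ b < x) then
        sgn ((par (I x) + par (I y)) * par (I b)) else 1 := by
    have h2 : sgn ((par (I x) + par (I y)) * (if x < y then par (I x) else par (I y))) =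
      ∏ b, if b = min x y then
        sgn ((par (I x) + par (I y)) * par (I b)) else 1 := by
      rw [Finset.prod_ite_eq' Finset.univ (min x y), if_pos (Finset.mem_univ _)]
      split_ifs with h
      · rw [min_eq_left h.le]
      · rw [min_eq_right (not_lt.1 h)]
    rw [h2, preSign, preSign, ← Finset.prod_mul_distrib, ← Finset.prod_mul_distrib]
    refine Finset.prod_congr rfl fun b _ => ?_
    rcases lt_or_gt_of_ne hxy with h | h
    · rw [min_eq_left h.le]
      rcases lt_trichotomy b x with h3 | h3 | h3
      · simp [h3, h3.trans h, h3.ne, h3.not_gt, (h3.trans h).not_gt, sgn_mul_self]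
      · subst h3; simp [h, h.not_gt]
      · simp [h3, h3.not_gt, h3.ne']
    · rw [min_eq_right h.le]
      rcases lt_trichotomy b y with h3 | h3 | h3
      · simp [h3, h3.trans h, h3.ne, h3.not_gt, (h3.trans h).not_gt, sgn_mul_self]
      · subst h3; simp [h, h.not_gt]
      · simp [h3, h3.not_gt, h3.ne']
  rw [h1]
  generalize (∏ b, if (x < b ∧ b < y) ∨ (y < b ∧ b < x) then
        sgn ((par (I x) + par (I y)) * par (I b)) else 1) = Q
  rcases lt_or_gt_of_ne hxy with h | h
  · rw [if_pos h, if_neg h.not_gt]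
    generalize par (I x) = a
    generalize par (I y) = b
    rw [mul_one, ← mul_assoc]
    congr 1
    revert a b; decide
  · rw [if_neg h.not_gt, if_pos h]
    generalize par (I x) = a
    generalize par (I y) = b
    rw [mul_right_comm, ← mul_assoc]
    congr 1
    revert a b; decide

/-- The projection on the tensors whose factor in the position `y` has parity `b`. -/
noncomputable def parProj (n m : ℕ) (y : Fin k) (b : ZMod 2) : T n m k →ₗ[ℂ] T n m k :=
  (vecBasis n m k).constr ℂ fun I => if par (I y) = b then vec I else 0

theorem parProj_vec (y : Fin k) (b : ZMod 2) (I : Fin k → Idx n m) :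
    parProj n m y b (vec I) = if par (I y) = b then vec I else 0 := by
  conv_lhs => rw [parProj, ← vecBasis_apply, Module.Basis.constr_basis]

theorem coord_parProj (y : Fin k) (b : ZMod 2) (z : T n m k) (K : Fin k → Idx n m) :
    coord K (parProj n m y b z) = if par (K y) = b then coord K z else 0 := by
  have : coord K ∘ₗ parProj n m y b = (if par (K y) = b then (1 : ℂ) else 0) • coord K := by
    refine hom_ext fun I => ?_
    rw [LinearMap.comp_apply, parProj_vec, LinearMap.smul_apply, coord_vec]
    by_cases h : I = K
    · subst h
      by_cases h1 : par (I y) = b <;> simp [coord_vec, h1]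
    · split_ifs <;> simp [coord_vec, h]
  have := LinearMap.congr_fun this z
  rw [LinearMap.comp_apply, LinearMap.smul_apply] at this
  rw [this]; split_ifs <;> simp

/-- In E_qp E_pq v_I both factors act in the same position, which restores v_I once for every letter
p of parity `a`, or in two different positions, which exchanges their letters. So each parity block
of the quadratic Casimir is a count plus a sum of transpositions, and the latter are controlled by a
Young symmetrizer. -/
theorem casimir (a b : ZMod 2) (I : Fin k → Idx n m) :
    ∑ p : Idx n m, ∑ q : Idx n m, (if par p = a ∧ par q = b then
      gact q p (gact p q (vec I)) else 0) =
    ∑ y, (if par (I y) = b then (Fintype.card {p : Idx n m // par p = a} : ℂ) • vec I +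
      (sgn a : ℂ) • ∑ x, (if x ≠ y ∧ par (I x) = a then
        permAct n m (Equiv.swap x y) (vec I) else 0) else 0) := by
  have h1 : ∀ p q : Idx n m, gact q p (gact p q (vec I)) = ∑ y, if I y = q then
      vec I + ∑ x, (if x ≠ y ∧ I x = p then ((sgn (par p) : ℂ) •
        permAct n m (Equiv.swap x y) (vec I)) else 0) else 0 := by
    intro p q
    rw [gact_vec, map_sum]
    refine Finset.sum_congr rfl fun y _ => ?_
    by_cases hy : I y = q
    · rw [if_pos hy, if_pos hy, map_smul, gact_vec, Finset.smul_sum,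
        Fintype.sum_eq_add_sum_compl y]
      congr 1
      · rw [Function.update_self, if_pos rfl, preSign_update_self, smul_smul, add_comm (par q)]
        have := preSign_mul_self (par p + par q) I y
        have h : ((preSign (par p + par q) I y : ℤ) : ℂ) * (preSign (par p + par q) I y : ℤ) = 1 := by
          exact_mod_cast this
        rw [h, one_smul, ← hy]
        simp
      · rw [Fintype.sum_eq_add_sum_compl y, if_neg (by simp), zero_add]
        refine Finset.sum_congr rfl fun x hx => ?_
        have hxy : x ≠ y := by simpa using hx
        rw [Function.update_of_ne hxy]
        by_cases hp : I x = p
        · rw [if_pos hp, if_pos ⟨hxy, hp⟩, smul_smul, permAct_vec, smul_smul]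
          have h2 : Function.update (Function.update I y p) x q =
              I ∘ (Equiv.swap x y).symm := by
            funext c
            rw [Equiv.symm_swap, Function.comp_apply]
            by_cases hx : c = x
            · subst hx; simp [hy]
            · by_cases hy' : c = y
              · subst hy'; simp [hp, hxy.symm]
              · simp [hx, hy', Equiv.swap_apply_of_ne_of_ne hx hy']
          rw [h2]
          congr 1
          have := preSign_mul_preSign_swap I hxy (p := p) (by rw [hp])
          rw [hp, hy] at this
          rw [add_comm (par q)]
          exact_mod_cast this
        · rw [if_neg hp, if_neg (fun h => hp h.2), smul_zero]
    · rw [if_neg hy, if_neg hy, map_zero]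
  simp only [h1]
  have h2 : ∀ p q : Idx n m, (if par p = a ∧ par q = b then (∑ y, if I y = q then
      vec I + ∑ x, (if x ≠ y ∧ I x = p then ((sgn (par p) : ℂ) •
        permAct n m (Equiv.swap x y) (vec I)) else 0) else 0) else 0) =
      ∑ y, if I y = q then (if par p = a ∧ par q = b then
      vec I + ∑ x, (if x ≠ y ∧ I x = p then ((sgn (par p) : ℂ) •
        permAct n m (Equiv.swap x y) (vec I)) else 0) else 0) else 0 := by
    intro p q
    by_cases h : par p = a ∧ par q = b
    · simp only [if_pos h]
    · simp only [if_neg h, ite_self, Finset.sum_const_zero]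
  simp only [h2]
  have h3 : ∀ p : Idx n m, (∑ q, ∑ y, if I y = q then (if par p = a ∧ par q = b then
      vec I + ∑ x, (if x ≠ y ∧ I x = p then ((sgn (par p) : ℂ) •
        permAct n m (Equiv.swap x y) (vec I)) else 0) else 0) else 0) =
      ∑ y, (if par p = a ∧ par (I y) = b then
      vec I + ∑ x, (if x ≠ y ∧ I x = p then ((sgn (par p) : ℂ) •
        permAct n m (Equiv.swap x y) (vec I)) else 0) else 0) := by
    intro p
    rw [Finset.sum_comm]
    refine Finset.sum_congr rfl fun y _ => ?_
    rw [Finset.sum_ite_eq Finset.univ (I y), if_pos (Finset.mem_univ _)]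
  simp only [h3]
  rw [Finset.sum_comm]
  refine Finset.sum_congr rfl fun y _ => ?_
  by_cases hy : par (I y) = b
  · simp only [hy, and_true, if_true]
    rw [← Finset.sum_filter, Finset.sum_add_distrib, Finset.sum_const, ← Fintype.card_subtype,
      ← Nat.cast_smul_eq_nsmul ℂ]
    congr 1
    rw [Finset.sum_comm, Finset.smul_sum]
    refine Finset.sum_congr rfl fun x _ => ?_
    rw [Finset.sum_filter]
    by_cases hx : x ≠ y ∧ par (I x) = a
    · rw [if_pos hx, Fintype.sum_eq_single (I x)]
      · rw [if_pos hx.2, if_pos ⟨hx.1, rfl⟩, hx.2]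
      · intro p hp
        have h5 : ¬ (x ≠ y ∧ I x = p) := fun h => hp h.2.symm
        simp only [if_neg h5, ite_self]
    · rw [if_neg hx, smul_zero]
      refine Finset.sum_eq_zero fun p _ => ?_
      split_ifs with h4 h5
      · exact absurd ⟨h5.1, by rw [h5.2, h4]⟩ hx
      · rfl
      · rfl
  · simp [hy]

theorem card_par_zero : Fintype.card {p : Idx n m // par p = 0} = n := by
  rw [Fintype.card_subtype]
  have : (Finset.univ.filter fun p : Idx n m => par p = 0) =
      Finset.univ.map ⟨Sum.inl, Sum.inl_injective⟩ := by
    ext p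
    simp only [Finset.mem_filter, Finset.mem_univ, true_and]
    cases p <;> simp [par]
  rw [this]; simp

theorem card_par_one : Fintype.card {p : Idx n m // par p = 1} = m := by
  rw [Fintype.card_subtype]
  have : (Finset.univ.filter fun p : Idx n m => par p = 1) =
      Finset.univ.map ⟨Sum.inr, Sum.inr_injective⟩ := by
    ext p
    simp only [Finset.mem_filter, Finset.mem_univ, true_and]
    cases p <;> simp [par]
  rw [this]; simp

end

section


variable {n m k l : ℕ}

/-! ### Vectors of maximal weight are even -/

theorem casimir_apply (a b : ZMod 2) (z : T n m k) :
    ∑ p : Idx n m, ∑ q : Idx n m, (if par p = a ∧ par q = b then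
      gact q p (gact p q z) else 0) =
    (Fintype.card {p : Idx n m // par p = a} : ℂ) • ∑ y, parProj n m y b z +
      (sgn a : ℂ) • ∑ y, ∑ x, (if x ≠ y then
        permAct n m (Equiv.swap x y) (parProj n m x a (parProj n m y b z)) else 0) := by
  have h : (∑ p : Idx n m, ∑ q : Idx n m, (if par p = a ∧ par q = b then
      gact q p ∘ₗ gact p q else 0) : T n m k →ₗ[ℂ] T n m k) =
    (Fintype.card {p : Idx n m // par p = a} : ℂ) • ∑ y, parProj n m y b +
      (sgn a : ℂ) • ∑ y, ∑ x, (if x ≠ y then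
        permAct n m (Equiv.swap x y) ∘ₗ parProj n m x a ∘ₗ parProj n m y b else 0) := by
    refine hom_ext fun I => ?_
    have := casimir a b I
    have e1 : ∀ (c : Prop) [Decidable c] (A : T n m k →ₗ[ℂ] T n m k) (w : T n m k),
        (if c then A else 0) w = if c then A w else 0 := by
      intro c _ A w; split_ifs <;> simp
    simp only [LinearMap.sum_apply, LinearMap.add_apply, LinearMap.smul_apply, e1,
      LinearMap.comp_apply, parProj_vec]
    rw [this, Finset.smul_sum, Finset.smul_sum, ← Finset.sum_add_distrib]
    refine Finset.sum_congr rfl fun y _ => ?_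
    by_cases hy : par (I y) = b
    · simp only [if_pos hy]
      congr 2
      refine Finset.sum_congr rfl fun x _ => ?_
      by_cases h1 : x ≠ y <;> by_cases h2 : par (I x) = a <;> simp [h1, h2, parProj_vec]
    · simp [hy]
  have := LinearMap.congr_fun h z
  have e1 : ∀ (c : Prop) [Decidable c] (A : T n m k →ₗ[ℂ] T n m k) (w : T n m k),
      (if c then A else 0) w = if c then A w else 0 := by
    intro c _ A w; split_ifs <;> simp
  simpa only [LinearMap.sum_apply, LinearMap.add_apply, LinearMap.smul_apply, e1,
    LinearMap.comp_apply] using this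

theorem permAct_parProj (σ : Fin k ≃ Fin l) (y : Fin k) (b : ZMod 2) (z : T n m k) :
    permAct n m σ (parProj n m y b z) = parProj n m (σ y) b (permAct n m σ z) := by
  refine tensor_ext fun K => ?_
  rw [coord_permAct, coord_parProj, coord_parProj, coord_permAct]
  simp

theorem parProj_zero_add_one (x : Fin k) (z : T n m k) :
    parProj n m x 0 z + parProj n m x 1 z = z := by
  refine tensor_ext fun K => ?_
  rw [map_add, coord_parProj, coord_parProj]
  rcases zmod_two_cases (par (K x)) with h | h <;> simp [h]

/-- E_ij and E_ji are adjoint for the Hermitian product with orthonormal basis v_I. Equal parities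
are needed because otherwise the signs of `preSign` enter. -/
theorem sum_conj_coord_gact {i j : Idx n m} (hij : par i = par j) (z w : T n m k) :
    ∑ K, starRingEnd ℂ (coord K z) * coord K (gact i j w) =
      ∑ K, starRingEnd ℂ (coord K (gact j i z)) * coord K w := by
  simp only [coord_gact, hij, CharTwo.add_self_eq_zero, preSign_zero, Int.cast_one, one_mul,
    map_sum, Finset.mul_sum, Finset.sum_mul]
  rw [Finset.sum_comm]
  conv_rhs => rw [Finset.sum_comm]
  refine Finset.sum_congr rfl fun α _ => ?_
  simp only [mul_ite, mul_zero, ite_mul, zero_mul, apply_ite (starRingEnd ℂ), map_zero]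
  rw [← Finset.sum_filter, ← Finset.sum_filter]
  refine Finset.sum_bij' (fun K _ => Function.update K α j) (fun K _ => Function.update K α i)
    ?_ ?_ ?_ ?_ ?_
  · intro K _; simp
  · intro K _; simp
  · intro K hK
    have : K α = i := by simpa using hK
    simp [← this]
  · intro K hK
    have : K α = j := by simpa using hK
    simp [← this]
  · intro K hK
    have : K α = i := by simpa using hK
    simp [← this]

/-- A tensor with the symmetry of a rectangle of `n` rows and `m + 1` columns that is annihilated
by the positive odd root vectors has no odd factors. -/
theorem coord_eq_zero_of_killed (z : T n m k)
    (h1 : ∀ x, ∑ y, (if y ≠ x then permAct n m (Equiv.swap x y) z else 0) =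
      ((m : ℂ) + 1 - n) • z)
    (h2 : ∀ p q : Idx n m, par p = 0 → par q = 1 → gact p q z = 0)
    (K : Fin k → Idx n m) (α : Fin k) (hα : par (K α) = 1) : coord K z = 0 := by
  -- `N` is `z` with each coordinate multiplied by its number of odd letters (`hcN`); `A` and `M`
  -- collect the transpositions of an odd letter with another odd letter, respectively with an even
  -- one.
  set N := ∑ y, parProj n m y 1 z with hN
  set A := ∑ y, ∑ x, (if x ≠ y then
        permAct n m (Equiv.swap x y) (parProj n m x 1 (parProj n m y 1 z)) else 0) with hA
  set M := ∑ y, ∑ x, (if x ≠ y then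
        permAct n m (Equiv.swap x y) (parProj n m x 0 (parProj n m y 1 z)) else 0) with hM
  have c01 := casimir_apply 0 1 z
  have c11 := casimir_apply 1 1 z
  rw [card_par_zero, sgn_zero, ← hN, ← hM, Int.cast_one, one_smul] at c01
  rw [card_par_one, sgn_one, ← hN, ← hA] at c11
  have hzero : (∑ p : Idx n m, ∑ q : Idx n m, (if par p = 0 ∧ par q = 1 then
      gact q p (gact p q z) else 0)) = 0 := by
    refine Finset.sum_eq_zero fun p _ => Finset.sum_eq_zero fun q _ => ?_
    split_ifs with h
    · rw [h2 p q h.1 h.2, map_zero]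
    · rfl
  rw [hzero] at c01
  -- Adding the two parities at `x` removes that projection, and after the transposition the odd
  -- letter stands at `x`; then `h1` evaluates the sum over the other position.
  have hMA : M + A = ((m : ℂ) + 1 - n) • N := by
    rw [hM, hA, ← Finset.sum_add_distrib]
    have : ∀ y : Fin k, (∑ x, (if x ≠ y then
        permAct n m (Equiv.swap x y) (parProj n m x 0 (parProj n m y 1 z)) else 0)) +
        (∑ x, (if x ≠ y then
        permAct n m (Equiv.swap x y) (parProj n m x 1 (parProj n m y 1 z)) else 0)) =
        ∑ x, parProj n m x 1 (if y ≠ x then permAct n m (Equiv.swap x y) z else 0) := by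
      intro y
      rw [← Finset.sum_add_distrib]
      refine Finset.sum_congr rfl fun x _ => ?_
      by_cases hxy : x = y
      · simp [hxy]
      · rw [if_pos hxy, if_pos hxy, if_pos (Ne.symm hxy), ← map_add, parProj_zero_add_one,
          permAct_parProj, Equiv.swap_apply_right]
    simp only [this]
    rw [Finset.sum_comm, hN, Finset.smul_sum]
    refine Finset.sum_congr rfl fun x _ => ?_
    rw [← map_sum, h1 x, map_smul]
  -- Since `z` is killed, M = -nN, and so A = (m+1)N and the odd-odd Casimir is mN - A = -N. The one
  -- column in excess of m makes it negative.
  have hC : (∑ p : Idx n m, ∑ q : Idx n m, (if par p = 1 ∧ par q = 1 then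
      gact q p (gact p q z) else 0)) = -N := by
    have hA' : A = ((m : ℂ) + 1 - n) • N - M := by rw [← hMA]; abel
    have hM' : M = -((n : ℂ) • N) := by
      rw [eq_neg_iff_add_eq_zero, add_comm]; exact c01.symm
    have aux : ∀ {E : Type} [AddCommGroup E] [Module ℂ E] (w : E), (m : ℂ) • w +
        ((-1 : ℤ) : ℂ) • (((m : ℂ) + 1 - n) • w - -((n : ℂ) • w)) = -w := by
      intro E _ _ w
      rw [Int.cast_neg, Int.cast_one]
      module
    rw [c11, hA', hM']
    exact aux N
  have hcN : ∀ K, coord K N = (∑ y, if par (K y) = 1 then (1 : ℂ) else 0) * coord K z := by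
    intro K
    rw [hN, map_sum, Finset.sum_mul]
    refine Finset.sum_congr rfl fun y _ => ?_
    rw [coord_parProj]; split_ifs <;> simp
  -- Pairing with `z`: squared norms plus the squared coordinates weighted by their numbers of odd
  -- letters sum to zero, so every coordinate with an odd letter vanishes.
  have hsum : ∑ p : Idx n m, ∑ q : Idx n m, (if par p = 1 ∧ par q = 1 then
      ∑ K, starRingEnd ℂ (coord K (gact p q z)) * coord K (gact p q z) else 0) +
      ∑ K, starRingEnd ℂ (coord K z) * coord K N = 0 := by
    have h3 := congrArg (fun w => ∑ K, starRingEnd ℂ (coord K z) * coord K w) hC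
    simp only [map_neg, mul_neg, Finset.sum_neg_distrib] at h3
    rw [← eq_neg_iff_add_eq_zero, ← h3]
    have h4 : ∀ w : Idx n m → Idx n m → T n m k,
        ∑ K, starRingEnd ℂ (coord K z) * coord K (∑ p, ∑ q, w p q) =
          ∑ p, ∑ q, ∑ K, starRingEnd ℂ (coord K z) * coord K (w p q) := by
      intro w
      simp only [map_sum, Finset.mul_sum]
      rw [Finset.sum_comm]
      exact Finset.sum_congr rfl fun p _ => Finset.sum_comm
    rw [h4]
    refine Finset.sum_congr rfl fun p _ => Finset.sum_congr rfl fun q _ => ?_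
    by_cases h : par p = 1 ∧ par q = 1
    · simp only [if_pos h]
      exact (sum_conj_coord_gact (by rw [h.1, h.2]) z _).symm
    · simp [h]
  have hre := congrArg Complex.re hsum
  have hterm : ∀ w : ℂ, (starRingEnd ℂ w * w) = ((Complex.normSq w : ℝ) : ℂ) := by
    intro w; rw [mul_comm, Complex.mul_conj]
  have hpos : ∀ K : Fin k → Idx n m, starRingEnd ℂ (coord K z) * coord K N =
      (((∑ y, if par (K y) = 1 then (1 : ℝ) else 0) * Complex.normSq (coord K z) : ℝ) : ℂ) := by
    intro K
    have hs : ((∑ y, if par (K y) = 1 then (1 : ℝ) else 0 : ℝ) : ℂ) =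
        ∑ y, if par (K y) = 1 then (1 : ℂ) else 0 := by
      rw [Complex.ofReal_sum]
      exact Finset.sum_congr rfl fun y _ => by split_ifs <;> simp
    rw [hcN, Complex.ofReal_mul, hs, ← hterm]
    ring
  simp only [hterm, hpos] at hre
  rw [Complex.add_re, Complex.re_sum, Complex.re_sum] at hre
  simp only [Complex.ofReal_re, Complex.zero_re] at hre
  have hp1 : 0 ≤ ∑ p : Idx n m, (∑ q : Idx n m, (if par p = 1 ∧ par q = 1 then
      ∑ K, ((Complex.normSq (coord K (gact p q z)) : ℝ) : ℂ) else 0)).re := by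
    refine Finset.sum_nonneg fun p _ => ?_
    rw [Complex.re_sum]
    refine Finset.sum_nonneg fun q _ => ?_
    split_ifs
    · rw [Complex.re_sum]
      exact Finset.sum_nonneg fun K _ => by
        rw [Complex.ofReal_re]; exact Complex.normSq_nonneg _
    · simp
  have hp2 : ∀ K ∈ (Finset.univ : Finset (Fin k → Idx n m)),
      0 ≤ (∑ y, if par (K y) = 1 then (1 : ℝ) else 0) * Complex.normSq (coord K z) := by
    intro K _
    refine mul_nonneg (Finset.sum_nonneg fun y _ => ?_) (Complex.normSq_nonneg _)
    split_ifs <;> norm_num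
  have hp3 := Finset.sum_nonneg hp2
  have h0 := (Finset.sum_eq_zero_iff_of_nonneg hp2).1 (by linarith) K (Finset.mem_univ _)
  rcases mul_eq_zero.1 h0 with h | h
  · exfalso
    have := Finset.single_le_sum (f := fun y => if par (K y) = 1 then (1 : ℝ) else 0)
      (fun y _ => by split_ifs <;> norm_num) (Finset.mem_univ α)
    simp only [hα, if_true] at this
    linarith
  · exact Complex.normSq_eq_zero.1 h

end

/-! ### The group algebra of the symmetric group and rectangular Young symmetrizers. -/

section


variable {n m k l : ℕ}

/-! ### Row and column sums in the group algebra -/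

/-- The sign representation of the symmetric group on tensors. -/
noncomputable def permRep (n m k : ℕ) : Equiv.Perm (Fin k) →* Module.End ℂ (T n m k) where
  toFun σ := permAct n m σ
  map_one' := permAct_refl
  map_mul' σ τ := permAct_mul σ τ

/-- The group algebra of the symmetric group. -/
abbrev PermAlg (k : ℕ) := MonoidAlgebra ℂ (Equiv.Perm (Fin k))

/-- The action of the group algebra on tensors. -/
noncomputable def algRep (n m k : ℕ) : PermAlg k →ₐ[ℂ] Module.End ℂ (T n m k) :=
  MonoidAlgebra.lift ℂ (Module.End ℂ (T n m k)) (Equiv.Perm (Fin k)) (permRep n m k)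

/-- A permutation as an element of the group algebra. -/
noncomputable def ofPerm (σ : Equiv.Perm (Fin k)) : PermAlg k := MonoidAlgebra.of ℂ _ σ

theorem ofPerm_mul (σ τ : Equiv.Perm (Fin k)) : ofPerm (σ * τ) = ofPerm σ * ofPerm τ :=
  map_mul _ _ _

theorem ofPerm_one : ofPerm (1 : Equiv.Perm (Fin k)) = 1 := map_one _

theorem algRep_ofPerm (σ : Equiv.Perm (Fin k)) : algRep n m k (ofPerm σ) = permAct n m σ := by
  rw [algRep, ofPerm, MonoidAlgebra.lift_of]; rfl

variable {a b : ℕ} (t : Fin a × Fin b ≃ Fin k)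

/-- The row of a position of a tableau. -/
def rowOf (x : Fin k) : Fin a := (t.symm x).1

/-- The column of a position of a tableau. -/
def colOf (x : Fin k) : Fin b := (t.symm x).2

variable {t}

theorem eq_of_rowOf_of_colOf {x y : Fin k} (h1 : rowOf t x = rowOf t y)
    (h2 : colOf t x = colOf t y) : x = y :=
  t.symm.injective (Prod.ext h1 h2)

theorem mem_rowStab {σ : Equiv.Perm (Fin k)} :
    σ ∈ rowStab t ↔ ∀ x, rowOf t (σ x) = rowOf t x := by simp [rowStab, rowOf]

theorem mem_colStab {σ : Equiv.Perm (Fin k)} :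
    σ ∈ colStab t ↔ ∀ x, colOf t (σ x) = colOf t x := by simp [colStab, colOf]

theorem mul_mem_rowStab {σ τ : Equiv.Perm (Fin k)} (h : σ ∈ rowStab t) (h' : τ ∈ rowStab t) :
    σ * τ ∈ rowStab t := by
  rw [mem_rowStab] at *
  intro x; rw [Equiv.Perm.mul_apply, h, h']

theorem mul_mem_colStab {σ τ : Equiv.Perm (Fin k)} (h : σ ∈ colStab t) (h' : τ ∈ colStab t) :
    σ * τ ∈ colStab t := by
  rw [mem_colStab] at *
  intro x; rw [Equiv.Perm.mul_apply, h, h']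

theorem inv_mem_rowStab {σ : Equiv.Perm (Fin k)} (h : σ ∈ rowStab t) : σ⁻¹ ∈ rowStab t := by
  rw [mem_rowStab] at *
  intro x; rw [← h (σ⁻¹ x)]; simp

theorem inv_mem_colStab {σ : Equiv.Perm (Fin k)} (h : σ ∈ colStab t) : σ⁻¹ ∈ colStab t := by
  rw [mem_colStab] at *
  intro x; rw [← h (σ⁻¹ x)]; simp

theorem swap_mem_rowStab {x y : Fin k} (h : rowOf t x = rowOf t y) :
    Equiv.swap x y ∈ rowStab t := by
  rw [mem_rowStab]
  intro z
  rw [Equiv.swap_apply_def]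
  split_ifs with h1 h2
  · rw [h1, h]
  · rw [h2, h]
  · rfl

theorem swap_mem_colStab {x y : Fin k} (h : colOf t x = colOf t y) :
    Equiv.swap x y ∈ colStab t := by
  rw [mem_colStab]
  intro z
  rw [Equiv.swap_apply_def]
  split_ifs with h1 h2
  · rw [h1, h]
  · rw [h2, h]
  · rfl

variable (t)

/-- The sum of the row stabilizer. -/
noncomputable def rowSum : PermAlg k := ∑ σ ∈ rowStab t, ofPerm σ

/-- The signed sum of the column stabilizer. -/
noncomputable def colSum : PermAlg k := ∑ τ ∈ colStab t, ((Equiv.Perm.sign τ : ℤ) : ℂ) • ofPerm τ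

variable {t}

theorem ofPerm_mul_rowSum {σ : Equiv.Perm (Fin k)} (h : σ ∈ rowStab t) :
    ofPerm σ * rowSum t = rowSum t := by
  rw [rowSum, Finset.mul_sum]
  refine Finset.sum_bij' (fun τ _ => σ * τ) (fun τ _ => σ⁻¹ * τ) ?_ ?_ ?_ ?_ ?_
  · intro τ hτ; exact mul_mem_rowStab h hτ
  · intro τ hτ; exact mul_mem_rowStab (inv_mem_rowStab h) hτ
  · intro τ _; simp
  · intro τ _; simp
  · intro τ _; rw [ofPerm_mul]

theorem rowSum_mul_ofPerm {σ : Equiv.Perm (Fin k)} (h : σ ∈ rowStab t) :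
    rowSum t * ofPerm σ = rowSum t := by
  rw [rowSum, Finset.sum_mul]
  refine Finset.sum_bij' (fun τ _ => τ * σ) (fun τ _ => τ * σ⁻¹) ?_ ?_ ?_ ?_ ?_
  · intro τ hτ; exact mul_mem_rowStab hτ h
  · intro τ hτ; exact mul_mem_rowStab hτ (inv_mem_rowStab h)
  · intro τ _; simp
  · intro τ _; simp
  · intro τ _; rw [ofPerm_mul]

theorem sign_mul_sign (σ : Equiv.Perm (Fin k)) :
    ((Equiv.Perm.sign σ : ℤ) : ℂ) * ((Equiv.Perm.sign σ : ℤ) : ℂ) = 1 := by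
  rcases Int.units_eq_one_or (Equiv.Perm.sign σ) with h | h <;> simp [h]

theorem ofPerm_mul_colSum {σ : Equiv.Perm (Fin k)} (h : σ ∈ colStab t) :
    ofPerm σ * colSum t = ((Equiv.Perm.sign σ : ℤ) : ℂ) • colSum t := by
  rw [colSum, Finset.mul_sum, Finset.smul_sum]
  refine Finset.sum_bij' (fun τ _ => σ * τ) (fun τ _ => σ⁻¹ * τ) ?_ ?_ ?_ ?_ ?_
  · intro τ hτ; exact mul_mem_colStab h hτ
  · intro τ hτ; exact mul_mem_colStab (inv_mem_colStab h) hτ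
  · intro τ _; simp
  · intro τ _; simp
  · intro τ _
    rw [ofPerm_mul, mul_smul_comm, smul_smul, Equiv.Perm.sign_mul]
    push_cast
    rw [← mul_assoc, sign_mul_sign, one_mul]

theorem colSum_mul_ofPerm {σ : Equiv.Perm (Fin k)} (h : σ ∈ colStab t) :
    colSum t * ofPerm σ = ((Equiv.Perm.sign σ : ℤ) : ℂ) • colSum t := by
  rw [colSum, Finset.sum_mul, Finset.smul_sum]
  refine Finset.sum_bij' (fun τ _ => τ * σ) (fun τ _ => τ * σ⁻¹) ?_ ?_ ?_ ?_ ?_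
  · intro τ hτ; exact mul_mem_colStab hτ h
  · intro τ hτ; exact mul_mem_colStab hτ (inv_mem_colStab h)
  · intro τ _; simp
  · intro τ _; simp
  · intro τ _
    rw [ofPerm_mul, smul_mul_assoc, smul_smul, Equiv.Perm.sign_mul]
    push_cast
    rw [mul_left_comm, sign_mul_sign, mul_one]

theorem algRep_rowSum_mul_colSum : algRep n m k (rowSum t * colSum t) = young n m t := by
  rw [map_mul, rowSum, colSum, map_sum, map_sum, young, Finset.sum_mul_sum, Finset.sum_comm]
  refine Finset.sum_congr rfl fun τ _ => Finset.sum_congr rfl fun σ _ => ?_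
  rw [map_smul, algRep_ofPerm, algRep_ofPerm, mul_smul_comm]
  rfl

theorem permAct_young {σ : Equiv.Perm (Fin k)} (h : σ ∈ rowStab t) (z : T n m k) :
    permAct n m σ (young n m t z) = young n m t z := by
  rw [← algRep_rowSum_mul_colSum, ← algRep_ofPerm (n := n) (m := m) σ, ← Module.End.mul_apply,
    ← map_mul, ← mul_assoc, ofPerm_mul_rowSum h]

theorem young_permAct {τ : Equiv.Perm (Fin k)} (h : τ ∈ colStab t) (z : T n m k) :
    young n m t (permAct n m τ z) = ((Equiv.Perm.sign τ : ℤ) : ℂ) • young n m t z := by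
  rw [← algRep_rowSum_mul_colSum, ← algRep_ofPerm (n := n) (m := m) τ, ← Module.End.mul_apply,
    ← map_mul, mul_assoc, colSum_mul_ofPerm h, mul_smul_comm, map_smul, LinearMap.smul_apply]

theorem eq_zero_of_eq_neg_complex {E : Type*} [AddCommGroup E] [Module ℂ E] {x : E}
    (h : x = -x) : x = 0 := by
  have h2 : (2 : ℂ) • x = 0 := by
    rw [two_smul]; nth_rewrite 2 [h]; exact add_neg_cancel x
  exact (smul_eq_zero.1 h2).resolve_left two_ne_zero

/-- Equal even entries in a column are annihilated by a Young symmetrizer. -/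
theorem young_vec_eq_zero {x y : Fin k} (hxy : x ≠ y) (hcol : colOf t x = colOf t y)
    {I : Fin k → Idx n m} (hI : I x = I y) (hev : par (I x) = 0) : young n m t (vec I) = 0 := by
  refine eq_zero_of_eq_neg_complex ?_
  have h := young_permAct (swap_mem_colStab hcol) (vec I)
  rw [permAct_vec, permSign_swap_of_par_eq I hxy (by rw [hI]), hev, Equiv.Perm.sign_swap hxy] at h
  have h2 : I ∘ (Equiv.swap x y).symm = I := by
    funext c
    rw [Function.comp_apply, Equiv.symm_swap, Equiv.swap_apply_def]
    split_ifs with h1 h2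
    · rw [h1, hI]
    · rw [h2, hI]
    · rfl
  rw [h2, sgn_zero, Int.cast_one, one_smul] at h
  refine h.trans ?_
  rw [Units.val_neg, Units.val_one, Int.cast_neg, Int.cast_one]
  exact neg_one_smul ℂ (young n m t (vec I))

/-- The coordinates of the values of a Young symmetrizer vanish when there are equal odd entries
in a row. -/
theorem coord_young_eq_zero {x y : Fin k} (hxy : x ≠ y) (hrow : rowOf t x = rowOf t y)
    {K : Fin k → Idx n m} (hK : K x = K y) (hodd : par (K x) = 1) (z : T n m k) :
    coord K (young n m t z) = 0 := by
  refine eq_zero_of_eq_neg_complex ?_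
  have h := congrArg (coord K) (permAct_young (swap_mem_rowStab hrow) z)
  have h2 : K ∘ (Equiv.swap x y) = K := by
    funext c
    rw [Function.comp_apply, Equiv.swap_apply_def]
    split_ifs with h1 h2
    · rw [h1, hK]
    · rw [h2, hK]
    · rfl
  rw [coord_permAct, h2, permSign_swap_of_par_eq K hxy (by rw [hK]), hodd, sgn_one] at h
  rw [Int.cast_neg, Int.cast_one, neg_one_mul] at h
  exact h.symm

theorem card_rowOf_eq (p : Fin a) : (Finset.univ.filter fun y => rowOf t y = p).card = b := by
  have : (Finset.univ.filter fun y => rowOf t y = p) =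
      Finset.univ.map ⟨fun c => t (p, c), fun c d h => by simpa using h⟩ := by
    ext y
    simp only [Finset.mem_filter, Finset.mem_univ, true_and, Finset.mem_map]
    constructor
    · intro h
      exact ⟨colOf t y, by rw [← h]; simp [rowOf, colOf]⟩
    · rintro ⟨c, rfl⟩
      change (t.symm (t (p, c))).1 = p
      rw [Equiv.symm_apply_apply]
  rw [this]; simp

/-- The Garnir relation for a row and a position outside it. -/
theorem sum_swap_mul_row {x : Fin k} {p : Fin a} (hx : rowOf t x ≠ p) :
    (∑ y ∈ Finset.univ.filter fun y => rowOf t y = p, ofPerm (Equiv.swap x y)) *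
      (rowSum t * colSum t) = -(rowSum t * colSum t) := by
  -- b + 1 positions, so under any permutation two of them fall into the same one of the b columns.
  set S : Finset (Fin k) := insert x (Finset.univ.filter fun y => rowOf t y = p) with hS
  have hcard : b < S.card := by
    rw [hS, Finset.card_insert_of_notMem (by simp [hx]), card_rowOf_eq]
    exact Nat.lt_succ_self b
  set H : Finset (Equiv.Perm (Fin k)) := Finset.univ.filter fun h => ∀ z, z ∉ S → h z = z with hH
  have hHmul : ∀ g h, g ∈ H → h ∈ H → g * h ∈ H := by
    intro g h hg hh
    simp only [hH, Finset.mem_filter, Finset.mem_univ, true_and] at *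
    intro z hz
    rw [Equiv.Perm.mul_apply, hh z hz, hg z hz]
  have hswap : ∀ y1 ∈ S, ∀ y2 ∈ S, Equiv.swap y1 y2 ∈ H := by
    intro y1 h1 y2 h2
    simp only [hH, Finset.mem_filter, Finset.mem_univ, true_and]
    intro z hz
    exact Equiv.swap_apply_of_ne_of_ne (by rintro rfl; exact hz h1) (by rintro rfl; exact hz h2)
  have hmaps : ∀ h ∈ H, ∀ z ∈ S, h z ∈ S := by
    intro h hh z hz
    by_contra hc
    simp only [hH, Finset.mem_filter, Finset.mem_univ, true_and] at hh
    have := h.injective (hh _ hc)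
    rw [this] at hc
    exact hc hz
  have hxS : x ∈ S := by simp [hS]
  -- the symmetrizer of `S` kills the column antisymmetrizers
  have hkill : ∀ ρ : Equiv.Perm (Fin k), (∑ h ∈ H, ofPerm h) * (ofPerm ρ * colSum t) = 0 := by
    intro ρ
    obtain ⟨y1, h1, y2, h2, hne, hc⟩ := Finset.exists_ne_map_eq_of_card_lt_of_maps_to
      (s := S) (t := (Finset.univ : Finset (Fin b))) (by simpa using hcard)
      (f := fun y => colOf t (ρ⁻¹ y)) (fun _ _ => Finset.mem_univ _)
    have e1 : (∑ h ∈ H, ofPerm h) * ofPerm (Equiv.swap y1 y2) = ∑ h ∈ H, ofPerm h := by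
      rw [Finset.sum_mul]
      refine Finset.sum_bij' (fun τ _ => τ * Equiv.swap y1 y2) (fun τ _ => τ * Equiv.swap y1 y2)
        ?_ ?_ ?_ ?_ ?_
      · intro τ hτ; exact hHmul _ _ hτ (hswap _ h1 _ h2)
      · intro τ hτ; exact hHmul _ _ hτ (hswap _ h1 _ h2)
      · intro τ _; simp [mul_assoc]
      · intro τ _; simp [mul_assoc]
      · intro τ _; rw [ofPerm_mul]
    have e2 : Equiv.swap y1 y2 * ρ = ρ * Equiv.swap (ρ⁻¹ y1) (ρ⁻¹ y2) := by
      rw [Equiv.mul_swap_eq_swap_mul]; simp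
    refine eq_zero_of_eq_neg_complex ?_
    have hne' : ρ⁻¹ y1 ≠ ρ⁻¹ y2 := fun h => hne (ρ⁻¹.injective h)
    conv_lhs => rw [← e1, mul_assoc, ← mul_assoc (ofPerm (Equiv.swap y1 y2)), ← ofPerm_mul, e2,
      ofPerm_mul, mul_assoc (ofPerm ρ), ofPerm_mul_colSum (swap_mem_colStab hc),
      Equiv.Perm.sign_swap hne']
    simp
  have h0 : (∑ h ∈ H, ofPerm h) * (rowSum t * colSum t) = 0 := by
    rw [rowSum, Finset.sum_mul (rowStab t), Finset.mul_sum]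
    exact Finset.sum_eq_zero fun ρ _ => hkill ρ
  -- The permutation `Equiv.swap x (h x) * h` fixes `x` and permutes the row, so the row sum absorbs
  -- it and only a transposition remains. Each transposition arises equally often (`hN`), and this
  -- multiplicity cancels.
  have h1 : ∀ h ∈ H, ofPerm h * (rowSum t * colSum t) =
      ofPerm (Equiv.swap x (h x)) * (rowSum t * colSum t) := by
    intro h hh
    have hmem : Equiv.swap x (h x) * h ∈ rowStab t := by
      rw [mem_rowStab]
      have hmem' := hHmul _ _ (hswap x hxS (h x) (hmaps h hh x hxS)) hh
      intro z
      by_cases hzx : z = x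
      · rw [hzx, Equiv.Perm.mul_apply, Equiv.swap_apply_right]
      · by_cases hz : z ∈ S
        · have hz' := hmaps _ hmem' z hz
          have hne : (Equiv.swap x (h x) * h) z ≠ x := by
            intro hc
            apply hzx
            apply (Equiv.swap x (h x) * h).injective
            rw [hc, Equiv.Perm.mul_apply, Equiv.swap_apply_right]
          rw [hS, Finset.mem_insert] at hz hz'
          have r1 := hz.resolve_left hzx
          have r2 := hz'.resolve_left hne
          simp only [Finset.mem_filter, Finset.mem_univ, true_and] at r1 r2
          rw [r1, r2]
        · simp only [hH, Finset.mem_filter, Finset.mem_univ, true_and] at hmem'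
          rw [hmem' z hz]
    have e3 : h = Equiv.swap x (h x) * (Equiv.swap x (h x) * h) := by
      rw [← mul_assoc, Equiv.swap_mul_self, one_mul]
    conv_lhs => rw [e3, ofPerm_mul, mul_assoc, ← mul_assoc (ofPerm (Equiv.swap x (h x) * h)),
      ofPerm_mul_rowSum hmem]
  have hN : ∀ y ∈ S, (H.filter fun h => h x = y).card = (H.filter fun h => h x = x).card := by
    intro y hy
    refine Finset.card_bij' (fun h _ => Equiv.swap x y * h) (fun h _ => Equiv.swap x y * h)
      ?_ ?_ ?_ ?_
    · intro h hh
      rw [Finset.mem_filter] at *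
      exact ⟨hHmul _ _ (hswap x hxS y hy) hh.1, by rw [Equiv.Perm.mul_apply, hh.2]; simp⟩
    · intro h hh
      rw [Finset.mem_filter] at *
      exact ⟨hHmul _ _ (hswap x hxS y hy) hh.1, by rw [Equiv.Perm.mul_apply, hh.2]; simp⟩
    · intro h _; simp [← mul_assoc]
    · intro h _; simp [← mul_assoc]
  have hNpos : (H.filter fun h => h x = x).card ≠ 0 := by
    rw [← Nat.pos_iff_ne_zero, Finset.card_pos]
    exact ⟨1, by simp [hH]⟩
  have h2 : (∑ y ∈ S, ofPerm (Equiv.swap x y)) * (rowSum t * colSum t) = 0 := by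
    have h3 : ∑ h ∈ H, ofPerm (Equiv.swap x (h x)) * (rowSum t * colSum t) = 0 := by
      rw [← h0, Finset.sum_mul]
      exact (Finset.sum_congr rfl h1).symm
    rw [← Finset.sum_fiberwise_of_maps_to (g := fun h : Equiv.Perm (Fin k) => h x) (t := S)
      (fun h hh => hmaps h hh x hxS)] at h3
    have h4 : ∀ y ∈ S, ∑ h ∈ H with h x = y,
        ofPerm (Equiv.swap x (h x)) * (rowSum t * colSum t) =
        ((H.filter fun h => h x = x).card : ℂ) •
          (ofPerm (Equiv.swap x y) * (rowSum t * colSum t)) := by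
      intro y hy
      rw [← hN y hy, Nat.cast_smul_eq_nsmul, ← Finset.sum_const]
      refine Finset.sum_congr rfl fun h hh => ?_
      rw [(Finset.mem_filter.1 hh).2]
    rw [Finset.sum_congr rfl h4, ← Finset.smul_sum, ← Finset.sum_mul] at h3
    exact (smul_eq_zero.1 h3).resolve_left (by exact_mod_cast hNpos)
  rw [hS, Finset.sum_insert (by simp [hx]), Equiv.swap_self] at h2
  rw [eq_neg_iff_add_eq_zero, ← h2, add_mul, add_comm]
  congr 1
  exact (one_mul _).symm

/-- The row of `x` contributes b - 1 and each of the other a - 1 rows contributes -1 by the Garnir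
relation. The eigenvalue b - a is the same for every position because the tableau is a rectangle. -/
theorem sum_swap_mul (t : Fin a × Fin b ≃ Fin k) (x : Fin k) :
    ∑ y, (if y ≠ x then ofPerm (Equiv.swap x y) * (rowSum t * colSum t) else 0) =
      ((b : ℂ) - a) • (rowSum t * colSum t) := by
  rw [← Finset.sum_fiberwise Finset.univ (rowOf t)]
  have h : ∀ p, ∑ y with rowOf t y = p,
      (if y ≠ x then ofPerm (Equiv.swap x y) * (rowSum t * colSum t) else 0) =
      -(rowSum t * colSum t) + if rowOf t x = p then (b : ℂ) • (rowSum t * colSum t) else 0 := by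
    intro p
    by_cases hp : rowOf t x = p
    · rw [if_pos hp]
      have : ∀ y ∈ Finset.univ.filter fun y => rowOf t y = p,
          (if y ≠ x then ofPerm (Equiv.swap x y) * (rowSum t * colSum t) else 0) =
          rowSum t * colSum t - if x = y then rowSum t * colSum t else 0 := by
        intro y hy
        have hy' : rowOf t y = p := by simpa using hy
        by_cases hxy : y = x
        · simp [hxy]
        · rw [if_pos hxy, if_neg (Ne.symm hxy), sub_zero, ← mul_assoc,
            ofPerm_mul_rowSum (swap_mem_rowStab (hp.trans hy'.symm))]
      rw [Finset.sum_congr rfl this, Finset.sum_sub_distrib, Finset.sum_const, card_rowOf_eq,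
        Finset.sum_ite_eq, if_pos (by simp [hp]), ← Nat.cast_smul_eq_nsmul ℂ]
      abel
    · rw [if_neg hp, add_zero, ← sum_swap_mul_row hp, Finset.sum_mul]
      refine Finset.sum_congr rfl fun y hy => ?_
      rw [if_pos]
      rintro rfl
      exact hp (by simpa using hy)
  rw [Finset.sum_congr rfl fun p _ => h p, Finset.sum_add_distrib, Finset.sum_const,
    Finset.sum_ite_eq, if_pos (Finset.mem_univ _), Finset.card_univ, Fintype.card_fin,
    ← Nat.cast_smul_eq_nsmul ℂ, sub_smul, smul_neg]
  abel

theorem sum_swap_young (t : Fin a × Fin b ≃ Fin k) (z : T n m k) (x : Fin k) :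
    ∑ y, (if y ≠ x then permAct n m (Equiv.swap x y) (young n m t z) else 0) =
      ((b : ℂ) - a) • young n m t z := by
  have h := congrArg (fun c => algRep n m k c z) (sum_swap_mul t x)
  simp only [map_sum, map_smul, algRep_rowSum_mul_colSum, LinearMap.smul_apply,
    LinearMap.sum_apply] at h
  rw [← h]
  refine Finset.sum_congr rfl fun y _ => ?_
  split_ifs
  · rw [map_mul, algRep_rowSum_mul_colSum, algRep_ofPerm, Module.End.mul_apply]
  · simp

end

/-! ### Commutation of the operator 𝓛 with osp(V). -/

section


variable {n m k l : ℕ}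

/-! ### Positions of the tableaux -/

/-- The positions of `v_{I_1} ⊗ w`: the first `n` ones and those of `w`. -/
def prependPos (n m : ℕ) : Fin n ⊕ Fin (n * m) ≃ Fin (n * (m + 1)) :=
  finSumFinEquiv.trans (finCongr (by ring))

theorem prependSeq_inl (L : Fin (n * m) → Idx n m) (i : Fin n) :
    prependSeq L (prependPos n m (Sum.inl i)) = Sum.inl i := by
  simp [prependSeq, prependPos]

theorem prependSeq_inr (L : Fin (n * m) → Idx n m) (x : Fin (n * m)) :
    prependSeq L (prependPos n m (Sum.inr x)) = L x := by
  simp [prependSeq, prependPos]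

theorem colTab_val {a b : ℕ} (i : Fin a) (j : Fin b) : (colTab a b (i, j)).val = i + a * j := by
  simp [colTab, finProdFinEquiv]

theorem colTab_zero (i : Fin n) : colTab n (m + 1) (i, 0) = prependPos n m (Sum.inl i) := by
  apply Fin.ext
  rw [colTab_val]; simp [prependPos]

theorem colTab_succ (i : Fin n) (j : Fin m) :
    colTab n (m + 1) (i, j.succ) = prependPos n m (Sum.inr (colTab n m (i, j))) := by
  apply Fin.ext
  rw [colTab_val]
  simp only [prependPos, Equiv.trans_apply, finSumFinEquiv_apply_right, finCongr_apply,
    Fin.val_cast, Fin.val_natAdd, colTab_val, Fin.val_succ]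
  ring

theorem bordTab_last (j : Fin m) : bordTab n m (Fin.last n, j) = Fin.natAdd (n * m) j := by
  have : (finSumFinEquiv.symm (Fin.last n) : Fin n ⊕ Fin 1) = Sum.inr 0 := by
    rw [Equiv.symm_apply_eq]; rfl
  simp [bordTab, this]

theorem bordTab_castSucc (i : Fin n) (j : Fin m) :
    bordTab n m (i.castSucc, j) = Fin.castAdd m (colTab n m (i, j)) := by
  have : (finSumFinEquiv.symm (i.castSucc) : Fin n ⊕ Fin 1) = Sum.inl i := by
    rw [Equiv.symm_apply_eq]; rfl
  simp [bordTab, this]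

theorem prependPos_lt_iff (u v : Fin n ⊕ Fin (n * m)) :
    prependPos n m u < prependPos n m v ↔ (finSumFinEquiv u).val < (finSumFinEquiv v).val :=
  Iff.rfl

theorem preSign_prependSeq_inr (a : ZMod 2) (L : Fin (n * m) → Idx n m) (x : Fin (n * m)) :
    preSign a (prependSeq L) (prependPos n m (Sum.inr x)) = preSign a L x := by
  unfold preSign
  rw [← Equiv.prod_comp (prependPos n m), Fintype.prod_sum_type]
  simp only [prependSeq_inl, prependSeq_inr, prependPos_lt_iff]
  simp [par, sgn_zero]

theorem preSign_prependSeq_inl (a : ZMod 2) (L : Fin (n * m) → Idx n m) (i : Fin n) :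
    preSign a (prependSeq L) (prependPos n m (Sum.inl i)) = 1 := by
  unfold preSign
  rw [← Equiv.prod_comp (prependPos n m), Fintype.prod_sum_type]
  simp only [prependSeq_inl, prependSeq_inr, prependPos_lt_iff]
  rw [Finset.prod_eq_one, Finset.prod_eq_one, one_mul]
  · intro x _
    rw [if_neg]
    have := i.isLt
    simp only [finSumFinEquiv_apply_left, finSumFinEquiv_apply_right, Fin.val_natAdd,
      Fin.val_castAdd]
    omega
  · intro j _; simp [par, sgn_zero]

theorem update_prependSeq_inr (L : Fin (n * m) → Idx n m) (x : Fin (n * m)) (i : Idx n m) :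
    Function.update (prependSeq L) (prependPos n m (Sum.inr x)) i =
      prependSeq (Function.update L x i) := by
  funext y
  obtain ⟨u, rfl⟩ := (prependPos n m).surjective y
  rcases u with u | u
  · rw [prependSeq_inl, Function.update_of_ne (by simp), prependSeq_inl]
  · rw [prependSeq_inr]
    by_cases h : u = x
    · subst h; simp
    · rw [Function.update_of_ne (by simpa using h), Function.update_of_ne h, prependSeq_inr]

theorem preSign_castAdd (a : ZMod 2) (I : Fin (k + l) → Idx n m) (x : Fin k) :
    preSign a I (Fin.castAdd l x) = preSign a (fun y => I (Fin.castAdd l y)) x := by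
  unfold preSign
  rw [Fin.prod_univ_add]
  rw [Finset.prod_eq_one (f := fun i => if Fin.natAdd k i < Fin.castAdd l x then _ else _), mul_one]
  · rfl
  · intro y _
    rw [if_neg]
    have := x.isLt
    simp only [Fin.lt_def, Fin.val_natAdd, Fin.val_castAdd]
    omega

/-! ### Insertion of `v_{I_1}` and contraction with the last row -/

theorem prepend_vec (L : Fin (n * m) → Idx n m) : prepend n m (vec L) = vec (prependSeq L) := by
  conv_lhs => rw [prepend, ← vecBasis_apply, Module.Basis.constr_basis]

theorem contract_vec (I : Fin (n * m + m) → Idx n m) : contract n m (vec I) =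
    if ∀ j : Fin m, I (Fin.natAdd (n * m) j) = Sum.inr j then
      vec (fun α => I (Fin.castAdd m α)) else 0 := by
  conv_lhs => rw [contract, ← vecBasis_apply, Module.Basis.constr_basis]

/-- Leibniz rule on both sides. The action on the first n rows is common to both, with equal signs
because the inserted letters are even; the last row is acted on only before the contraction, the
letters of I_1 only after the insertion. -/
theorem gact_prepend_contract (i j : Idx n m) (I : Fin (n * m + m) → Idx n m) :
    gact i j (prepend n m (contract n m (vec I))) +
      ∑ y : Fin m, (if I (Fin.natAdd (n * m) y) = j then
        (preSign (par i + par j) I (Fin.natAdd (n * m) y) : ℂ) •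
          prepend n m (contract n m (vec (Function.update I (Fin.natAdd (n * m) y) i))) else 0) =
    prepend n m (contract n m (gact i j (vec I))) +
      if ∀ j : Fin m, I (Fin.natAdd (n * m) j) = Sum.inr j then
        ∑ p : Fin n, (if Sum.inl p = j then
          vec (Function.update (prependSeq fun α => I (Fin.castAdd m α))
            (prependPos n m (Sum.inl p)) i) else 0) else 0 := by
  have h1 : prepend n m (contract n m (gact i j (vec I))) =
      (if ∀ j : Fin m, I (Fin.natAdd (n * m) j) = Sum.inr j then
        ∑ x : Fin (n * m), (if I (Fin.castAdd m x) = j then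
        (preSign (par i + par j) (fun α => I (Fin.castAdd m α)) x : ℂ) •
          vec (prependSeq (Function.update (fun α => I (Fin.castAdd m α)) x i)) else 0) else 0) +
      ∑ y : Fin m, (if I (Fin.natAdd (n * m) y) = j then
        (preSign (par i + par j) I (Fin.natAdd (n * m) y) : ℂ) •
          prepend n m (contract n m (vec (Function.update I (Fin.natAdd (n * m) y) i))) else 0) := by
    rw [gact_vec, Fin.sum_univ_add, map_add, map_add, map_sum, map_sum, map_sum, map_sum]
    congr 1
    · have hc : ∀ x : Fin (n * m), contract n m (vec (Function.update I (Fin.castAdd m x) i)) =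
          if ∀ j : Fin m, I (Fin.natAdd (n * m) j) = Sum.inr j then
            vec (Function.update (fun α => I (Fin.castAdd m α)) x i) else 0 := by
        intro x
        rw [contract_vec]
        have e1 : ∀ j : Fin m, Function.update I (Fin.castAdd m x) i (Fin.natAdd (n * m) j) =
            I (Fin.natAdd (n * m) j) := by
          intro j
          rw [Function.update_of_ne]
          intro h
          have := congrArg Fin.val h
          simp only [Fin.val_natAdd, Fin.val_castAdd] at this
          omega
        have e2 : (fun α => Function.update I (Fin.castAdd m x) i (Fin.castAdd m α)) =
            Function.update (fun α => I (Fin.castAdd m α)) x i := by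
          funext y
          by_cases h : y = x
          · subst h; simp
          · rw [Function.update_of_ne h, Function.update_of_ne (by simpa using h)]
        simp only [e1, e2]
      by_cases hI : ∀ j : Fin m, I (Fin.natAdd (n * m) j) = Sum.inr j
      · rw [if_pos hI]
        refine Finset.sum_congr rfl fun x _ => ?_
        by_cases hx : I (Fin.castAdd m x) = j
        · rw [if_pos hx, if_pos hx, map_smul, map_smul, hc, if_pos hI, prepend_vec, preSign_castAdd]
        · rw [if_neg hx, if_neg hx, map_zero, map_zero]
      · rw [if_neg hI]
        refine Finset.sum_eq_zero fun x _ => ?_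
        by_cases hx : I (Fin.castAdd m x) = j
        · rw [if_pos hx, map_smul, map_smul, hc, if_neg hI, map_zero, smul_zero]
        · rw [if_neg hx, map_zero, map_zero]
    · refine Finset.sum_congr rfl fun y _ => ?_
      split_ifs
      · rw [map_smul, map_smul]
      · rw [map_zero, map_zero]
  have h2 : gact i j (prepend n m (contract n m (vec I))) =
      (if ∀ j : Fin m, I (Fin.natAdd (n * m) j) = Sum.inr j then
        ∑ p : Fin n, (if Sum.inl p = j then
          vec (Function.update (prependSeq fun α => I (Fin.castAdd m α))
            (prependPos n m (Sum.inl p)) i) else 0) else 0) +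
      (if ∀ j : Fin m, I (Fin.natAdd (n * m) j) = Sum.inr j then
        ∑ x : Fin (n * m), (if I (Fin.castAdd m x) = j then
        (preSign (par i + par j) (fun α => I (Fin.castAdd m α)) x : ℂ) •
          vec (prependSeq (Function.update (fun α => I (Fin.castAdd m α)) x i)) else 0) else 0) := by
    rw [contract_vec]
    by_cases hI : ∀ j : Fin m, I (Fin.natAdd (n * m) j) = Sum.inr j
    · rw [if_pos hI, if_pos hI, if_pos hI, prepend_vec, gact_vec, ← Equiv.sum_comp (prependPos n m),
        Fintype.sum_sum_type]
      simp only [prependSeq_inl, prependSeq_inr, preSign_prependSeq_inl, preSign_prependSeq_inr,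
        update_prependSeq_inr, Int.cast_one, one_smul]
    · simp [if_neg hI]
  rw [h1, h2]
  abel

theorem rowOf_natAdd (y : Fin m) : rowOf (bordTab n m) (Fin.natAdd (n * m) y) = Fin.last n := by
  rw [rowOf, ← bordTab_last, Equiv.symm_apply_apply]

theorem colOf_prependPos_inl (p : Fin n) :
    colOf (colTab n (m + 1)) (prependPos n m (Sum.inl p)) = 0 := by
  rw [colOf, ← colTab_zero, Equiv.symm_apply_apply]

theorem natAdd_ne {y y' : Fin m} (h : y ≠ y') : Fin.natAdd (n * m) y ≠ Fin.natAdd (n * m) y' := by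
  intro h'
  apply h
  have := congrArg Fin.val h'
  simp only [Fin.val_natAdd] at this
  exact Fin.ext (by omega)

/-- The matrix units outside the negative odd part commute with the operator, up to the
supertrace. -/
theorem gact_invOp {i j : Idx n m} (hij : ¬ (par i = 1 ∧ par j = 0)) :
    gact i j ∘ₗ invOp n m = invOp n m ∘ₗ gact i j +
      (if i = j then (sgn (par i) : ℂ) else 0) • invOp n m := by
  have hpar : ∀ p : Idx n m, par p = 0 ∨ par p = 1 := fun p => zmod_two_cases _
  -- the part that acts on the first column
  have hA : ∀ I : Fin (n * m + m) → Idx n m, young n m (colTab n (m + 1))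
      (if ∀ j : Fin m, I (Fin.natAdd (n * m) j) = Sum.inr j then
        ∑ p : Fin n, (if Sum.inl p = j then
          vec (Function.update (prependSeq fun α => I (Fin.castAdd m α))
            (prependPos n m (Sum.inl p)) i) else 0) else 0) =
      (if i = j ∧ par i = 0 then (1 : ℂ) else 0) •
        young n m (colTab n (m + 1)) (prepend n m (contract n m (vec I))) := by
    intro I
    rw [contract_vec]
    by_cases hI : ∀ j : Fin m, I (Fin.natAdd (n * m) j) = Sum.inr j
    · rw [if_pos hI, if_pos hI, prepend_vec, map_sum]
      rcases j with j | j
      · rw [Fintype.sum_eq_single j]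
        · rw [if_pos rfl]
          by_cases hi : i = Sum.inl j
          · subst hi
            rw [if_pos ⟨rfl, rfl⟩, one_smul]
            congr 2
            rw [Function.update_eq_self_iff]
            exact (prependSeq_inl _ j).symm
          · rw [if_neg (fun h => hi h.1), zero_smul]
            have hi0 : par i = 0 := by
              rcases hpar i with h | h
              · exact h
              · exact absurd ⟨h, rfl⟩ hij
            rcases i with i | i
            · have hne : i ≠ j := fun h => hi (by rw [h])
              have hp : prependPos n m (Sum.inl i) ≠ prependPos n m (Sum.inl j) := by simpa using hne
              -- The even letter i, put in the place of j, occurs twice in the first column.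
              refine young_vec_eq_zero (x := prependPos n m (Sum.inl i))
                (y := prependPos n m (Sum.inl j)) hp ?_ ?_ ?_
              · rw [colOf_prependPos_inl, colOf_prependPos_inl]
              · rw [Function.update_self, Function.update_of_ne hp, prependSeq_inl]
              · rw [Function.update_of_ne hp, prependSeq_inl]; rfl
            · exact absurd hi0 (by simp [par])
        · intro p hp
          rw [if_neg (by simpa using hp), map_zero]
      · rw [Finset.sum_eq_zero fun p _ => by simp, if_neg, zero_smul]
        rintro ⟨rfl, h⟩
        simp [par] at h
    · simp [if_neg hI]
  -- the part that acts on the last row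
  have hB : ∀ w : T n m (n * m + m), ∀ I : Fin (n * m + m) → Idx n m,
      coord I (young n m (bordTab n m) w) •
      ∑ y : Fin m, (if I (Fin.natAdd (n * m) y) = j then
        (preSign (par i + par j) I (Fin.natAdd (n * m) y) : ℂ) •
          prepend n m (contract n m (vec (Function.update I (Fin.natAdd (n * m) y) i))) else 0) =
      coord I (young n m (bordTab n m) w) • (if i = j ∧ par i = 1 then (1 : ℂ) else 0) •
        prepend n m (contract n m (vec I)) := by
    intro w I
    by_cases hi : i = j
    · subst hi
      congr 1
      rw [CharTwo.add_self_eq_zero]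
      have : ∀ y : Fin m, (if I (Fin.natAdd (n * m) y) = i then
        (preSign 0 I (Fin.natAdd (n * m) y) : ℂ) •
          prepend n m (contract n m (vec (Function.update I (Fin.natAdd (n * m) y) i))) else 0) =
          if I (Fin.natAdd (n * m) y) = i then prepend n m (contract n m (vec I)) else 0 := by
        intro y
        by_cases h : I (Fin.natAdd (n * m) y) = i
        · rw [if_pos h, if_pos h, preSign_zero, ← h, Function.update_eq_self]; simp
        · rw [if_neg h, if_neg h]
      simp only [this]
      rw [contract_vec]
      by_cases hI : ∀ j : Fin m, I (Fin.natAdd (n * m) j) = Sum.inr j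
      · simp only [hI]
        rcases i with i | i
        · simp [par]
        · rw [Fintype.sum_eq_single i]
          · simp [par]
          · intro y hy; simp [hy]
      · simp [if_neg hI]
    · rw [if_neg (fun h => hi h.1), zero_smul, smul_zero]
      by_cases hcoord : coord I (young n m (bordTab n m) w) = 0
      · rw [hcoord, zero_smul]
      rw [Finset.sum_eq_zero, smul_zero]
      intro y _
      by_cases hy : I (Fin.natAdd (n * m) y) = j
      · rw [if_pos hy, contract_vec, if_neg, map_zero, smul_zero]
        intro hJ
        have hiy := hJ y
        rw [Function.update_self] at hiy
        have hpj : par j = 1 := by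
          rcases hpar j with h | h
          · exact absurd ⟨by rw [hiy]; rfl, h⟩ hij
          · exact h
        rcases j with j | j
        · simp [par] at hpj
        have hjy : j ≠ y := by rintro rfl; exact hi hiy
        have hj := hJ j
        rw [Function.update_of_ne (natAdd_ne hjy)] at hj
        -- The contraction demands the odd letter j in its own place of the last row, but j also
        -- stands at y: a repetition that the symmetrizer of t excludes.
        refine hcoord (coord_young_eq_zero (natAdd_ne hjy) ?_ ?_ ?_ w)
        · rw [rowOf_natAdd, rowOf_natAdd]
        · rw [hj, hy]
        · rw [hj]; rfl
      · rw [if_neg hy]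
  have hF : ∀ w : T n m (n * m + m), young n m (colTab n (m + 1))
      (gact i j (prepend n m (contract n m (young n m (bordTab n m) w)))) +
      (if i = j ∧ par i = 1 then (1 : ℂ) else 0) • young n m (colTab n (m + 1))
        (prepend n m (contract n m (young n m (bordTab n m) w))) =
      young n m (colTab n (m + 1))
        (prepend n m (contract n m (gact i j (young n m (bordTab n m) w)))) +
      (if i = j ∧ par i = 0 then (1 : ℂ) else 0) • young n m (colTab n (m + 1))
        (prepend n m (contract n m (young n m (bordTab n m) w))) := by
    intro w
    have hw := sum_coord (young n m (bordTab n m) w)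
    have e : ∀ I, young n m (colTab n (m + 1)) (gact i j (prepend n m (contract n m
        (coord I (young n m (bordTab n m) w) • vec I)))) +
      (if i = j ∧ par i = 1 then (1 : ℂ) else 0) • young n m (colTab n (m + 1))
        (prepend n m (contract n m (coord I (young n m (bordTab n m) w) • vec I))) =
      young n m (colTab n (m + 1))
        (prepend n m (contract n m (gact i j (coord I (young n m (bordTab n m) w) • vec I)))) +
      (if i = j ∧ par i = 0 then (1 : ℂ) else 0) • young n m (colTab n (m + 1))
        (prepend n m (contract n m (coord I (young n m (bordTab n m) w) • vec I))) := by
      intro I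
      have h1 := congrArg (fun v => coord I (young n m (bordTab n m) w) •
        young n m (colTab n (m + 1)) v) (gact_prepend_contract i j I)
      simp only [map_add, smul_add, hA] at h1
      have h2 := congrArg (young n m (colTab n (m + 1))) (hB w I)
      simp only [map_smul] at h2
      rw [h2] at h1
      simp only [map_smul]
      rw [smul_comm (if i = j ∧ par i = 1 then (1 : ℂ) else 0),
        smul_comm (if i = j ∧ par i = 0 then (1 : ℂ) else 0)]
      exact h1
    have e' := Finset.sum_congr rfl fun I (_ : I ∈ Finset.univ) => e I
    rw [Finset.sum_add_distrib, Finset.sum_add_distrib, ← Finset.smul_sum, ← Finset.smul_sum] at e'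
    simp only [← map_sum] at e'
    rw [hw] at e'
    exact e'
  refine LinearMap.ext fun w => ?_
  have h1 : ∀ v, young n m (colTab n (m + 1)) (gact i j v) = gact i j (young n m _ v) :=
    fun v => LinearMap.congr_fun (young_gact _ i j) v
  have h2 : ∀ v, young n m (bordTab n m) (gact i j v) = gact i j (young n m _ v) :=
    fun v => LinearMap.congr_fun (young_gact _ i j) v
  have h3 := hF w
  rw [h1, ← h2] at h3
  simp only [invOp, LinearMap.comp_apply, LinearMap.add_apply, LinearMap.smul_apply]
  -- On the diagonal v_{I_1} contributes 1 for even i, and the covector contributes -1 for odd i.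
  by_cases hi : i = j
  · rcases hpar i with h | h
    · simp only [hi ▸ h, hi, true_and, if_true, zero_ne_one, if_false, zero_smul, add_zero] at h3 ⊢
      rw [sgn_zero, Int.cast_one]
      exact h3
    · simp only [hi ▸ h, hi, true_and, if_true, one_ne_zero, if_false, zero_smul, add_zero] at h3 ⊢
      rw [sgn_one, ← h3, Int.cast_neg, Int.cast_one, one_smul]
      have aux : ∀ {E : Type} [AddCommGroup E] [Module ℂ E] (u v : E), u = u + v + (-1 : ℂ) • v := by
        intro E _ _ u v
        module
      exact aux _ _
  · simp only [hi, false_and, if_false, zero_smul, add_zero] at h3 ⊢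
    exact h3

end

section


variable {n m k l : ℕ}

/-! ### Degrees -/

/-- The number of odd entries of a sequence. -/
def oddDeg (I : Fin k → Idx n m) : ℤ := ∑ α, if par (I α) = 1 then 1 else 0

/-- A map of tensors that changes the number of odd factors by `s`. -/
def Shifts (A : T n m k →ₗ[ℂ] T n m l) (s : ℤ) : Prop :=
  ∀ I K, coord K (A (vec I)) ≠ 0 → oddDeg K = oddDeg I + s

theorem Shifts.comp {j : ℕ} {A : T n m k →ₗ[ℂ] T n m l} {B : T n m l →ₗ[ℂ] T n m j} {s t : ℤ}
    (hB : Shifts B t) (hA : Shifts A s) : Shifts (B ∘ₗ A) (s + t) := by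
  intro I K h
  rw [LinearMap.comp_apply, ← sum_coord (A (vec I)), map_sum, map_sum] at h
  obtain ⟨J, -, hJ⟩ := Finset.exists_ne_zero_of_sum_ne_zero h
  rw [map_smul, map_smul, smul_eq_mul] at hJ
  rw [hB J K (right_ne_zero_of_mul hJ), hA I J (left_ne_zero_of_mul hJ), add_assoc]

theorem Shifts.sub {A B : T n m k →ₗ[ℂ] T n m l} {s : ℤ} (hA : Shifts A s) (hB : Shifts B s) :
    Shifts (A - B) s := by
  intro I K h
  rw [LinearMap.sub_apply, map_sub] at h
  by_cases h1 : coord K (A (vec I)) = 0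
  · rw [h1, zero_sub, neg_ne_zero] at h
    exact hB I K h
  · exact hA I K h1

theorem Shifts.sum {ι : Type*} {S : Finset ι} {A : ι → T n m k →ₗ[ℂ] T n m l} {s : ℤ}
    (hA : ∀ i ∈ S, Shifts (A i) s) : Shifts (∑ i ∈ S, A i) s := by
  intro I K h
  rw [LinearMap.sum_apply, map_sum] at h
  obtain ⟨i, hi, h⟩ := Finset.exists_ne_zero_of_sum_ne_zero h
  exact hA i hi I K h

theorem Shifts.smul {A : T n m k →ₗ[ℂ] T n m l} {s : ℤ} (hA : Shifts A s) (c : ℂ) :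
    Shifts (c • A) s := by
  intro I K h
  rw [LinearMap.smul_apply, map_smul, smul_eq_mul] at h
  exact hA I K (right_ne_zero_of_mul h)

theorem shifts_permAct (σ : Fin k ≃ Fin l) : Shifts (permAct n m σ) 0 := by
  intro I K h
  rw [permAct_vec, map_smul, smul_eq_mul, coord_vec] at h
  have : I ∘ σ.symm = K := by
    by_contra hc
    simp [hc] at h
  rw [← this, add_zero, oddDeg, oddDeg, ← Equiv.sum_comp σ]
  simp

theorem shifts_young {a b : ℕ} (t : Fin a × Fin b ≃ Fin k) : Shifts (young n m t) 0 :=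
  Shifts.sum fun _ _ => Shifts.sum fun _ _ =>
    ((shifts_permAct _).comp (shifts_permAct _)).smul _

theorem oddDeg_update (I : Fin k → Idx n m) (α : Fin k) (i : Idx n m) :
    oddDeg (Function.update I α i) =
      oddDeg I + (if par i = 1 then 1 else 0) - if par (I α) = 1 then 1 else 0 := by
  unfold oddDeg
  rw [Fintype.sum_eq_add_sum_compl α, Fintype.sum_eq_add_sum_compl α (f := fun α =>
    if par (I α) = 1 then (1 : ℤ) else 0)]
  have : ∑ x ∈ {α}ᶜ, (if par (Function.update I α i x) = 1 then (1 : ℤ) else 0) =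
      ∑ x ∈ {α}ᶜ, if par (I x) = 1 then 1 else 0 := by
    refine Finset.sum_congr rfl fun x hx => ?_
    rw [Function.update_of_ne (by simpa using hx)]
  rw [this, Function.update_self]
  ring

theorem shifts_gact {i j : Idx n m} (hi : par i = 1) (hj : par j = 0) :
    Shifts (gact i j : T n m k →ₗ[ℂ] T n m k) 1 := by
  intro I K h
  rw [gact_vec, map_sum] at h
  obtain ⟨α, -, h⟩ := Finset.exists_ne_zero_of_sum_ne_zero h
  by_cases hα : I α = j
  · rw [if_pos hα, map_smul, smul_eq_mul, coord_vec] at h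
    have : Function.update I α i = K := by
      by_contra hc
      simp [hc] at h
    rw [← this, oddDeg_update, hi, hα, hj]
    simp
  · simp [if_neg hα] at h

theorem shifts_prepend : Shifts (prepend n m) 0 := by
  intro I K h
  rw [prepend_vec, coord_vec] at h
  have : prependSeq I = K := by
    by_contra hc
    simp [hc] at h
  rw [← this, oddDeg, ← Equiv.sum_comp (prependPos n m), Fintype.sum_sum_type]
  simp only [prependSeq_inl, prependSeq_inr]
  simp [par, oddDeg]

theorem shifts_contract : Shifts (contract n m) (-m) := by
  intro I K h
  rw [contract_vec] at h
  by_cases hI : ∀ j : Fin m, I (Fin.natAdd (n * m) j) = Sum.inr j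
  · rw [if_pos hI, coord_vec] at h
    have : (fun α => I (Fin.castAdd m α)) = K := by
      by_contra hc
      simp [hc] at h
    rw [← this, oddDeg, oddDeg, Fin.sum_univ_add]
    simp [hI, par]
  · simp [if_neg hI] at h

theorem shifts_invOp : Shifts (invOp n m) (-m) := by
  have := (shifts_young (colTab n (m + 1))).comp (shifts_prepend.comp
    (shifts_contract.comp (shifts_young (bordTab n m))))
  simpa [invOp] using this

/-- The Young symmetrizer of a tableau with more rows than there are even indices annihilates the
tensors with few odd factors. -/
theorem young_vec_eq_zero_of_oddDeg_lt {a b : ℕ} (t : Fin a × Fin b ≃ Fin k) (ha : n < a)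
    {I : Fin k → Idx n m} (hI : oddDeg I < b) : young n m t (vec I) = 0 := by
  -- Fewer than b odd letters leave a column without any; it has a > n even entries, so two of them
  -- agree.
  have hcol : ∃ c : Fin b, ∀ p : Fin a, par (I (t (p, c))) = 0 := by
    by_contra hc
    push Not at hc
    choose p hp using hc
    have h1 : (b : ℤ) ≤ oddDeg I := by
      have e1 : (b : ℤ) = ∑ x ∈ Finset.univ.map ⟨fun c => t (p c, c), fun c d h => by
          have := t.injective h
          exact (Prod.mk.inj this).2⟩, if par (I x) = 1 then (1 : ℤ) else 0 := by
        rw [Finset.sum_map]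
        have : ∀ c, par (I (t (p c, c))) = 1 := fun c =>
          (zmod_two_cases _).resolve_left (hp c)
        refine Eq.trans ?_ (Finset.sum_congr rfl fun c _ => (if_pos (this c)).symm)
        simp
      rw [e1, oddDeg]
      refine Finset.sum_le_sum_of_subset_of_nonneg (Finset.subset_univ _) fun x _ _ => ?_
      split_ifs <;> norm_num
    omega
  obtain ⟨c, hc⟩ := hcol
  have hx : ∀ p, ∃ i : Fin n, I (t (p, c)) = Sum.inl i := by
    intro p
    have := hc p
    rcases h : I (t (p, c)) with i | j
    · exact ⟨i, rfl⟩
    · rw [h] at this; simp [par] at this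
  choose f hf using hx
  obtain ⟨p, q, hne, hpq⟩ := Fintype.exists_ne_map_eq_of_card_lt f (by simpa using ha)
  refine young_vec_eq_zero (x := t (p, c)) (y := t (q, c)) ?_ ?_ ?_ (hc p)
  · intro h; apply hne; simpa using t.injective h
  · simp [colOf]
  · rw [hf, hf, hpq]

/-! ### The negative odd part -/

/-- Terms in two different positions cancel: whichever operator acts in the later position passes a
letter whose parity the other one has changed or not yet changed. The terms in one position give the
matrix products. -/
theorem gact_anticomm {i j p q : Idx n m} (hi : par i = 1) (hj : par j = 0) (hp : par p = 0)
    (hq : par q = 1) (z : T n m k) :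
    gact i j (gact p q z) + gact p q (gact i j z) =
      (if p = j then gact i q z else 0) + if i = q then gact p j z else 0 := by
  have key : ∀ I : Fin k → Idx n m, gact i j (gact p q (vec I)) + gact p q (gact i j (vec I)) =
      (if p = j then gact i q (vec I) else 0) + if i = q then gact p j (vec I) else 0 := by
    intro I
    have e1 : gact i j (gact p q (vec I)) = ∑ β, ∑ α, if I β = q then
        if Function.update I β p α = j then
          ((preSign 1 I β * preSign 1 (Function.update I β p) α : ℤ) : ℂ) •
            vec (Function.update (Function.update I β p) α i) else 0 else 0 := by
      rw [gact_vec, map_sum]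
      refine Finset.sum_congr rfl fun β _ => ?_
      by_cases h : I β = q
      · simp only [if_pos h]
        rw [map_smul, gact_vec, Finset.smul_sum, hi, hj, hp, hq, zero_add, add_zero]
        refine Finset.sum_congr rfl fun α _ => ?_
        split_ifs
        · rw [smul_smul]; push_cast; rfl
        · rw [smul_zero]
      · simp [if_neg h]
    have e2 : gact p q (gact i j (vec I)) = ∑ β, ∑ α, if I α = j then
        if Function.update I α i β = q then
          ((preSign 1 I α * preSign 1 (Function.update I α i) β : ℤ) : ℂ) •
            vec (Function.update (Function.update I α i) β p) else 0 else 0 := by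
      rw [gact_vec, map_sum, Finset.sum_comm]
      refine Finset.sum_congr rfl fun α _ => ?_
      by_cases h : I α = j
      · simp only [if_pos h]
        rw [map_smul, gact_vec, Finset.smul_sum, hi, hj, hp, hq, zero_add, add_zero]
        refine Finset.sum_congr rfl fun α _ => ?_
        split_ifs
        · rw [smul_smul]; push_cast; rfl
        · rw [smul_zero]
      · simp [if_neg h]
    rw [e1, e2, ← Finset.sum_add_distrib]
    simp only [← Finset.sum_add_distrib]
    have e3 : (if p = j then gact i q (vec I) else 0) + (if i = q then gact p j (vec I) else 0) =
        ∑ β, ((if p = j then if I β = q then vec (Function.update I β i) else 0 else 0) +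
          if i = q then if I β = j then vec (Function.update I β p) else 0 else 0) := by
      rw [Finset.sum_add_distrib, gact_vec, gact_vec, hi, hj, hp, hq, CharTwo.add_self_eq_zero,
        add_zero]
      simp only [preSign_zero, Int.cast_one, one_smul]
      split_ifs <;> simp
    rw [e3]
    refine Finset.sum_congr rfl fun β _ => ?_
    rw [Fintype.sum_eq_single β]
    · simp only [Function.update_self, preSign_update_self, preSign_mul_self, Function.update_idem,
        Int.cast_one, one_smul]
      congr 1
      · split_ifs <;> rfl
      · split_ifs <;> rfl
    · intro α hα
      rw [Function.update_of_ne hα, Function.update_of_ne (Ne.symm hα)]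
      by_cases h1 : I β = q <;> by_cases h2 : I α = j
      · simp only [if_pos h1, if_pos h2]
        rw [Function.update_comm hα, ← add_smul, preSign_update, preSign_update, h1, h2, hi, hj, hp,
          hq]
        rcases lt_or_gt_of_ne hα with h | h
        · simp only [h, h.not_gt, if_true, if_false]
          have : ((preSign 1 I β * (preSign 1 I α * 1) : ℤ) : ℂ) +
              ((preSign 1 I α * (preSign 1 I β * sgn (1 * (1 + 0))) : ℤ) : ℂ) = 0 := by
            simp [sgn_one]; ring
          rw [this, zero_smul]
        · simp only [h, h.not_gt, if_true, if_false]
          have : ((preSign 1 I β * (preSign 1 I α * sgn (1 * (0 + 1))) : ℤ) : ℂ) +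
              ((preSign 1 I α * (preSign 1 I β * 1) : ℤ) : ℂ) = 0 := by
            simp [sgn_one]; ring
          rw [this, zero_smul]
      · simp [h1, h2]
      · simp [h1, h2]
      · simp [h1, h2]
  have h : (gact i j ∘ₗ gact p q + gact p q ∘ₗ gact i j : T n m k →ₗ[ℂ] T n m k) =
      (if p = j then gact i q else 0) + if i = q then gact p j else 0 := by
    refine hom_ext fun I => ?_
    have := key I
    rw [LinearMap.add_apply, LinearMap.comp_apply, LinearMap.comp_apply, this, LinearMap.add_apply]
    split_ifs <;> rfl
  have := LinearMap.congr_fun h z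
  rw [LinearMap.add_apply, LinearMap.comp_apply, LinearMap.comp_apply, LinearMap.add_apply] at this
  rw [this]
  split_ifs <;> rfl

/-- The direct argument fails here, since an odd letter may replace one of the inserted even letters
without producing a repetition. Instead the commutator is shown to vanish by its relations with the
opposite odd part, the Casimir argument and the count of odd letters. -/
theorem gact_invOp_neg {i j : Idx n m} (hi : par i = 1) (hj : par j = 0) :
    gact i j ∘ₗ invOp n m = invOp n m ∘ₗ gact i j := by
  set f := gact i j ∘ₗ invOp n m - invOp n m ∘ₗ gact i j with hf
  have hfa : ∀ u, f u = gact i j (invOp n m u) - invOp n m (gact i j u) := fun u => rfl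
  -- the commutator anticommutes with the positive odd part
  have hanti : ∀ p q : Idx n m, par p = 0 → par q = 1 → ∀ u, gact p q (f u) = f (-gact p q u) := by
    intro p q hp hq u
    have hc : ∀ u, gact p q (invOp n m u) = invOp n m (gact p q u) := by
      intro u
      have := LinearMap.congr_fun (gact_invOp (i := p) (j := q) (by simp [hp])) u
      rw [LinearMap.add_apply, LinearMap.comp_apply, LinearMap.comp_apply, if_neg, zero_smul,
        LinearMap.zero_apply, add_zero] at this
      · exact this
      · rintro rfl; rw [hp] at hq; exact zero_ne_one hq
    have h1 := gact_anticomm hi hj hp hq (invOp n m u)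
    have h2 := congrArg (invOp n m) (gact_anticomm hi hj hp hq u)
    -- The anticommutator is even and commutes with `invOp`: each summand has a defect only if p = j
    -- and i = q, and then the defects -1 and 1 cancel.
    have h3 : (if p = j then gact i q (invOp n m u) else 0) +
        (if i = q then gact p j (invOp n m u) else 0) =
        invOp n m ((if p = j then gact i q u else 0) + if i = q then gact p j u else 0) := by
      have c1 := LinearMap.congr_fun (gact_invOp (i := i) (j := q) (by simp [hq])) u
      have c2 := LinearMap.congr_fun (gact_invOp (i := p) (j := j) (by simp [hp])) u
      simp only [LinearMap.add_apply, LinearMap.comp_apply, LinearMap.smul_apply] at c1 c2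
      rw [map_add]
      by_cases hpj : p = j <;> by_cases hiq : i = q
      · simp only [hpj, hiq, if_true] at c1 c2 ⊢
        rw [c1, c2, ← hiq, hi, hj, sgn_one, sgn_zero, Int.cast_neg, Int.cast_one, one_smul]
        have aux : ∀ {E : Type} [AddCommGroup E] [Module ℂ E] (u v w : E),
            u + (-1 : ℂ) • w + (v + w) = u + v := by
          intro E _ _ u v w
          module
        exact aux _ _ _
      · simp only [hpj, hiq, if_true, if_false, zero_smul, add_zero] at c1 ⊢
        rw [c1, map_zero, add_zero]
      · simp only [hpj, hiq, if_true, if_false, zero_smul, add_zero] at c2 ⊢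
        rw [c2, map_zero, zero_add]
      · simp only [hpj, hiq, if_false, map_zero]
    rw [h3] at h1
    rw [← h1, map_add] at h2
    rw [map_neg, hfa, hfa, map_sub, hc]
    have h4 := hc u
    rw [h4] at h2
    have aux : ∀ {E : Type} [AddCommGroup E] (a b c d : E), a + b = c + d → d - b = -(c - a) := by
      intro E _ a b c d h
      have : d = a + b - c := by rw [h]; abel
      rw [this]; abel
    exact aux _ _ _ _ h2
  -- the values of the commutator have the symmetry of a rectangle
  have hyoung : ∀ u, ∃ w, f u = young n m (colTab n (m + 1)) w := by
    intro u
    have h1 := LinearMap.congr_fun (young_gact (n := n) (m := m) (colTab n (m + 1)) i j)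
      (prepend n m (contract n m (young n m (bordTab n m) u)))
    refine ⟨gact i j (prepend n m (contract n m (young n m (bordTab n m) u))) -
      prepend n m (contract n m (young n m (bordTab n m) (gact i j u))), ?_⟩
    rw [LinearMap.comp_apply, LinearMap.comp_apply] at h1
    rw [map_sub, h1]
    rfl
  have hshift : Shifts f (1 - m) := by
    rw [hf]
    refine Shifts.sub ?_ ?_
    · have := (shifts_gact (k := n * (m + 1)) hi hj).comp (shifts_invOp (n := n) (m := m))
      rwa [neg_add_eq_sub] at this
    · have := (shifts_invOp (n := n) (m := m)).comp (shifts_gact (k := n * m + m) hi hj)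
      rwa [← sub_eq_add_neg] at this
  have hvec : ∀ I, oddDeg I < m → f (vec I) = 0 := by
    intro I hI
    have h0 := young_vec_eq_zero_of_oddDeg_lt (bordTab n m) (Nat.lt_succ_self n) hI
    have h1 := LinearMap.congr_fun (young_gact (n := n) (m := m) (bordTab n m) i j) (vec I)
    simp only [LinearMap.comp_apply, h0, map_zero] at h1
    rw [hfa]
    simp only [invOp, LinearMap.comp_apply, h0, h1, map_zero, sub_zero]
  have hnonneg : ∀ {k : ℕ} (K : Fin k → Idx n m), 0 ≤ oddDeg K := by
    intro k K
    exact Finset.sum_nonneg fun x _ => by split_ifs <;> norm_num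
  -- Induction on a bound for the number of odd letters in `f u`: E_pq with p even and q odd lowers
  -- it, and E_pq (f u) is again a value of f.
  have hmain : ∀ d : ℕ, ∀ u, (∀ K, coord K (f u) ≠ 0 → oddDeg K < d) → f u = 0 := by
    intro d
    induction d with
    | zero =>
      intro u hu
      refine tensor_ext fun K => ?_
      rw [map_zero]
      by_contra hK
      have := hu K hK
      have := hnonneg K
      push_cast at *
      omega
    | succ d ih =>
      intro u hu
      have hkill : ∀ p q : Idx n m, par p = 0 → par q = 1 → gact p q (f u) = 0 := by
        intro p q hp hq
        rw [hanti p q hp hq]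
        apply ih
        intro K hK
        rw [← hanti p q hp hq, coord_gact] at hK
        obtain ⟨α, -, h⟩ := Finset.exists_ne_zero_of_sum_ne_zero hK
        by_cases hα : K α = p
        · rw [if_pos hα] at h
          have := hu _ (right_ne_zero_of_mul h)
          rw [oddDeg_update, hα, hp, hq] at this
          simp at this
          omega
        · simp [if_neg hα] at h
      obtain ⟨w, hw⟩ := hyoung u
      have hodd := coord_eq_zero_of_killed (f u) (fun x => by
        rw [hw, sum_swap_young]; push_cast; rfl) hkill
      refine tensor_ext fun K => ?_
      rw [map_zero]
      by_cases hK : ∃ α, par (K α) = 1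
      · obtain ⟨α, hα⟩ := hK
        exact hodd K α hα
      · push Not at hK
        have hK0 : oddDeg K = 0 := Finset.sum_eq_zero fun α _ => if_neg (hK α)
        rw [← sum_coord u, map_sum, map_sum]
        refine Finset.sum_eq_zero fun I _ => ?_
        rw [map_smul, map_smul]
        by_cases h : coord K (f (vec I)) = 0
        · rw [h, smul_zero]
        -- A value without odd letters comes from m - 1 odd letters, where f vanishes.
        · have := hshift I K h
          rw [hvec I (by omega), map_zero, smul_zero]
  rw [← sub_eq_zero, ← hf]
  refine LinearMap.ext fun u => ?_
  refine hmain (n * (m + 1) + 1) u fun K _ => ?_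
  have : oddDeg K ≤ ∑ α : Fin (n * (m + 1)), 1 :=
    Finset.sum_le_sum fun x _ => by split_ifs <;> norm_num
  simp at this
  push_cast
  omega

/-! ### Commutation with the orthosymplectic Lie superalgebra -/

theorem conj_conj (i : Idx n m) : conj (conj i) = i := by
  cases i <;> simp [conj]

theorem par_conj (i : Idx n m) : par (conj i) = par i := by
  cases i <;> rfl

/-- The conjugation as a permutation of the indices. -/
def conjEquiv : Equiv.Perm (Idx n m) := ⟨conj, conj, conj_conj, conj_conj⟩

theorem cSign_mul_self (i : Idx n m) : cSign i * cSign i = 1 := by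
  unfold cSign; split_ifs <;> norm_num

theorem form_e_right (u : V n m) (l : Idx n m) : form u (e l) = cSign l * u (conj l) := by
  rw [form, Fintype.sum_eq_single (conj l)]
  · rw [conj_conj, e_apply, if_pos rfl, mul_one]
  · intro i hi
    rw [e_apply, if_neg, mul_zero]
    rintro rfl
    exact hi (conj_conj i).symm

theorem form_e_left (v : V n m) (j : Idx n m) : form (e j) v = cSign (conj j) * v (conj j) := by
  rw [form, Fintype.sum_eq_single j]
  · rw [e_apply, if_pos rfl, mul_one]
  · intro i hi
    rw [e_apply, if_neg hi, mul_zero, zero_mul]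

theorem IsOsp.entries {a : ZMod 2} {X : V n m →ₗ[ℂ] V n m} (h : IsOsp a X) (j l : Idx n m) :
    cSign l * X (e j) (conj l) + sgn (a * par j) * (cSign (conj j) * X (e l) (conj j)) = 0 := by
  have := h.preserves (par j) (e j) (Submodule.subset_span ⟨j, rfl, rfl⟩) (e l)
  rwa [form_e_right, form_e_left] at this

/-- For even X the invariance of the form gives opposite diagonal entries at i and at its conjugate,
which have the same parity; so the sum is its own negative. For odd X the diagonal is zero. -/
theorem IsOsp.supertrace {a : ZMod 2} {X : V n m →ₗ[ℂ] V n m} (h : IsOsp a X) :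
    ∑ i, X (e i) i * sgn (par i) = 0 := by
  refine eq_zero_of_eq_neg_complex ?_
  conv_lhs => rw [← Equiv.sum_comp conjEquiv]
  rw [← Finset.sum_neg_distrib]
  refine Finset.sum_congr rfl fun i _ => ?_
  change X (e (conj i)) (conj i) * sgn (par (conj i)) = _
  rw [par_conj]
  rcases zmod_two_cases a with rfl | rfl
  · have h1 := h.entries i (conj i)
    rw [conj_conj, zero_mul, sgn_zero] at h1
    have h2 : (cSign (conj i) : ℂ) * cSign (conj i) = 1 := by exact_mod_cast cSign_mul_self _
    have h3 : X (e i) i + X (e (conj i)) (conj i) = 0 := by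
      have := congrArg (fun x => (cSign (conj i) : ℂ) * x) h1
      push_cast at this
      linear_combination this - (X (e i) i + X (e (conj i)) (conj i)) * h2
    linear_combination sgn (par i) * h3
  · have h1 : ∀ i, X (e i) i = 0 := by
      intro i
      by_contra hc
      have := h.homog i i hc
      simp at this
    rw [h1, h1]; simp

/-- The scalar defects of the diagonal matrix units add up to the supertrace. -/
theorem invOp_act {a : ZMod 2} {X : V n m →ₗ[ℂ] V n m} (h : IsOsp a X) :
    invOp n m ∘ₗ act a X = act a X ∘ₗ invOp n m := by
  rw [act_eq_sum_gact h.homog, act_eq_sum_gact h.homog]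
  have hg : ∀ i j : Idx n m, gact i j ∘ₗ invOp n m = invOp n m ∘ₗ gact i j +
      (if i = j then (sgn (par i) : ℂ) else 0) • invOp n m := by
    intro i j
    by_cases hij : par i = 1 ∧ par j = 0
    · rw [gact_invOp_neg hij.1 hij.2, if_neg, zero_smul, add_zero]
      rintro rfl
      rw [hij.1] at hij
      exact one_ne_zero hij.2
    · exact gact_invOp hij
  refine LinearMap.ext fun z => ?_
  have hg' : ∀ i j : Idx n m, gact i j (invOp n m z) = invOp n m (gact i j z) +
      (if i = j then (sgn (par i) : ℂ) else 0) • invOp n m z :=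
    fun i j => LinearMap.congr_fun (hg i j) z
  simp only [LinearMap.comp_apply, LinearMap.sum_apply, LinearMap.smul_apply, map_sum, map_smul, hg',
    smul_add, Finset.sum_add_distrib]
  refine (add_eq_left.2 ?_).symm
  have h0 : (∑ i, X (e i) i * sgn (par i)) • invOp n m z = 0 := by rw [h.supertrace, zero_smul]
  rw [← h0, Finset.sum_smul]
  refine Finset.sum_congr rfl fun i _ => ?_
  rw [Fintype.sum_eq_single i]
  · rw [if_pos rfl, smul_smul]
  · intro j hj
    rw [if_neg (Ne.symm hj), zero_smul, smul_zero]

end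

section


variable {n m k l N : ℕ}

/-! ### Invariance of the powers of the form -/

/-- The sequence `z_1 z̃_1 … z_N z̃_N`. -/
def pairSeq (z : Fin N → Idx n m) : Fin (N * 2) → Idx n m := fun x =>
  if (finProdFinEquiv.symm x).2 = 0 then z (finProdFinEquiv.symm x).1
    else conj (z (finProdFinEquiv.symm x).1)

theorem pairSeq_zero (z : Fin N → Idx n m) (b : Fin N) :
    pairSeq z (finProdFinEquiv (b, 0)) = z b := by simp [pairSeq]

theorem pairSeq_one (z : Fin N → Idx n m) (b : Fin N) :
    pairSeq z (finProdFinEquiv (b, 1)) = conj (z b) := by simp [pairSeq]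

theorem formPower_eq : formPower n m N =
    ∑ z : Fin N → Idx n m, ((∏ b, cSign (z b) : ℤ) : ℂ) • vec (pairSeq z) := rfl

theorem coord_formPower (K : Fin (N * 2) → Idx n m) : coord K (formPower n m N) =
    ∏ b : Fin N, if K (finProdFinEquiv (b, 1)) = conj (K (finProdFinEquiv (b, 0))) then
      (cSign (K (finProdFinEquiv (b, 0))) : ℂ) else 0 := by
  rw [formPower_eq, map_sum]
  simp only [map_smul, coord_vec, smul_eq_mul]
  rw [Fintype.sum_eq_single fun b => K (finProdFinEquiv (b, 0))]
  · by_cases h : ∀ b : Fin N, K (finProdFinEquiv (b, 1)) = conj (K (finProdFinEquiv (b, 0)))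
    · rw [if_pos, mul_one]
      · push_cast
        exact Finset.prod_congr rfl fun b _ => (if_pos (h b)).symm
      · funext x
        obtain ⟨⟨b, ε⟩, rfl⟩ := finProdFinEquiv.surjective x
        fin_cases ε
        · exact pairSeq_zero _ b
        · exact (pairSeq_one _ b).trans (h b).symm
    · rw [if_neg, mul_zero]
      · push Not at h
        obtain ⟨b, hb⟩ := h
        exact (Finset.prod_eq_zero (Finset.mem_univ b) (if_neg hb)).symm
      · intro hK
        apply h
        intro b
        have h1 := congrFun hK (finProdFinEquiv (b, 1))
        rw [pairSeq_one] at h1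
        exact h1.symm
  · intro z hz
    rw [if_neg, mul_zero]
    rintro rfl
    apply hz
    funext b
    rw [pairSeq_zero]

theorem preSign_succ (a : ZMod 2) (I : Fin k → Idx n m) {x y : Fin k} (h : y.val = x.val + 1) :
    preSign a I y = preSign a I x * sgn (a * par (I x)) := by
  unfold preSign
  have : sgn (a * par (I x)) = ∏ β, if β = x then sgn (a * par (I β)) else 1 := by
    rw [Finset.prod_ite_eq' Finset.univ x, if_pos (Finset.mem_univ _)]
  rw [this, ← Finset.prod_mul_distrib]
  refine Finset.prod_congr rfl fun β _ => ?_
  rcases lt_trichotomy β x with h1 | h1 | h1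
  · have : β < y := by rw [Fin.lt_def] at *; omega
    simp [h1, this, h1.ne]
  · subst h1
    have : β < y := by rw [Fin.lt_def]; omega
    simp [this]
  · have : ¬ β < y := by rw [Fin.lt_def] at *; omega
    simp [this, h1.not_gt, h1.ne']

/-- The action treats one pair at a time, and within a pair the two terms cancel by `IsOsp.entries`;
the extra sign of the second term comes from passing the first letter of the pair. -/
theorem act_formPower {a : ZMod 2} {X : V n m →ₗ[ℂ] V n m} (h : IsOsp a X) :
    act a X (formPower n m N) = 0 := by
  refine tensor_ext fun K => ?_
  rw [map_zero, coord_act, ← Equiv.sum_comp finProdFinEquiv, Fintype.sum_prod_type]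
  refine Finset.sum_eq_zero fun b _ => ?_
  rw [Fin.sum_univ_two]
  set k0 := K (finProdFinEquiv (b, 0)) with hk0
  set k1 := K (finProdFinEquiv (b, 1)) with hk1
  set R : ℂ := ∏ b' ∈ {b}ᶜ, if K (finProdFinEquiv (b', 1)) = conj (K (finProdFinEquiv (b', 0))) then
      (cSign (K (finProdFinEquiv (b', 0))) : ℂ) else 0 with hR
  have e0 : ∀ j, coord (Function.update K (finProdFinEquiv (b, 0)) j) (formPower n m N) =
      (if k1 = conj j then (cSign j : ℂ) else 0) * R := by
    intro j
    rw [coord_formPower, Fintype.prod_eq_mul_prod_compl b, Function.update_self,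
      Function.update_of_ne (by simp)]
    congr 1
    refine Finset.prod_congr rfl fun b' hb' => ?_
    have hb' : b' ≠ b := by simpa using hb'
    rw [Function.update_of_ne (by simp [hb']), Function.update_of_ne (by simp [hb'])]
  have e1 : ∀ j, coord (Function.update K (finProdFinEquiv (b, 1)) j) (formPower n m N) =
      (if j = conj k0 then (cSign k0 : ℂ) else 0) * R := by
    intro j
    rw [coord_formPower, Fintype.prod_eq_mul_prod_compl b, Function.update_self,
      Function.update_of_ne (by simp)]
    congr 1
    refine Finset.prod_congr rfl fun b' hb' => ?_
    have hb' : b' ≠ b := by simpa using hb'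
    rw [Function.update_of_ne (by simp [hb']), Function.update_of_ne (by simp [hb'])]
  simp only [e0, e1]
  -- Only the conjugate of the other letter completes the pair to one with nonzero coefficient.
  rw [Fintype.sum_eq_single (conj k1), Fintype.sum_eq_single (conj k0), conj_conj, if_pos rfl,
    if_pos rfl, preSign_succ a K (x := finProdFinEquiv (b, 0)) (y := finProdFinEquiv (b, 1))
      (by simp [finProdFinEquiv]; ring), ← hk0]
  · have h1 := h.entries (conj k0) (conj k1)
    rw [conj_conj, conj_conj, par_conj] at h1
    have h2 : (cSign (conj k1) : ℂ) * cSign (conj k1) = 1 := by exact_mod_cast cSign_mul_self _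
    have h3 : (cSign k0 : ℂ) * cSign k0 = 1 := by exact_mod_cast cSign_mul_self _
    have h4 : (sgn (a * par k0) : ℂ) * sgn (a * par k0) = 1 := by exact_mod_cast sgn_mul_self _
    push_cast
    linear_combination preSign a K (finProdFinEquiv (b, 0)) * R *
      ((sgn (a * par k0) * cSign k0 * cSign (conj k1) : ℂ) * h1 -
        sgn (a * par k0) * cSign k0 * X (e (conj k0)) k1 * h2 -
        cSign (conj k1) * X (e (conj k1)) k0 * cSign k0 * cSign k0 * h4 -
        cSign (conj k1) * X (e (conj k1)) k0 * h3)
  · intro j hj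
    rw [if_neg hj]; simp
  · intro j hj
    rw [if_neg]
    · simp
    · rintro h
      apply hj
      rw [h, conj_conj]

theorem act_formTensor {r : ℕ} {a : ZMod 2} {X : V n (2 * r) →ₗ[ℂ] V n (2 * r)} (h : IsOsp a X) :
    act a X (formTensor n r) = 0 := by
  have := LinearMap.congr_fun (permAct_act h.homog (rowArrange n r))
    (formPower n (2 * r) ((n + 1) * r))
  rw [LinearMap.comp_apply, LinearMap.comp_apply, act_formPower h, map_zero] at this
  exact this.symm

end

/-! ### Quasi-idempotence, and reduction of 𝓛 to column antisymmetrization and the last row. -/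

section


variable {n m k l : ℕ} {a b : ℕ} {t : Fin a × Fin b ≃ Fin k}

/-! ### Rectangular Young symmetrizers are quasi-idempotent -/

theorem coeff_ofPerm_mul (σ g : Equiv.Perm (Fin k)) (x : PermAlg k) :
    (ofPerm σ * x).coeff g = x.coeff (σ⁻¹ * g) := by
  have := MonoidAlgebra.coeff_single_mul_eq_mul_coeff (x := x) (m := σ) (m₁ := g) (r := (1 : ℂ))
    (σ⁻¹ * g) (fun m' _ => by rw [eq_inv_mul_iff_mul_eq])
  rwa [one_mul] at this

theorem coeff_mul_ofPerm (σ g : Equiv.Perm (Fin k)) (x : PermAlg k) :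
    (x * ofPerm σ).coeff g = x.coeff (g * σ⁻¹) := by
  have := MonoidAlgebra.coeff_mul_single_eq_coeff_mul (x := x) (m := σ) (m₁ := g) (r := (1 : ℂ))
    (g * σ⁻¹) (fun m' _ => by rw [eq_mul_inv_iff_mul_eq])
  rwa [mul_one] at this

theorem coeff_ofPerm (σ g : Equiv.Perm (Fin k)) :
    (ofPerm σ).coeff g = if σ = g then (1 : ℂ) else 0 := by
  have : (ofPerm σ).coeff = Finsupp.single σ (1 : ℂ) := rfl
  rw [this, Finsupp.single_apply]

/-- A permutation that is not the product of a row and a column permutation maps two positions of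
the same column to the same row. -/
theorem exists_of_not_mem_mul (t : Fin a × Fin b ≃ Fin k) (g : Equiv.Perm (Fin k))
    (hg : ¬ ∃ σ ∈ rowStab t, ∃ τ ∈ colStab t, g = σ * τ) :
    ∃ x y, x ≠ y ∧ rowOf t x = rowOf t y ∧ colOf t (g⁻¹ x) = colOf t (g⁻¹ y) := by
  by_contra hc
  push Not at hc
  apply hg
  -- If no such positions exist, moving each x within its row to the column of `g⁻¹ x` is a
  -- permutation ρ. It preserves rows, ρ g preserves columns, and g = ρ⁻¹ (ρ g).
  have hinj : Function.Injective fun x => t (rowOf t x, colOf t (g⁻¹ x)) := by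
    intro x y h
    have h' := Prod.mk.inj (t.injective h)
    by_contra hne
    exact hc x y hne h'.1 h'.2
  set ρ : Equiv.Perm (Fin k) := Equiv.ofBijective _ (Finite.injective_iff_bijective.1 hinj) with hρ
  have hρx : ∀ x, ρ x = t (rowOf t x, colOf t (g⁻¹ x)) := fun x => rfl
  have hrow : ρ ∈ rowStab t := by
    rw [mem_rowStab]
    intro x
    rw [hρx]
    conv_lhs => rw [rowOf, Equiv.symm_apply_apply]
  refine ⟨ρ⁻¹, inv_mem_rowStab hrow, ρ * g, ?_, by simp⟩
  rw [mem_colStab]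
  intro x
  rw [Equiv.Perm.mul_apply, hρx]
  conv_lhs => rw [colOf, Equiv.symm_apply_apply]
  simp

theorem eq_one_of_mem_rowStab_colStab {σ : Equiv.Perm (Fin k)} (h : σ ∈ rowStab t)
    (h' : σ ∈ colStab t) : σ = 1 := by
  rw [mem_rowStab] at h
  rw [mem_colStab] at h'
  ext x
  rw [eq_of_rowOf_of_colOf (h x) (h' x)]; rfl

/-- Only 1 preserves both rows and columns, so 1 arises once as a product of a row and a column
permutation. -/
theorem coeff_one_rowSum_mul_colSum : (rowSum t * colSum t).coeff 1 = 1 := by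
  have h1 : (1 : Equiv.Perm (Fin k)) ∈ rowStab t := by rw [mem_rowStab]; simp
  have h2 : (1 : Equiv.Perm (Fin k)) ∈ colStab t := by rw [mem_colStab]; simp
  rw [rowSum, Finset.sum_mul, MonoidAlgebra.coeff_sum, Finsupp.finsetSum_apply,
    Finset.sum_eq_single 1]
  · rw [ofPerm_one, one_mul, colSum, MonoidAlgebra.coeff_sum, Finsupp.finsetSum_apply,
      Finset.sum_eq_single 1]
    · rw [MonoidAlgebra.coeff_smul_apply, coeff_ofPerm]; simp
    · intro τ _ hτ
      rw [MonoidAlgebra.coeff_smul_apply, coeff_ofPerm, if_neg hτ, smul_zero]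
    · exact fun h => absurd h2 h
  · intro σ hσ hne
    rw [coeff_ofPerm_mul, colSum, MonoidAlgebra.coeff_sum, Finsupp.finsetSum_apply]
    refine Finset.sum_eq_zero fun τ hτ => ?_
    rw [MonoidAlgebra.coeff_smul_apply, coeff_ofPerm, if_neg, smul_zero]
    rintro rfl
    rw [mul_one] at hτ
    have := eq_one_of_mem_rowStab_colStab (inv_mem_rowStab hσ) hτ
    exact hne (inv_eq_one.1 this)
  · exact fun h => absurd h1 h

/-- Von Neumann's lemma. The symmetry determines the coefficients at products στ from the one at 1;
at any other g, a transposition that is a row permutation on the left of g and a column permutation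
on its right makes the coefficient its own negative. -/
theorem eq_smul_of_row_col {x : PermAlg k} (hr : ∀ σ ∈ rowStab t, ofPerm σ * x = x)
    (hc : ∀ τ ∈ colStab t, x * ofPerm τ = ((Equiv.Perm.sign τ : ℤ) : ℂ) • x) :
    x = x.coeff 1 • (rowSum t * colSum t) := by
  have hval : ∀ y : PermAlg k, (∀ σ ∈ rowStab t, ofPerm σ * y = y) →
      (∀ τ ∈ colStab t, y * ofPerm τ = ((Equiv.Perm.sign τ : ℤ) : ℂ) • y) →
      (∀ σ ∈ rowStab t, ∀ g, y.coeff (σ * g) = y.coeff g) ∧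
      ∀ τ ∈ colStab t, ∀ g, y.coeff (g * τ) = ((Equiv.Perm.sign τ : ℤ) : ℂ) * y.coeff g := by
    intro y hr hc
    constructor
    · intro σ hσ g
      conv_lhs => rw [← hr σ hσ, coeff_ofPerm_mul, inv_mul_cancel_left]
    · intro τ hτ g
      have := congrArg (fun z => MonoidAlgebra.coeff z (g * τ)) (hc τ hτ)
      simp only [coeff_mul_ofPerm, MonoidAlgebra.coeff_smul_apply, mul_inv_cancel_right,
        smul_eq_mul] at this
      rw [this, ← mul_assoc, sign_mul_sign, one_mul]
  have hx := hval x hr hc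
  have he := hval (rowSum t * colSum t) (fun σ hσ => by rw [← mul_assoc, ofPerm_mul_rowSum hσ])
    (fun τ hτ => by rw [mul_assoc, colSum_mul_ofPerm hτ, mul_smul_comm])
  have hzero : ∀ y : PermAlg k, ((∀ σ ∈ rowStab t, ∀ g, y.coeff (σ * g) = y.coeff g) ∧
      ∀ τ ∈ colStab t, ∀ g, y.coeff (g * τ) = ((Equiv.Perm.sign τ : ℤ) : ℂ) * y.coeff g) →
      ∀ g, (¬ ∃ σ ∈ rowStab t, ∃ τ ∈ colStab t, g = σ * τ) → y.coeff g = 0 := by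
    intro y hy g hg
    obtain ⟨u, v, hne, hrow, hcol⟩ := exists_of_not_mem_mul t g hg
    refine eq_zero_of_eq_neg_complex ?_
    have e2 : Equiv.swap u v * g = g * Equiv.swap (g⁻¹ u) (g⁻¹ v) := by
      rw [Equiv.mul_swap_eq_swap_mul]; simp
    have hne' : g⁻¹ u ≠ g⁻¹ v := fun h => hne (g⁻¹.injective h)
    conv_lhs => rw [← hy.1 _ (swap_mem_rowStab hrow) g, e2, hy.2 _ (swap_mem_colStab hcol),
      Equiv.Perm.sign_swap hne']
    simp
  refine MonoidAlgebra.ext (Finsupp.ext fun g => ?_)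
  rw [MonoidAlgebra.coeff_smul_apply, smul_eq_mul]
  by_cases hg : ∃ σ ∈ rowStab t, ∃ τ ∈ colStab t, g = σ * τ
  · obtain ⟨σ, hσ, τ, hτ, rfl⟩ := hg
    have e1 : ∀ y : PermAlg k, ((∀ σ ∈ rowStab t, ∀ g, y.coeff (σ * g) = y.coeff g) ∧
      ∀ τ ∈ colStab t, ∀ g, y.coeff (g * τ) = ((Equiv.Perm.sign τ : ℤ) : ℂ) * y.coeff g) →
      y.coeff (σ * τ) = ((Equiv.Perm.sign τ : ℤ) : ℂ) * y.coeff 1 := by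
      intro y hy
      rw [hy.1 σ hσ, ← one_mul τ, hy.2 τ hτ, one_mul]
    rw [e1 x hx, e1 _ he, coeff_one_rowSum_mul_colSum]
    ring
  · rw [hzero x hx g hg, hzero _ he g hg, mul_zero]

/-- A rectangular Young symmetrizer is a nonzero multiple of an idempotent. -/
theorem exists_rowSum_mul_colSum_sq (t : Fin a × Fin b ≃ Fin k) :
    ∃ h : ℂ, h ≠ 0 ∧
      (rowSum t * colSum t) * (rowSum t * colSum t) = h • (rowSum t * colSum t) := by
  set E := rowSum t * colSum t with hE
  have hsq := eq_smul_of_row_col (t := t) (x := E * E)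
    (fun σ hσ => by rw [hE, ← mul_assoc, ← mul_assoc (ofPerm σ), ofPerm_mul_rowSum hσ])
    (fun τ hτ => by
      rw [mul_assoc E, hE, mul_assoc (rowSum t) (colSum t) (ofPerm τ), colSum_mul_ofPerm hτ,
        mul_smul_comm, mul_smul_comm])
  refine ⟨(E * E).coeff 1, ?_, hsq⟩
  intro h0
  rw [h0, zero_smul] at hsq
  -- If the scalar were 0, left multiplication by E would be nilpotent and have trace 0. But each of
  -- its diagonal entries is the coefficient of E at 1, so the trace is the order of the group.
  have hnil : IsNilpotent (LinearMap.mulLeft ℂ E) :=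
    ⟨2, by rw [pow_two, Module.End.mul_eq_comp, ← LinearMap.mulLeft_mul, hsq,
      LinearMap.mulLeft_zero_eq_zero]⟩
  have htr := (LinearMap.isNilpotent_trace_of_isNilpotent hnil).eq_zero
  rw [LinearMap.trace_eq_matrix_trace ℂ (MonoidAlgebra.basis (Equiv.Perm (Fin k)) ℂ),
    Matrix.trace] at htr
  have hdiag : ∀ g : Equiv.Perm (Fin k), (LinearMap.toMatrix
      (MonoidAlgebra.basis (Equiv.Perm (Fin k)) ℂ) (MonoidAlgebra.basis (Equiv.Perm (Fin k)) ℂ)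
      (LinearMap.mulLeft ℂ E)).diag g = 1 := by
    intro g
    rw [Matrix.diag_apply, LinearMap.toMatrix_apply, LinearMap.mulLeft_apply]
    change (E * ofPerm g).coeff g = 1
    rw [coeff_mul_ofPerm, mul_inv_cancel, hE, coeff_one_rowSum_mul_colSum]
  rw [Finset.sum_congr rfl fun g _ => hdiag g] at htr
  simp at htr

theorem card_rowStab_ne_zero (t : Fin a × Fin b ≃ Fin k) : ((rowStab t).card : ℂ) ≠ 0 := by
  rw [Nat.cast_ne_zero, ← Nat.pos_iff_ne_zero, Finset.card_pos]
  exact ⟨1, by rw [mem_rowStab]; simp⟩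

theorem card_colStab_ne_zero (t : Fin a × Fin b ≃ Fin k) : ((colStab t).card : ℂ) ≠ 0 := by
  rw [Nat.cast_ne_zero, ← Nat.pos_iff_ne_zero, Finset.card_pos]
  exact ⟨1, by rw [mem_colStab]; simp⟩

end

section


variable {n m k l : ℕ} {a b : ℕ} {t : Fin a × Fin b ≃ Fin k}

/-! ### Parametrization of the row and column stabilizers -/

/-- The permutation of the positions of a tableau that acts by `f j` on the `j`-th column. -/
def colPerm (t : Fin a × Fin b ≃ Fin k) (f : Fin b → Equiv.Perm (Fin a)) : Equiv.Perm (Fin k) :=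
  t.permCongr (Equiv.prodCongrLeft f)

/-- The permutation of the positions of a tableau that acts by `g i` on the `i`-th row. -/
def rowPerm (t : Fin a × Fin b ≃ Fin k) (g : Fin a → Equiv.Perm (Fin b)) : Equiv.Perm (Fin k) :=
  t.permCongr (Equiv.prodCongrRight g)

theorem colPerm_apply (f : Fin b → Equiv.Perm (Fin a)) (i : Fin a) (j : Fin b) :
    colPerm t f (t (i, j)) = t (f j i, j) := by
  simp [colPerm, Equiv.permCongr_apply]

theorem rowPerm_apply (g : Fin a → Equiv.Perm (Fin b)) (i : Fin a) (j : Fin b) :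
    rowPerm t g (t (i, j)) = t (i, g i j) := by
  simp [rowPerm, Equiv.permCongr_apply]

theorem perm_ext_cells {σ τ : Equiv.Perm (Fin k)} (t : Fin a × Fin b ≃ Fin k)
    (h : ∀ i j, σ (t (i, j)) = τ (t (i, j))) : σ = τ := by
  ext1 x
  obtain ⟨⟨i, j⟩, rfl⟩ := t.surjective x
  exact h i j

theorem rowOf_cell (i : Fin a) (j : Fin b) : rowOf t (t (i, j)) = i := by simp [rowOf]

theorem colOf_cell (i : Fin a) (j : Fin b) : colOf t (t (i, j)) = j := by simp [colOf]

theorem colPerm_mul (f g : Fin b → Equiv.Perm (Fin a)) :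
    colPerm t (f * g) = colPerm t f * colPerm t g := by
  refine perm_ext_cells t fun i j => ?_
  rw [Equiv.Perm.mul_apply, colPerm_apply, colPerm_apply, colPerm_apply]; rfl

theorem colPerm_one : colPerm t 1 = 1 := by
  refine perm_ext_cells t fun i j => ?_
  rw [colPerm_apply]; rfl

theorem sign_colPerm (f : Fin b → Equiv.Perm (Fin a)) :
    Equiv.Perm.sign (colPerm t f) = ∏ j, Equiv.Perm.sign (f j) := by
  rw [colPerm, Equiv.Perm.sign_permCongr, Equiv.Perm.sign_prodCongrLeft]

theorem colPerm_mem (f : Fin b → Equiv.Perm (Fin a)) : colPerm t f ∈ colStab t := by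
  rw [mem_colStab]
  intro x
  obtain ⟨⟨i, j⟩, rfl⟩ := t.surjective x
  rw [colPerm_apply, colOf_cell, colOf_cell]

theorem rowPerm_mem (g : Fin a → Equiv.Perm (Fin b)) : rowPerm t g ∈ rowStab t := by
  rw [mem_rowStab]
  intro x
  obtain ⟨⟨i, j⟩, rfl⟩ := t.surjective x
  rw [rowPerm_apply, rowOf_cell, rowOf_cell]

theorem colPerm_injective : Function.Injective (colPerm t) := by
  intro f g h
  funext j
  ext1 i
  have := Equiv.congr_fun h (t (i, j))
  rw [colPerm_apply, colPerm_apply] at this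
  exact (Prod.mk.inj (t.injective this)).1

theorem rowPerm_injective : Function.Injective (rowPerm t) := by
  intro f g h
  funext i
  ext1 j
  have := Equiv.congr_fun h (t (i, j))
  rw [rowPerm_apply, rowPerm_apply] at this
  exact (Prod.mk.inj (t.injective this)).2

theorem exists_colPerm {τ : Equiv.Perm (Fin k)} (h : τ ∈ colStab t) : ∃ f, colPerm t f = τ := by
  rw [mem_colStab] at h
  have hcell : ∀ i j, τ (t (i, j)) = t (rowOf t (τ (t (i, j))), j) := by
    intro i j
    refine eq_of_rowOf_of_colOf (t := t) ?_ ?_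
    · rw [rowOf_cell]
    · rw [h, colOf_cell, colOf_cell]
  have hinj : ∀ j, Function.Injective fun i => rowOf t (τ (t (i, j))) := by
    intro j i i' hi
    have : τ (t (i, j)) = τ (t (i', j)) := by rw [hcell i, hcell i']; exact congrArg (fun p => t (p, j)) hi
    exact (Prod.mk.inj (t.injective (τ.injective this))).1
  refine ⟨fun j => Equiv.ofBijective _ (Finite.injective_iff_bijective.1 (hinj j)), ?_⟩
  refine perm_ext_cells t fun i j => ?_
  rw [colPerm_apply, hcell i j]; rfl

theorem exists_rowPerm {σ : Equiv.Perm (Fin k)} (h : σ ∈ rowStab t) : ∃ g, rowPerm t g = σ := by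
  rw [mem_rowStab] at h
  have hcell : ∀ i j, σ (t (i, j)) = t (i, colOf t (σ (t (i, j)))) := by
    intro i j
    refine eq_of_rowOf_of_colOf (t := t) ?_ ?_
    · rw [h, rowOf_cell, rowOf_cell]
    · rw [colOf_cell]
  have hinj : ∀ i, Function.Injective fun j => colOf t (σ (t (i, j))) := by
    intro i j j' hj
    have : σ (t (i, j)) = σ (t (i, j')) := by rw [hcell i j, hcell i j']; exact congrArg (fun p => t (i, p)) hj
    exact (Prod.mk.inj (t.injective (σ.injective this))).2
  refine ⟨fun i => Equiv.ofBijective _ (Finite.injective_iff_bijective.1 (hinj i)), ?_⟩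
  refine perm_ext_cells t fun i j => ?_
  rw [rowPerm_apply, hcell i j]; rfl

theorem colSum_eq : colSum t =
    ∑ f, ((∏ j, (Equiv.Perm.sign (f j) : ℤ) : ℤ) : ℂ) • ofPerm (colPerm t f) := by
  rw [colSum]
  refine (Finset.sum_nbij (colPerm t) (fun f _ => colPerm_mem f) colPerm_injective.injOn
    (fun τ hτ => ?_) fun f _ => ?_).symm
  · obtain ⟨f, rfl⟩ := exists_colPerm hτ
    exact ⟨f, by simp, rfl⟩
  · rw [sign_colPerm]; push_cast; rfl

theorem rowSum_eq : rowSum t = ∑ g, ofPerm (rowPerm t g) := by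
  rw [rowSum]
  refine (Finset.sum_nbij (rowPerm t) (fun f _ => rowPerm_mem f) rowPerm_injective.injOn
    (fun τ hτ => ?_) fun f _ => rfl).symm
  obtain ⟨f, rfl⟩ := exists_rowPerm hτ
  exact ⟨f, by simp, rfl⟩

/-! ### The positions of `w` in `v_{I_1} ⊗ w` -/

/-- Permutations of the positions of `w` as permutations of the positions of `v_{I_1} ⊗ w`. -/
def shiftPerm (n m : ℕ) : Equiv.Perm (Fin (n * m)) →* Equiv.Perm (Fin (n * (m + 1))) where
  toFun σ := (prependPos n m).permCongr (Equiv.sumCongr (Equiv.refl _) σ)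
  map_one' := by
    ext1 x
    obtain ⟨u, rfl⟩ := (prependPos n m).surjective x
    rcases u with u | u <;> simp [Equiv.permCongr_apply]
  map_mul' σ τ := by
    ext1 x
    obtain ⟨u, rfl⟩ := (prependPos n m).surjective x
    rcases u with u | u <;> simp [Equiv.permCongr_apply]

theorem shiftPerm_inl (σ : Equiv.Perm (Fin (n * m))) (i : Fin n) :
    shiftPerm n m σ (prependPos n m (Sum.inl i)) = prependPos n m (Sum.inl i) := by
  simp [shiftPerm, Equiv.permCongr_apply]

theorem shiftPerm_inr (σ : Equiv.Perm (Fin (n * m))) (x : Fin (n * m)) :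
    shiftPerm n m σ (prependPos n m (Sum.inr x)) = prependPos n m (Sum.inr (σ x)) := by
  simp [shiftPerm, Equiv.permCongr_apply]

theorem sign_shiftPerm (σ : Equiv.Perm (Fin (n * m))) :
    Equiv.Perm.sign (shiftPerm n m σ) = Equiv.Perm.sign σ := by
  change Equiv.Perm.sign ((prependPos n m).permCongr (Equiv.Perm.sumCongr 1 σ)) = _
  rw [Equiv.Perm.sign_permCongr, Equiv.Perm.sign_sumCongr]
  simp

theorem permSign_shiftPerm (σ : Equiv.Perm (Fin (n * m))) (L : Fin (n * m) → Idx n m) :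
    permSign (shiftPerm n m σ) (prependSeq L) = permSign σ L := by
  unfold permSign
  rw [← Equiv.prod_comp (prependPos n m), Fintype.prod_sum_type]
  rw [Finset.prod_eq_one, one_mul]
  · refine Finset.prod_congr rfl fun x _ => ?_
    rw [← Equiv.prod_comp (prependPos n m), Fintype.prod_sum_type, Finset.prod_eq_one, one_mul]
    · refine Finset.prod_congr rfl fun y _ => ?_
      simp only [shiftPerm_inr, prependSeq_inr, prependPos_lt_iff, finSumFinEquiv_apply_right,
        Fin.val_natAdd, Nat.add_lt_add_iff_left]
      rfl
    · intro y _; simp [prependSeq_inl, par]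
  · intro x _
    exact Finset.prod_eq_one fun y _ => by simp [prependSeq_inl, par]

theorem prepend_permAct (σ : Equiv.Perm (Fin (n * m))) (z : T n m (n * m)) :
    prepend n m (permAct n m σ z) = permAct n m (shiftPerm n m σ) (prepend n m z) := by
  refine LinearMap.congr_fun (f := prepend n m ∘ₗ permAct n m σ)
    (g := permAct n m (shiftPerm n m σ) ∘ₗ prepend n m) (hom_ext fun L => ?_) z
  rw [LinearMap.comp_apply, LinearMap.comp_apply, permAct_vec, map_smul, prepend_vec, prepend_vec,
    permAct_vec, permSign_shiftPerm]
  congr 2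
  funext x
  obtain ⟨u, rfl⟩ := (prependPos n m).surjective x
  rw [Function.comp_apply]
  rcases u with u | u
  · have h : (shiftPerm n m σ).symm (prependPos n m (Sum.inl u)) = prependPos n m (Sum.inl u) := by
      rw [Equiv.symm_apply_eq, shiftPerm_inl]
    rw [h, prependSeq_inl, prependSeq_inl]
  · have h : (shiftPerm n m σ).symm (prependPos n m (Sum.inr u)) =
        prependPos n m (Sum.inr (σ.symm u)) := by
      rw [Equiv.symm_apply_eq, shiftPerm_inr, Equiv.apply_symm_apply]
    rw [h, prependSeq_inr, prependSeq_inr]; rfl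

/-- The map of group algebras that extends `shiftPerm`. -/
noncomputable def shiftAlg (n m : ℕ) : PermAlg (n * m) →ₐ[ℂ] PermAlg (n * (m + 1)) :=
  MonoidAlgebra.lift ℂ _ _ ((MonoidAlgebra.of ℂ _).comp (shiftPerm n m))

theorem shiftAlg_ofPerm (σ : Equiv.Perm (Fin (n * m))) :
    shiftAlg n m (ofPerm σ) = ofPerm (shiftPerm n m σ) := by
  rw [shiftAlg, ofPerm, MonoidAlgebra.lift_of]; rfl

theorem prepend_algRep (x : PermAlg (n * m)) (z : T n m (n * m)) :
    prepend n m (algRep n m _ x z) = algRep n m _ (shiftAlg n m x) (prepend n m z) := by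
  induction x using MonoidAlgebra.induction_on with
  | of σ =>
    change prepend n m (algRep n m _ (ofPerm σ) z) = algRep n m _ (shiftAlg n m (ofPerm σ)) _
    rw [shiftAlg_ofPerm, algRep_ofPerm, algRep_ofPerm, prepend_permAct]
  | add x y hx hy =>
    rw [map_add, LinearMap.add_apply, map_add, hx, hy, map_add, map_add, LinearMap.add_apply]
  | smul c x hx =>
    rw [map_smul, LinearMap.smul_apply, map_smul, hx, map_smul, map_smul, LinearMap.smul_apply]

theorem shiftPerm_colPerm (f : Fin m → Equiv.Perm (Fin n)) :
    shiftPerm n m (colPerm (colTab n m) f) =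
      colPerm (colTab n (m + 1)) (Fin.cons 1 f : Fin (m + 1) → Equiv.Perm (Fin n)) := by
  refine perm_ext_cells (colTab n (m + 1)) fun i j => ?_
  rw [colPerm_apply]
  refine Fin.cases ?_ (fun j => ?_) j
  · rw [colTab_zero, shiftPerm_inl, Fin.cons_zero]; exact (colTab_zero i).symm
  · rw [colTab_succ, shiftPerm_inr, colPerm_apply, Fin.cons_succ, ← colTab_succ]

theorem shiftPerm_mem_rowStab {σ : Equiv.Perm (Fin (n * m))} (h : σ ∈ rowStab (colTab n m)) :
    shiftPerm n m σ ∈ rowStab (colTab n (m + 1)) := by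
  obtain ⟨g, rfl⟩ := exists_rowPerm h
  rw [mem_rowStab]
  intro x
  obtain ⟨⟨i, j⟩, rfl⟩ := (colTab n (m + 1)).surjective x
  refine Fin.cases ?_ (fun j => ?_) j
  · rw [colTab_zero, shiftPerm_inl]
  · rw [colTab_succ, shiftPerm_inr, rowPerm_apply, ← colTab_succ, ← colTab_succ, rowOf_cell,
      rowOf_cell]

theorem shiftPerm_mem_colStab {σ : Equiv.Perm (Fin (n * m))} (h : σ ∈ colStab (colTab n m)) :
    shiftPerm n m σ ∈ colStab (colTab n (m + 1)) := by
  obtain ⟨g, rfl⟩ := exists_colPerm h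
  rw [shiftPerm_colPerm]
  exact colPerm_mem _

/-- The signed sum of the permutations of the first column. -/
noncomputable def firstColSum (n m : ℕ) : PermAlg (n * (m + 1)) :=
  ∑ g : Equiv.Perm (Fin n), ((Equiv.Perm.sign g : ℤ) : ℂ) •
    ofPerm (colPerm (colTab n (m + 1)) (Fin.cons g 1 : Fin (m + 1) → Equiv.Perm (Fin n)))

/-- The columns after the first one form the smaller rectangle. -/
theorem colSum_colTab_succ : colSum (colTab n (m + 1)) =
    firstColSum n m * shiftAlg n m (colSum (colTab n m)) := by
  rw [colSum_eq, colSum_eq, map_sum, firstColSum, Finset.sum_mul_sum, ← Fintype.sum_prod_type',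
    ← Equiv.sum_comp (Fin.consEquiv fun _ : Fin (m + 1) => Equiv.Perm (Fin n))]
  refine Finset.sum_congr rfl fun gf _ => ?_
  obtain ⟨g, f⟩ := gf
  rw [map_smul, shiftAlg_ofPerm, smul_mul_smul_comm, ← ofPerm_mul, shiftPerm_colPerm, ← colPerm_mul]
  congr 1
  · simp only [Fin.consEquiv, Equiv.coe_fn_mk, Fin.prod_univ_succ, Fin.cons_zero, Fin.cons_succ]
    push_cast; rfl
  · congr 2
    funext j
    refine Fin.cases ?_ (fun j => ?_) j <;> simp [Fin.consEquiv]

/-- The two factors permute disjoint sets of positions. -/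
theorem firstColSum_mul_shiftAlg (x : PermAlg (n * m)) :
    firstColSum n m * shiftAlg n m x = shiftAlg n m x * firstColSum n m := by
  induction x using MonoidAlgebra.induction_on with
  | of σ =>
    change firstColSum n m * shiftAlg n m (ofPerm σ) = shiftAlg n m (ofPerm σ) * firstColSum n m
    rw [shiftAlg_ofPerm, firstColSum, Finset.sum_mul, Finset.mul_sum]
    refine Finset.sum_congr rfl fun g _ => ?_
    rw [smul_mul_assoc, mul_smul_comm, ← ofPerm_mul, ← ofPerm_mul]
    congr 2
    ext1 x
    obtain ⟨u, rfl⟩ := (prependPos n m).surjective x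
    rw [Equiv.Perm.mul_apply, Equiv.Perm.mul_apply]
    rcases u with u | u
    · rw [shiftPerm_inl, ← colTab_zero, colPerm_apply, colTab_zero, shiftPerm_inl]
    · have : ∀ y, colPerm (colTab n (m + 1)) (Fin.cons g 1 : Fin (m + 1) → Equiv.Perm (Fin n))
          (prependPos n m (Sum.inr y)) = prependPos n m (Sum.inr y) := by
        intro y
        obtain ⟨⟨i, j⟩, rfl⟩ := (colTab n m).surjective y
        rw [← colTab_succ, colPerm_apply]; simp
      rw [shiftPerm_inr, this, this, shiftPerm_inr]
  | add x y hx hy => rw [map_add, mul_add (firstColSum n m), hx, hy, add_mul _ _ (firstColSum n m)]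
  | smul c x hx => rw [map_smul, mul_smul_comm, smul_mul_assoc, hx]

theorem rowSum_mul_shiftAlg_rowSum : rowSum (colTab n (m + 1)) *
    shiftAlg n m (rowSum (colTab n m)) =
      ((rowStab (colTab n m)).card : ℂ) • rowSum (colTab n (m + 1)) := by
  conv_lhs => rw [rowSum.eq_def (colTab n m)]
  rw [map_sum, Finset.mul_sum, Nat.cast_smul_eq_nsmul, ← Finset.sum_const]
  refine Finset.sum_congr rfl fun σ hσ => ?_
  rw [shiftAlg_ofPerm, rowSum_mul_ofPerm (shiftPerm_mem_rowStab hσ)]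

/-- The Young symmetrizer of the smaller rectangle may be absorbed into that of the larger one. -/
theorem exists_young_prepend (n m : ℕ) : ∃ h : ℂ, h ≠ 0 ∧ ∀ z : T n m (n * m),
    young n m (colTab n (m + 1)) (prepend n m
      (algRep n m _ (rowSum (colTab n m) * colSum (colTab n m)) z)) =
      h • young n m (colTab n (m + 1)) (prepend n m z) := by
  obtain ⟨h, h0, hsq⟩ := exists_rowSum_mul_colSum_sq (colTab n m)
  refine ⟨h, h0, fun z => ?_⟩
  rw [prepend_algRep, ← algRep_rowSum_mul_colSum, ← Module.End.mul_apply, ← map_mul,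
    ← LinearMap.smul_apply, ← map_smul]
  congr 2
  set R := rowSum (colTab n m)
  set C := colSum (colTab n m)
  set R' := rowSum (colTab n (m + 1))
  set C1 := firstColSum n m
  have hc : ((rowStab (colTab n m)).card : ℂ) ≠ 0 := card_rowStab_ne_zero _
  set c : ℂ := ((rowStab (colTab n m)).card : ℂ)
  -- R' absorbs the shifted R, which commutes with C1. So a factor R may be created in front of C
  -- for the scalar c, and then (R C)(R C) = h R C applies inside the larger symmetrizer.
  have e1 : c • (R' * C1) = R' * C1 * shiftAlg n m R := by
    rw [mul_assoc, firstColSum_mul_shiftAlg, ← mul_assoc, rowSum_mul_shiftAlg_rowSum,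
      smul_mul_assoc]
  have e2 : c • (R' * (C1 * shiftAlg n m C) * shiftAlg n m (R * C)) =
      c • (h • (R' * (C1 * shiftAlg n m C))) := by
    calc c • (R' * (C1 * shiftAlg n m C) * shiftAlg n m (R * C))
        = (c • (R' * C1)) * (shiftAlg n m C * shiftAlg n m (R * C)) := by
          rw [smul_mul_assoc]; simp only [mul_assoc]
      _ = R' * C1 * shiftAlg n m ((R * C) * (R * C)) := by
          rw [e1]; simp only [map_mul, mul_assoc]
      _ = h • ((R' * C1 * shiftAlg n m R) * shiftAlg n m C) := by
          rw [hsq, map_smul, mul_smul_comm, map_mul]; simp only [mul_assoc]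
      _ = c • (h • (R' * (C1 * shiftAlg n m C))) := by
          rw [← e1, smul_mul_assoc, smul_comm]; simp only [mul_assoc]
  rw [colSum_colTab_succ]
  exact smul_right_injective _ hc e2

end

section


variable {n m k l : ℕ} {a b : ℕ} {t : Fin a × Fin b ≃ Fin k}

theorem permAct_mul_apply (σ τ : Equiv.Perm (Fin k)) (z : T n m k) :
    permAct n m (σ * τ) z = permAct n m σ (permAct n m τ z) :=
  LinearMap.congr_fun (permAct_mul σ τ) z

/-! ### Splitting off the last row of the larger tableau -/

/-- The permutation of `k + l` positions that acts by `σ` on the first `k` and by `π` on the last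
`l` ones. -/
def joinPerm (σ : Equiv.Perm (Fin k)) (π : Equiv.Perm (Fin l)) : Equiv.Perm (Fin (k + l)) :=
  finSumFinEquiv.permCongr (Equiv.sumCongr σ π)

theorem joinPerm_castAdd (σ : Equiv.Perm (Fin k)) (π : Equiv.Perm (Fin l)) (x : Fin k) :
    joinPerm σ π (Fin.castAdd l x) = Fin.castAdd l (σ x) := by
  simp [joinPerm, Equiv.permCongr_apply]

theorem joinPerm_natAdd (σ : Equiv.Perm (Fin k)) (π : Equiv.Perm (Fin l)) (y : Fin l) :
    joinPerm σ π (Fin.natAdd k y) = Fin.natAdd k (π y) := by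
  simp [joinPerm, Equiv.permCongr_apply]

theorem perm_ext_add {ρ ρ' : Equiv.Perm (Fin (k + l))}
    (h1 : ∀ x, ρ (Fin.castAdd l x) = ρ' (Fin.castAdd l x))
    (h2 : ∀ y, ρ (Fin.natAdd k y) = ρ' (Fin.natAdd k y)) : ρ = ρ' := by
  ext1 x
  exact Fin.addCases h1 h2 x

theorem joinPerm_mul (σ σ' : Equiv.Perm (Fin k)) (π π' : Equiv.Perm (Fin l)) :
    joinPerm (σ * σ') (π * π') = joinPerm σ π * joinPerm σ' π' := by
  refine perm_ext_add (fun x => ?_) fun y => ?_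
  · simp only [Equiv.Perm.mul_apply, joinPerm_castAdd]
  · simp only [Equiv.Perm.mul_apply, joinPerm_natAdd]

theorem sign_joinPerm (σ : Equiv.Perm (Fin k)) (π : Equiv.Perm (Fin l)) :
    Equiv.Perm.sign (joinPerm σ π) = Equiv.Perm.sign σ * Equiv.Perm.sign π := by
  change Equiv.Perm.sign (finSumFinEquiv.permCongr (Equiv.Perm.sumCongr σ π)) = _
  rw [Equiv.Perm.sign_permCongr, Equiv.Perm.sign_sumCongr]

theorem joinPerm_symm (σ : Equiv.Perm (Fin k)) (π : Equiv.Perm (Fin l)) :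
    (joinPerm σ π).symm = joinPerm σ.symm π.symm := by
  refine perm_ext_add (fun x => ?_) fun y => ?_
  · rw [Equiv.symm_apply_eq, joinPerm_castAdd, joinPerm_castAdd, Equiv.apply_symm_apply]
  · rw [Equiv.symm_apply_eq, joinPerm_natAdd, joinPerm_natAdd, Equiv.apply_symm_apply]

/-- The sign of the action of `joinPerm` is the product of the signs of both parts. -/
theorem permSign_joinPerm (σ : Equiv.Perm (Fin k)) (π : Equiv.Perm (Fin l))
    (I : Fin (k + l) → Idx n m) : permSign (joinPerm σ π) I =
      permSign σ (fun x => I (Fin.castAdd l x)) * permSign π fun y => I (Fin.natAdd k y) := by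
  have hlt : ∀ (x : Fin k) (y : Fin l), Fin.castAdd l x < Fin.natAdd k y := by
    intro x y
    rw [Fin.lt_def, Fin.val_castAdd, Fin.val_natAdd]; omega
  unfold permSign
  rw [Fin.prod_univ_add]
  congr 1
  · refine Finset.prod_congr rfl fun x _ => ?_
    rw [Fin.prod_univ_add, Finset.prod_eq_one (f := fun y => if Fin.castAdd l x < Fin.natAdd k y ∧ _ then _ else _), mul_one]
    · simp only [joinPerm_castAdd]; rfl
    · intro y _
      rw [if_neg]
      rw [joinPerm_castAdd, joinPerm_natAdd]
      exact fun h => absurd h.2.1 (hlt _ _).not_gt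
  · refine Finset.prod_congr rfl fun x _ => ?_
    rw [Fin.prod_univ_add, Finset.prod_eq_one, one_mul]
    · simp only [joinPerm_natAdd, Fin.natAdd_lt_natAdd_iff]
    · intro y _
      rw [if_neg]
      exact fun h => absurd h.1 (hlt _ _).not_gt

theorem contract_joinPerm (σ : Equiv.Perm (Fin (n * m))) (z : T n m (n * m + m)) :
    contract n m (permAct n m (joinPerm σ 1) z) = permAct n m σ (contract n m z) := by
  refine LinearMap.congr_fun (f := contract n m ∘ₗ permAct n m (joinPerm σ 1))
    (g := permAct n m σ ∘ₗ contract n m) (hom_ext fun I => ?_) z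
  rw [LinearMap.comp_apply, LinearMap.comp_apply, permAct_vec, map_smul, contract_vec, contract_vec,
    permSign_joinPerm]
  have h1 : permSign (1 : Equiv.Perm (Fin m)) (fun y => I (Fin.natAdd (n * m) y)) = 1 := by
    rw [permSign_eq]; exact invSign_self _ _
  have h2 : ∀ y, (I ∘ (joinPerm σ 1).symm) (Fin.natAdd (n * m) y) = I (Fin.natAdd (n * m) y) := by
    intro y
    rw [Function.comp_apply, joinPerm_symm, joinPerm_natAdd]; rfl
  have h3 : (fun x => (I ∘ (joinPerm σ 1).symm) (Fin.castAdd m x)) =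
      (fun x => I (Fin.castAdd m x)) ∘ σ.symm := by
    funext x
    rw [Function.comp_apply, joinPerm_symm, joinPerm_castAdd]; rfl
  rw [h1, mul_one]
  simp only [h2]
  rw [h3]
  split_ifs
  · rw [permAct_vec]
  · rw [smul_zero, map_zero]

theorem rowPerm_snoc (g : Fin n → Equiv.Perm (Fin m)) (π : Equiv.Perm (Fin m)) :
    rowPerm (bordTab n m) (Fin.snoc g π : Fin (n + 1) → Equiv.Perm (Fin m)) =
      joinPerm (rowPerm (colTab n m) g) π := by
  refine perm_ext_cells (bordTab n m) fun i j => ?_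
  rw [rowPerm_apply]
  refine Fin.lastCases ?_ (fun i => ?_) i
  · rw [bordTab_last, bordTab_last, joinPerm_natAdd, Fin.snoc_last]
  · rw [bordTab_castSucc, bordTab_castSucc, joinPerm_castAdd, rowPerm_apply, Fin.snoc_castSucc]

theorem rowSum_bordTab : rowSum (bordTab n m) =
    ∑ g : Fin n → Equiv.Perm (Fin m), ∑ π : Equiv.Perm (Fin m),
      ofPerm (joinPerm (rowPerm (colTab n m) g) 1) * ofPerm (joinPerm 1 π) := by
  rw [rowSum_eq, ← Equiv.sum_comp (Fin.snocEquiv fun _ : Fin (n + 1) => Equiv.Perm (Fin m)),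
    Fintype.sum_prod_type_right]
  refine Finset.sum_congr rfl fun g _ => Finset.sum_congr rfl fun π _ => ?_
  rw [← ofPerm_mul, ← joinPerm_mul, mul_one, one_mul, ← rowPerm_snoc]
  rfl

/-- The contraction after the symmetrization of the last row. -/
noncomputable def contractSym (n m : ℕ) : T n m (n * m + m) →ₗ[ℂ] T n m (n * m) :=
  ∑ π : Equiv.Perm (Fin m), contract n m ∘ₗ permAct n m (joinPerm 1 π)

theorem contractSym_apply (z : T n m (n * m + m)) : contractSym n m z =
    ∑ π : Equiv.Perm (Fin m), contract n m (permAct n m (joinPerm 1 π) z) := by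
  simp [contractSym]

theorem contractSym_joinPerm (τ : Equiv.Perm (Fin (n * m))) (z : T n m (n * m + m)) :
    contractSym n m (permAct n m (joinPerm τ 1) z) = permAct n m τ (contractSym n m z) := by
  rw [contractSym_apply, contractSym_apply, map_sum]
  refine Finset.sum_congr rfl fun π _ => ?_
  rw [← contract_joinPerm, ← permAct_mul_apply, ← permAct_mul_apply, ← joinPerm_mul,
    ← joinPerm_mul, mul_one, one_mul, mul_one, one_mul]

/-- Row permutations of the first n rows commute with the contraction; only those of the last row
have to precede it. -/
theorem contract_young (z : T n m (n * m + m)) : contract n m (young n m (bordTab n m) z) =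
    algRep n m _ (rowSum (colTab n m))
      (contractSym n m (algRep n m _ (colSum (bordTab n m)) z)) := by
  rw [← algRep_rowSum_mul_colSum, map_mul, Module.End.mul_apply]
  generalize algRep n m _ (colSum (bordTab n m)) z = w
  rw [rowSum_bordTab, rowSum_eq]
  simp only [map_sum, LinearMap.sum_apply, map_mul, algRep_ofPerm, Module.End.mul_apply,
    contract_joinPerm, contractSym_apply]
  exact Finset.sum_comm

theorem joinPerm_mem_colStab {τ : Equiv.Perm (Fin (n * m))} (h : τ ∈ colStab (colTab n m)) :
    joinPerm τ 1 ∈ colStab (bordTab n m) := by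
  obtain ⟨f, rfl⟩ := exists_colPerm h
  rw [mem_colStab]
  intro x
  obtain ⟨⟨i, j⟩, rfl⟩ := (bordTab n m).surjective x
  refine Fin.lastCases ?_ (fun i => ?_) i
  · rw [bordTab_last, joinPerm_natAdd]; rfl
  · rw [bordTab_castSucc, joinPerm_castAdd, colPerm_apply, ← bordTab_castSucc, ← bordTab_castSucc,
      colOf_cell, colOf_cell]

/-- The map `e_s ∘ (v_{I_1} ⊗ -) ∘ contractSym`. -/
noncomputable def symOp (n m : ℕ) : T n m (n * m + m) →ₗ[ℂ] T n m (n * (m + 1)) :=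
  young n m (colTab n (m + 1)) ∘ₗ prepend n m ∘ₗ contractSym n m

theorem symOp_apply (z : T n m (n * m + m)) : symOp n m z =
    young n m (colTab n (m + 1)) (prepend n m (contractSym n m z)) := rfl

/-- Column permutations of the first n rows pass through the contraction and the insertion and reach
e_s, whose column antisymmetrization acts first. -/
theorem symOp_joinPerm {τ : Equiv.Perm (Fin (n * m))} (h : τ ∈ colStab (colTab n m))
    (z : T n m (n * m + m)) :
    symOp n m (permAct n m (joinPerm τ 1) z) = ((Equiv.Perm.sign τ : ℤ) : ℂ) • symOp n m z := by
  rw [symOp_apply, contractSym_joinPerm, prepend_permAct, young_permAct (shiftPerm_mem_colStab h),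
    sign_shiftPerm, symOp_apply]

/-- The symmetrizer of the larger tableau may be replaced by the antisymmetrization of its columns
followed by the symmetrization of its last row. -/
theorem exists_invOp_eq (n m : ℕ) : ∃ c : ℂ, c ≠ 0 ∧ ∀ z : T n m (n * m + m),
    invOp n m z = c • symOp n m (algRep n m _ (colSum (bordTab n m)) z) := by
  obtain ⟨h, h0, hh⟩ := exists_young_prepend n m
  have hc : ((colStab (colTab n m)).card : ℂ) ≠ 0 := card_colStab_ne_zero _
  refine ⟨((colStab (colTab n m)).card : ℂ)⁻¹ * h, mul_ne_zero (inv_ne_zero hc) h0, fun z => ?_⟩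
  change young n m (colTab n (m + 1)) (prepend n m (contract n m (young n m (bordTab n m) z))) = _
  rw [contract_young, symOp_apply]
  set y := contractSym n m (algRep n m _ (colSum (bordTab n m)) z) with hy
  -- `y` is already antisymmetric in the columns of the smaller rectangle, so its row sum is a
  -- multiple of the full Young symmetrizer of `y`, which `exists_young_prepend` removes.
  have h1 : algRep n m _ (colSum (colTab n m)) y = ((colStab (colTab n m)).card : ℂ) • y := by
    rw [colSum, map_sum, LinearMap.sum_apply, Nat.cast_smul_eq_nsmul, ← Finset.sum_const]
    refine Finset.sum_congr rfl fun τ hτ => ?_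
    rw [map_smul, LinearMap.smul_apply, algRep_ofPerm, hy, ← contractSym_joinPerm,
      ← algRep_ofPerm (joinPerm τ 1), ← Module.End.mul_apply, ← map_mul,
      ofPerm_mul_colSum (joinPerm_mem_colStab hτ), map_smul, LinearMap.smul_apply, map_smul,
      smul_smul, sign_joinPerm, Equiv.Perm.sign_one, mul_one, sign_mul_sign, one_smul]
  have h2 : y = ((colStab (colTab n m)).card : ℂ)⁻¹ • algRep n m _ (colSum (colTab n m)) y := by
    rw [h1, smul_smul, inv_mul_cancel₀ hc, one_smul]
  conv_lhs => rw [h2]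
  rw [map_smul, map_smul, map_smul, ← Module.End.mul_apply, ← map_mul, hh, smul_smul]

/-- A column permutation that fixes the last row acts only on the first rows. -/
theorem exists_joinPerm {f : Fin m → Equiv.Perm (Fin (n + 1))}
    (hf : ∀ j, f j (Fin.last n) = Fin.last n) :
    ∃ τ ∈ colStab (colTab n m), colPerm (bordTab n m) f = joinPerm τ 1 := by
  have hlt : ∀ j (i : Fin n), f j i.castSucc ≠ Fin.last n := by
    intro j i h
    rw [← hf j] at h
    exact (Fin.castSucc_lt_last i).ne ((f j).injective h)
  have hinj : ∀ j, Function.Injective fun i => (f j i.castSucc).castPred (hlt j i) := by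
    intro j i i' h
    exact Fin.castSucc_injective n ((f j).injective (Fin.castPred_inj.1 h))
  refine ⟨colPerm (colTab n m) fun j =>
    Equiv.ofBijective _ (Finite.injective_iff_bijective.1 (hinj j)), colPerm_mem _, ?_⟩
  refine perm_ext_cells (bordTab n m) fun i j => ?_
  rw [colPerm_apply]
  refine Fin.lastCases ?_ (fun i => ?_) i
  · rw [hf, bordTab_last, joinPerm_natAdd]; rfl
  · rw [bordTab_castSucc, joinPerm_castAdd, colPerm_apply, ← bordTab_castSucc]
    simp

theorem symOp_colPerm {f : Fin m → Equiv.Perm (Fin (n + 1))}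
    (hf : ∀ j, f j (Fin.last n) = Fin.last n) (z : T n m (n * m + m)) :
    symOp n m (permAct n m (colPerm (bordTab n m) f) z) =
      ((∏ j, (Equiv.Perm.sign (f j) : ℤ) : ℤ) : ℂ) • symOp n m z := by
  obtain ⟨τ, hτ, h⟩ := exists_joinPerm hf
  have h2 : (Equiv.Perm.sign τ : ℤ) = ∏ j, (Equiv.Perm.sign (f j) : ℤ) := by
    have h3 := congrArg (fun σ => (Equiv.Perm.sign σ : ℤ)) h
    simp only [sign_joinPerm, sign_colPerm, Equiv.Perm.sign_one, mul_one] at h3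
    rw [← h3]; push_cast; rfl
  rw [h, symOp_joinPerm hτ, h2]

end

/-! ### Evaluation of 𝓛 on the power of the form. -/

section


variable {n m k l r N : ℕ}

/-! ### The arranged power of the form -/

theorem pairOf_lc (q : Fin r) : pairOf (lc q) = q := by
  apply Fin.ext; simp only [pairOf, lc]; omega

theorem pairOf_rc (q : Fin r) : pairOf (rc q) = q := by
  apply Fin.ext; simp only [pairOf, rc]; omega

theorem lc_ne_rc (p q : Fin r) : lc p ≠ rc q := by
  intro h
  have := congrArg Fin.val h
  simp only [lc, rc] at this
  omega

theorem lc_inj {p q : Fin r} : lc p = lc q ↔ p = q :=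
  ⟨fun h => by rw [← pairOf_lc p, h, pairOf_lc], fun h => by rw [h]⟩

theorem eq_lc_or_eq_rc (x : Fin (2 * r)) : x = lc (pairOf x) ∨ x = rc (pairOf x) := by
  rcases Nat.mod_two_eq_zero_or_one x.val with h | h
  · left; apply Fin.ext; simp only [lc, pairOf]; omega
  · right; apply Fin.ext; simp only [rc, pairOf]; omega

/-- A property of columns may be checked on the left and on the right columns. -/
theorem forall_columns {P : Fin (2 * r) → Prop} : (∀ x, P x) ↔ ∀ q, P (lc q) ∧ P (rc q) := by
  refine ⟨fun h q => ⟨h _, h _⟩, fun h x => ?_⟩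
  rcases eq_lc_or_eq_rc x with hx | hx
  · rw [hx]; exact (h _).1
  · rw [hx]; exact (h _).2

/-- The columns as left and right members of pairs. -/
def columnEquiv (r : ℕ) : Fin r × Fin 2 ≃ Fin (2 * r) :=
  finProdFinEquiv.trans (finCongr (Nat.mul_comm r 2))

theorem columnEquiv_val (q : Fin r) (ε : Fin 2) : (columnEquiv r (q, ε)).val = 2 * q + ε := by
  simp [columnEquiv, finProdFinEquiv]; ring

theorem columnEquiv_zero (q : Fin r) : columnEquiv r (q, 0) = lc q := by
  apply Fin.ext; rw [columnEquiv_val]; simp [lc]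

theorem columnEquiv_one (q : Fin r) : columnEquiv r (q, 1) = rc q := by
  apply Fin.ext; rw [columnEquiv_val]; simp [rc]

theorem prod_columns {M : Type*} [CommMonoid M] (f : Fin (2 * r) → M) :
    ∏ x, f x = ∏ q, f (lc q) * f (rc q) := by
  rw [← Equiv.prod_comp (columnEquiv r), Fintype.prod_prod_type]
  simp only [Fin.prod_univ_two, columnEquiv_zero, columnEquiv_one]

/-- The row `z_1 z̃_1 … z_r z̃_r`. -/
def pairRow (z : Fin r → Idx n m) (x : Fin (2 * r)) : Idx n m :=
  if x.val % 2 = 0 then z (pairOf x) else conj (z (pairOf x))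

theorem pairRow_lc (z : Fin r → Idx n m) (q : Fin r) : pairRow z (lc q) = z q := by
  rw [pairRow, if_pos (by simp [lc]), pairOf_lc]

theorem pairRow_rc (z : Fin r → Idx n m) (q : Fin r) : pairRow z (rc q) = conj (z q) := by
  rw [pairRow, if_neg (by simp only [rc]; omega), pairOf_rc]

/-- The word whose letters are the entries of a filling of the cells of the larger tableau. -/
def cellWord (K : Fin (n + 1) → Fin m → Idx n m) (x : Fin (n * m + m)) : Idx n m :=
  K (rowOf (bordTab n m) x) (colOf (bordTab n m) x)

theorem cellWord_cell (K : Fin (n + 1) → Fin m → Idx n m) (i : Fin (n + 1)) (j : Fin m) :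
    cellWord K (bordTab n m (i, j)) = K i j := by
  rw [cellWord, rowOf_cell, colOf_cell]

theorem cellWord_comp_colPerm (K : Fin (n + 1) → Fin m → Idx n m)
    (f : Fin m → Equiv.Perm (Fin (n + 1))) :
    cellWord K ∘ (colPerm (bordTab n m) f).symm = cellWord fun i j => K ((f j).symm i) j := by
  funext x
  obtain ⟨⟨i, j⟩, rfl⟩ := (bordTab n m).surjective x
  have : (colPerm (bordTab n m) f).symm (bordTab n m (i, j)) =
      bordTab n m ((f j).symm i, j) := by
    rw [Equiv.symm_apply_eq, colPerm_apply, Equiv.apply_symm_apply]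
  rw [Function.comp_apply, this, cellWord_cell, cellWord_cell]

/-- Lexicographic comparison of two numbers written in base `a`. -/
theorem mod_order {a i i' c c' : ℕ} (hi : i < a) (hi' : i' < a) :
    i + a * c < i' + a * c' ↔ c < c' ∨ c = c' ∧ i < i' := by
  rcases lt_trichotomy c c' with h | h | h
  · have : a * (c + 1) ≤ a * c' := Nat.mul_le_mul_left a h
    rw [Nat.mul_add] at this
    simp only [h, true_or, iff_true]; omega
  · subst h; simp
  · have : a * (c' + 1) ≤ a * c := Nat.mul_le_mul_left a h
    rw [Nat.mul_add] at this
    constructor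
    · intro; omega
    · rintro (h1 | h1) <;> omega

theorem bordTab_castSucc_lt_iff (i i' : Fin n) (j j' : Fin m) :
    bordTab n m (i.castSucc, j) < bordTab n m (i'.castSucc, j') ↔ j < j' ∨ j = j' ∧ i < i' := by
  rw [bordTab_castSucc, bordTab_castSucc, Fin.lt_def, Fin.val_castAdd, Fin.val_castAdd, colTab_val,
    colTab_val, mod_order i.isLt i'.isLt, Fin.lt_def, Fin.lt_def, Fin.ext_iff]

theorem bordTab_castSucc_lt_last (i : Fin n) (j j' : Fin m) :
    bordTab n m (i.castSucc, j) < bordTab n m (Fin.last n, j') := by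
  rw [bordTab_castSucc, bordTab_last, Fin.lt_def, Fin.val_castAdd, Fin.val_natAdd]
  have := (colTab n m (i, j)).isLt
  omega

theorem bordTab_last_lt_iff (j j' : Fin m) :
    bordTab n m (Fin.last n, j) < bordTab n m (Fin.last n, j') ↔ j < j' := by
  rw [bordTab_last, bordTab_last, Fin.natAdd_lt_natAdd_iff]

/-- The position, in the power of the form, of a cell. -/
def blockPos (n r : ℕ) (p : Fin (n + 1)) (q : Fin r) (ε : Fin 2) : Fin ((n + 1) * r * 2) :=
  finProdFinEquiv (finProdFinEquiv (p, q), ε)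

theorem rowArrange_blockPos (p : Fin (n + 1)) (q : Fin r) (ε : Fin 2) :
    rowArrange n r (blockPos n r p q ε) = bordTab n (2 * r) (p, columnEquiv r (q, ε)) := by
  have : (finCongr (by ring : (n + 1) * r * 2 = (n + 1) * (2 * r))) (blockPos n r p q ε) =
      finProdFinEquiv (p, columnEquiv r (q, ε)) := by
    apply Fin.ext
    simp only [blockPos, finCongr_apply, Fin.val_cast, finProdFinEquiv_apply_val, columnEquiv_val]
    ring
  simp only [rowArrange, Equiv.trans_apply]
  rw [this, Equiv.symm_apply_apply]

theorem blockPos_lt_iff (p p' : Fin (n + 1)) (q q' : Fin r) (ε ε' : Fin 2) :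
    blockPos n r p q ε < blockPos n r p' q' ε' ↔
      p < p' ∨ p = p' ∧ columnEquiv r (q, ε) < columnEquiv r (q', ε') := by
  simp only [blockPos, Fin.lt_def, finProdFinEquiv_apply_val, columnEquiv_val]
  have h1 : ε.val + 2 * (q.val + r * p.val) = (2 * q + ε) + (2 * r) * p := by ring
  have h2 : ε'.val + 2 * (q'.val + r * p'.val) = (2 * q' + ε') + (2 * r) * p' := by ring
  rw [h1, h2, mod_order (by omega) (by omega), Fin.ext_iff]

/-- The letters that have to be moved past each other when a power of the form is arranged. -/
theorem rowArrange_reversed_iff (p p' : Fin (n + 1)) (q q' : Fin r) (ε ε' : Fin 2) :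
    (blockPos n r p q ε < blockPos n r p' q' ε' ∧
      rowArrange n r (blockPos n r p' q' ε') < rowArrange n r (blockPos n r p q ε)) ↔
    p < p' ∧ p' ≠ Fin.last n ∧ columnEquiv r (q', ε') < columnEquiv r (q, ε) := by
  rw [blockPos_lt_iff, rowArrange_blockPos, rowArrange_blockPos]
  generalize columnEquiv r (q, ε) = c
  generalize columnEquiv r (q', ε') = c'
  refine Fin.lastCases ?_ (fun i => ?_) p <;> refine Fin.lastCases ?_ (fun i' => ?_) p'
  · rw [bordTab_last_lt_iff]
    constructor
    · rintro ⟨h | h, h'⟩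
      · exact absurd h (lt_irrefl _)
      · exact absurd h' h.2.not_gt
    · rintro ⟨h, _⟩
      exact absurd h (lt_irrefl _)
  · constructor
    · rintro ⟨h | h, _⟩
      · exact absurd h (Fin.castSucc_lt_last i').not_gt
      · exact absurd h.1 (Fin.castSucc_lt_last i').ne'
    · rintro ⟨h, _⟩
      exact absurd h (Fin.castSucc_lt_last i').not_gt
  · constructor
    · rintro ⟨_, h⟩
      exact absurd h (bordTab_castSucc_lt_last _ _ _).not_gt
    · rintro ⟨_, h, _⟩
      exact absurd rfl h
  · rw [bordTab_castSucc_lt_iff, Fin.castSucc_lt_castSucc_iff, Fin.castSucc_inj]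
    have := (Fin.castSucc_lt_last i').ne
    constructor
    · rintro ⟨h | h, h' | h'⟩
      · exact ⟨h, this, h'⟩
      · exact absurd h h'.2.not_gt
      · exact absurd h' h.2.not_gt
      · exact absurd h.2 (by rw [h'.1]; exact lt_irrefl _)
    · rintro ⟨h, _, h'⟩
      exact ⟨Or.inl h, Or.inl h'⟩

theorem prod_blockPos {M : Type*} [CommMonoid M] (f : Fin ((n + 1) * r * 2) → M) :
    ∏ x, f x = ∏ p, ∏ q, ∏ ε, f (blockPos n r p q ε) := by
  rw [← Equiv.prod_comp finProdFinEquiv, Fintype.prod_prod_type, ← Equiv.prod_comp finProdFinEquiv,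
    Fintype.prod_prod_type]
  rfl

/-- The word `z_1 z̃_1 …` whose pairs are numbered by the rows and the pairs of columns. -/
def blockSeq (Z : Fin (n + 1) → Fin r → Idx n (2 * r)) : Fin ((n + 1) * r) → Idx n (2 * r) :=
  fun b => Z (finProdFinEquiv.symm b).1 (finProdFinEquiv.symm b).2

theorem blockSeq_apply (Z : Fin (n + 1) → Fin r → Idx n (2 * r)) (p : Fin (n + 1)) (q : Fin r) :
    blockSeq Z (finProdFinEquiv (p, q)) = Z p q := by
  simp [blockSeq]

theorem par_pairSeq_blockPos (Z : Fin (n + 1) → Fin r → Idx n (2 * r)) (p : Fin (n + 1))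
    (q : Fin r) (ε : Fin 2) : par (pairSeq (blockSeq Z) (blockPos n r p q ε)) = par (Z p q) := by
  rw [blockPos]
  fin_cases ε
  · exact (congrArg par (pairSeq_zero _ _)).trans (by rw [blockSeq_apply])
  · exact (congrArg par (pairSeq_one _ _)).trans (by rw [par_conj, blockSeq_apply])

/-- For q ≠ q' all four pairs of columns are reversed or none is, so the sign is 1; for q = q'
exactly one is. -/
theorem prod_column_pair (A : Prop) [Decidable A] (q q' : Fin r) :
    (∏ ε : Fin 2, ∏ ε' : Fin 2, if 2 * q'.val + ε'.val < 2 * q.val + ε.val ∧ A then (-1 : ℤ) else 1) =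
      if q = q' then (if A then -1 else 1) else 1 := by
  rw [Fin.prod_univ_two, Fin.prod_univ_two, Fin.prod_univ_two]
  by_cases hA : A
  · simp only [hA, and_true, if_true, Fin.val_zero, Fin.val_one]
    rcases lt_trichotomy q q' with h | h | h
    · rw [if_neg h.ne]
      rw [Fin.lt_def] at h
      rw [if_neg (by omega), if_neg (by omega), if_neg (by omega), if_neg (by omega)]; rfl
    · subst h
      simp
    · rw [if_neg h.ne']
      rw [Fin.lt_def] at h
      rw [if_pos (by omega), if_pos (by omega), if_pos (by omega), if_pos (by omega)]; rfl
  · simp [hA]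

/-- Passing from rows to columns reverses two letters if neither is in the last row and the lower
one stands further left. As both letters of a block have one parity, different column pairs
contribute 1, and within a column pair one reversal remains for every two rows. This is the source
of d. -/
theorem permSign_rowArrange (Z : Fin (n + 1) → Fin r → Idx n (2 * r)) :
    permSign (rowArrange n r) (pairSeq (blockSeq Z)) = ∏ q, dCol fun i : Fin n => Z i.castSucc q := by
  have hblock : ∀ p q p' q', (∏ ε, ∏ ε',
      if blockPos n r p q ε < blockPos n r p' q' ε' ∧
        rowArrange n r (blockPos n r p' q' ε') < rowArrange n r (blockPos n r p q ε) ∧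
        par (pairSeq (blockSeq Z) (blockPos n r p q ε)) = 1 ∧
        par (pairSeq (blockSeq Z) (blockPos n r p' q' ε')) = 1 then (-1 : ℤ) else 1) =
      if q = q' then
        (if p < p' ∧ p' ≠ Fin.last n ∧ par (Z p q) = 1 ∧ par (Z p' q') = 1 then -1 else 1)
      else 1 := by
    intro p q p' q'
    have hc : ∀ ε ε' : Fin 2, (blockPos n r p q ε < blockPos n r p' q' ε' ∧
        rowArrange n r (blockPos n r p' q' ε') < rowArrange n r (blockPos n r p q ε) ∧
        par (pairSeq (blockSeq Z) (blockPos n r p q ε)) = 1 ∧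
        par (pairSeq (blockSeq Z) (blockPos n r p' q' ε')) = 1) ↔
        2 * q'.val + ε' < 2 * q + ε ∧
          (p < p' ∧ p' ≠ Fin.last n ∧ par (Z p q) = 1 ∧ par (Z p' q') = 1) := by
      intro ε ε'
      rw [← and_assoc, rowArrange_reversed_iff, par_pairSeq_blockPos, par_pairSeq_blockPos,
        Fin.lt_def (a := columnEquiv r _), columnEquiv_val, columnEquiv_val]
      tauto
    simp only [hc]
    exact prod_column_pair _ q q'
  unfold permSign
  rw [prod_blockPos]
  simp only [prod_blockPos]
  have h1 : ∀ p q, (∏ ε, ∏ p', ∏ q', ∏ ε',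
      if blockPos n r p q ε < blockPos n r p' q' ε' ∧
        rowArrange n r (blockPos n r p' q' ε') < rowArrange n r (blockPos n r p q ε) ∧
        par (pairSeq (blockSeq Z) (blockPos n r p q ε)) = 1 ∧
        par (pairSeq (blockSeq Z) (blockPos n r p' q' ε')) = 1 then (-1 : ℤ) else 1) =
      ∏ p' : Fin (n + 1), if p < p' ∧ p' ≠ Fin.last n ∧ par (Z p q) = 1 ∧ par (Z p' q) = 1
        then (-1 : ℤ) else 1 := by
    intro p q
    rw [Finset.prod_comm]
    refine Finset.prod_congr rfl fun p' _ => ?_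
    rw [Finset.prod_comm, Finset.prod_congr rfl fun q' _ => hblock p q p' q', Finset.prod_ite_eq,
      if_pos (Finset.mem_univ _)]
  rw [Finset.prod_congr rfl fun p _ => Finset.prod_congr rfl fun q _ => h1 p q, Finset.prod_comm]
  refine Finset.prod_congr rfl fun q _ => ?_
  rw [Fin.prod_univ_castSucc, dCol, Finset.prod_eq_one (s := Finset.univ)
    (f := fun p' => if Fin.last n < p' ∧ _ then _ else _), mul_one]
  · refine Finset.prod_congr rfl fun i _ => ?_
    rw [Fin.prod_univ_castSucc, if_neg (by simp), mul_one]
    refine Finset.prod_congr rfl fun i' _ => ?_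
    simp only [Fin.castSucc_lt_castSucc_iff, ne_eq, (Fin.castSucc_lt_last i').ne, not_false_eq_true,
      true_and]
  · intro p' _
    rw [if_neg]
    exact fun h => absurd h.1 (Fin.le_last p').not_gt

theorem pairSeq_comp_rowArrange (Z : Fin (n + 1) → Fin r → Idx n (2 * r)) :
    pairSeq (blockSeq Z) ∘ (rowArrange n r).symm = cellWord fun p => pairRow (Z p) := by
  funext x
  obtain ⟨⟨p, c⟩, rfl⟩ := (bordTab n (2 * r)).surjective x
  obtain ⟨⟨q, ε⟩, rfl⟩ := (columnEquiv r).surjective c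
  rw [Function.comp_apply, ← rowArrange_blockPos, Equiv.symm_apply_apply, rowArrange_blockPos,
    cellWord_cell, blockPos]
  fin_cases ε
  · refine (pairSeq_zero _ _).trans ?_
    rw [blockSeq_apply]
    exact ((congrArg _ (columnEquiv_zero q)).trans (pairRow_lc _ _)).symm
  · refine (pairSeq_one _ _).trans ?_
    rw [blockSeq_apply]
    exact ((congrArg _ (columnEquiv_one q)).trans (pairRow_rc _ _)).symm

theorem formTensor_eq : formTensor n r = ∑ Z : Fin (n + 1) → Fin r → Idx n (2 * r),
    (((∏ p, ∏ q, cSign (Z p q)) * ∏ q, dCol fun i : Fin n => Z i.castSucc q : ℤ) : ℂ) •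
      vec (cellWord fun p => pairRow (Z p)) := by
  rw [formTensor, formPower_eq, map_sum]
  let E : (Fin (n + 1) → Fin r → Idx n (2 * r)) ≃ (Fin ((n + 1) * r) → Idx n (2 * r)) :=
    (Equiv.curry _ _ _).symm.trans (Equiv.arrowCongr finProdFinEquiv (Equiv.refl _))
  rw [← Equiv.sum_comp E]
  refine Finset.sum_congr rfl fun Z _ => ?_
  have hE : E Z = blockSeq Z := rfl
  rw [hE, map_smul, permAct_vec, smul_smul, permSign_rowArrange, pairSeq_comp_rowArrange]
  congr 1
  rw [← Int.cast_mul]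
  congr 2
  rw [← Equiv.prod_comp finProdFinEquiv, Fintype.prod_prod_type]
  simp only [blockSeq_apply]

/-! ### The symmetry of the power of the form -/

/-- The permutation of the two-fold factors of a power of the form. -/
def blockPerm (β : Equiv.Perm (Fin N)) : Equiv.Perm (Fin (N * 2)) :=
  finProdFinEquiv.permCongr (Equiv.prodCongr β (Equiv.refl _))

theorem blockPerm_apply (β : Equiv.Perm (Fin N)) (b : Fin N) (ε : Fin 2) :
    blockPerm β (finProdFinEquiv (b, ε)) = finProdFinEquiv (β b, ε) := by
  simp [blockPerm, Equiv.permCongr_apply]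

theorem par_pairSeq (z : Fin N → Idx n m) (b : Fin N) (ε : Fin 2) :
    par (pairSeq z (finProdFinEquiv (b, ε))) = par (z b) := by
  fin_cases ε
  · exact congrArg par (pairSeq_zero _ _)
  · exact (congrArg par (pairSeq_one _ _)).trans (par_conj _)

/-- An exchange of two blocks reverses four pairs of letters, and all four have the same two
parities. -/
theorem permSign_blockPerm (β : Equiv.Perm (Fin N)) (z : Fin N → Idx n m) :
    permSign (blockPerm β) (pairSeq z) = 1 := by
  unfold permSign
  rw [← Equiv.prod_comp finProdFinEquiv, Fintype.prod_prod_type]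
  refine Finset.prod_eq_one fun b _ => ?_
  simp only [← Equiv.prod_comp (finProdFinEquiv (m := N) (n := 2)), Fintype.prod_prod_type]
  rw [Finset.prod_comm]
  refine Finset.prod_eq_one fun b' _ => ?_
  have hc : ∀ ε ε' : Fin 2, (finProdFinEquiv (b, ε) < finProdFinEquiv (b', ε') ∧
      blockPerm β (finProdFinEquiv (b', ε')) < blockPerm β (finProdFinEquiv (b, ε)) ∧
      par (pairSeq z (finProdFinEquiv (b, ε))) = 1 ∧
      par (pairSeq z (finProdFinEquiv (b', ε'))) = 1) ↔
      (b < b' ∧ β b' < β b ∧ par (z b) = 1 ∧ par (z b') = 1) := by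
    intro ε ε'
    rw [blockPerm_apply, blockPerm_apply, par_pairSeq, par_pairSeq]
    simp only [Fin.lt_def, finProdFinEquiv_apply_val]
    rcases eq_or_ne b b' with h | h
    · subst h
      constructor
      · rintro ⟨h1, h2, _⟩; omega
      · rintro ⟨h1, _⟩; omega
    · have h1 : b.val ≠ b'.val := fun h' => h (Fin.ext h')
      have h2 : (β b).val ≠ (β b').val := fun h' => h (β.injective (Fin.ext h'))
      have h3 : ε.val + 2 * b.val < ε'.val + 2 * b'.val ↔ b.val < b'.val := by omega
      have h4 : ε'.val + 2 * (β b').val < ε.val + 2 * (β b).val ↔ (β b').val < (β b).val := by omega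
      rw [h3, h4]
  simp only [hc, Finset.prod_const, Finset.card_univ, Fintype.card_fin]
  split_ifs <;> rfl

theorem permAct_blockPerm (β : Equiv.Perm (Fin N)) :
    permAct n m (blockPerm β) (formPower n m N) = formPower n m N := by
  rw [formPower_eq, map_sum]
  conv_rhs => rw [← Equiv.sum_comp (Equiv.arrowCongr β (Equiv.refl (Idx n m)))]
  refine Finset.sum_congr rfl fun z _ => ?_
  rw [map_smul, permAct_vec, permSign_blockPerm, Int.cast_one, one_smul]
  have h1 : ∀ b, (Equiv.arrowCongr β (Equiv.refl (Idx n m)) z) b = z (β.symm b) := fun b => rfl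
  congr 1
  · congr 1
    simp only [h1]
    exact (Equiv.prod_comp β.symm fun b => cSign (z b)).symm
  · congr 1
    funext x
    obtain ⟨⟨b, ε⟩, rfl⟩ := finProdFinEquiv.surjective x
    have h2 : (blockPerm β).symm (finProdFinEquiv (b, ε)) = finProdFinEquiv (β.symm b, ε) := by
      rw [Equiv.symm_apply_eq, blockPerm_apply, Equiv.apply_symm_apply]
    rw [Function.comp_apply, h2]
    simp only [pairSeq, Equiv.symm_apply_apply, h1]

/-- Simultaneous permutations of both columns of a pair fix the power of the form. -/
theorem permAct_formTensor (g : Fin r → Equiv.Perm (Fin (n + 1))) :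
    permAct n (2 * r) (colPerm (bordTab n (2 * r)) fun j => g (pairOf j)) (formTensor n r) =
      formTensor n r := by
  have h : (rowArrange n r).trans (colPerm (bordTab n (2 * r)) fun j => g (pairOf j)) =
      (blockPerm (colPerm finProdFinEquiv g)).trans (rowArrange n r) := by
    ext1 x
    obtain ⟨⟨b, ε⟩, rfl⟩ := finProdFinEquiv.surjective x
    obtain ⟨⟨p, q⟩, rfl⟩ := finProdFinEquiv.surjective b
    rw [Equiv.trans_apply, Equiv.trans_apply, blockPerm_apply, colPerm_apply]
    change colPerm _ _ (rowArrange n r (blockPos n r p q ε)) =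
      rowArrange n r (blockPos n r (g q p) q ε)
    rw [rowArrange_blockPos, rowArrange_blockPos, colPerm_apply]
    have : pairOf (columnEquiv r (q, ε)) = q := by
      apply Fin.ext
      simp only [pairOf, columnEquiv_val]
      omega
    rw [this]
  rw [formTensor, ← LinearMap.comp_apply, ← permAct_trans, h, permAct_trans, LinearMap.comp_apply,
    permAct_blockPerm]

end

section


variable {n m k l r N : ℕ}

/-! ### Reduction of the sum over the columns -/

/-- The permutations of the columns that act by `g q` on the left member of the `q`-th pair. -/
def leftPerm (g : Fin r → Equiv.Perm (Fin (n + 1))) (j : Fin (2 * r)) : Equiv.Perm (Fin (n + 1)) :=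
  if j.val % 2 = 0 then g (pairOf j) else 1

/-- The permutations of the columns that act by `g q` on the right member of the `q`-th pair. -/
def rightPerm (g : Fin r → Equiv.Perm (Fin (n + 1))) (j : Fin (2 * r)) : Equiv.Perm (Fin (n + 1)) :=
  if j.val % 2 = 0 then 1 else g (pairOf j)

/-- The permutations of the columns that act by `g q` on both members of the `q`-th pair. -/
def dupPerm (g : Fin r → Equiv.Perm (Fin (n + 1))) (j : Fin (2 * r)) : Equiv.Perm (Fin (n + 1)) :=
  g (pairOf j)

theorem leftPerm_lc (g : Fin r → Equiv.Perm (Fin (n + 1))) (q : Fin r) :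
    leftPerm g (lc q) = g q := by
  rw [leftPerm, if_pos (by simp [lc]), pairOf_lc]

theorem leftPerm_rc (g : Fin r → Equiv.Perm (Fin (n + 1))) (q : Fin r) :
    leftPerm g (rc q) = 1 := by
  rw [leftPerm, if_neg (by simp only [rc]; omega)]

theorem rightPerm_lc (g : Fin r → Equiv.Perm (Fin (n + 1))) (q : Fin r) :
    rightPerm g (lc q) = 1 := by
  rw [rightPerm, if_pos (by simp [lc])]

theorem rightPerm_rc (g : Fin r → Equiv.Perm (Fin (n + 1))) (q : Fin r) :
    rightPerm g (rc q) = g q := by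
  rw [rightPerm, if_neg (by simp only [rc]; omega), pairOf_rc]

theorem dupPerm_lc (g : Fin r → Equiv.Perm (Fin (n + 1))) (q : Fin r) :
    dupPerm g (lc q) = g q := by rw [dupPerm, pairOf_lc]

theorem dupPerm_rc (g : Fin r → Equiv.Perm (Fin (n + 1))) (q : Fin r) :
    dupPerm g (rc q) = g q := by rw [dupPerm, pairOf_rc]

theorem columns_ext {α : Type*} {f g : Fin (2 * r) → α} (h1 : ∀ q, f (lc q) = g (lc q))
    (h2 : ∀ q, f (rc q) = g (rc q)) : f = g :=
  funext (forall_columns.2 fun q => ⟨h1 q, h2 q⟩)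

theorem leftPerm_mul (g h : Fin r → Equiv.Perm (Fin (n + 1))) :
    leftPerm (g * h) = leftPerm g * leftPerm h := by
  refine columns_ext (fun q => ?_) fun q => ?_
  · simp only [Pi.mul_apply, leftPerm_lc]
  · simp only [Pi.mul_apply, leftPerm_rc, mul_one]

/-- Trades a right factor h in the left columns for a simultaneous permutation of both columns,
invisible to the power of the form, and for h⁻¹ in the right columns, which stands on the left,
where `colTerm_mul_left` can remove it. -/
theorem leftPerm_mul_eq (g h : Fin r → Equiv.Perm (Fin (n + 1))) :
    leftPerm (g * h) = rightPerm h⁻¹ * (leftPerm g * dupPerm h) := by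
  refine columns_ext (fun q => ?_) fun q => ?_
  · simp only [Pi.mul_apply, leftPerm_lc, rightPerm_lc, dupPerm_lc, one_mul]
  · simp only [Pi.mul_apply, leftPerm_rc, rightPerm_rc, dupPerm_rc, one_mul, Pi.inv_apply,
      inv_mul_cancel]

/-- The contribution of a column permutation. -/
noncomputable def colTerm (n r : ℕ) (f : Fin (2 * r) → Equiv.Perm (Fin (n + 1))) :
    T n (2 * r) (n * (2 * r + 1)) :=
  ((∏ j, (Equiv.Perm.sign (f j) : ℤ) : ℤ) : ℂ) •
    symOp n (2 * r) (permAct n (2 * r) (colPerm (bordTab n (2 * r)) f) (formTensor n r))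

theorem symOp_colSum : symOp n (2 * r) (algRep n (2 * r) _ (colSum (bordTab n (2 * r)))
    (formTensor n r)) = ∑ f, colTerm n r f := by
  rw [colSum_eq, map_sum, LinearMap.sum_apply, map_sum]
  refine Finset.sum_congr rfl fun f _ => ?_
  rw [map_smul, LinearMap.smul_apply, map_smul, algRep_ofPerm, colTerm]

theorem prod_sign_mul (f g : Fin (2 * r) → Equiv.Perm (Fin (n + 1))) :
    (∏ j, (Equiv.Perm.sign ((f * g) j) : ℤ)) =
      (∏ j, (Equiv.Perm.sign (f j) : ℤ)) * ∏ j, (Equiv.Perm.sign (g j) : ℤ) := by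
  rw [← Finset.prod_mul_distrib]
  refine Finset.prod_congr rfl fun j _ => ?_
  rw [Pi.mul_apply, Equiv.Perm.sign_mul, Units.val_mul]

theorem sign_val_mul_self (σ : Equiv.Perm (Fin k)) :
    (Equiv.Perm.sign σ : ℤ) * (Equiv.Perm.sign σ : ℤ) = 1 := by
  rcases Int.units_eq_one_or (Equiv.Perm.sign σ) with h | h <;> simp [h]

theorem prod_sign_mul_self (f : Fin (2 * r) → Equiv.Perm (Fin (n + 1))) :
    (∏ j, (Equiv.Perm.sign (f j) : ℤ)) * (∏ j, (Equiv.Perm.sign (f j) : ℤ)) = 1 := by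
  rw [← Finset.prod_mul_distrib]
  exact Finset.prod_eq_one fun j _ => sign_val_mul_self _

/-- The sign of `a` in the antisymmetrization cancels the one from `symOp_colPerm`. -/
theorem colTerm_mul_left {a f : Fin (2 * r) → Equiv.Perm (Fin (n + 1))}
    (ha : ∀ j, a j (Fin.last n) = Fin.last n) : colTerm n r (a * f) = colTerm n r f := by
  rw [colTerm, colPerm_mul, permAct_mul_apply, symOp_colPerm ha, smul_smul, colTerm]
  congr 1
  rw [← Int.cast_mul, prod_sign_mul, mul_right_comm, prod_sign_mul_self, one_mul]

theorem colTerm_mul_dupPerm (f : Fin (2 * r) → Equiv.Perm (Fin (n + 1)))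
    (g : Fin r → Equiv.Perm (Fin (n + 1))) :
    colTerm n r (f * dupPerm g) = colTerm n r f := by
  have h : (∏ j, (Equiv.Perm.sign (dupPerm g j) : ℤ)) = 1 := by
    rw [prod_columns]
    refine Finset.prod_eq_one fun q _ => ?_
    rw [dupPerm_lc, dupPerm_rc, sign_val_mul_self]
  rw [colTerm, colPerm_mul, permAct_mul_apply, prod_sign_mul, h, mul_one]
  change _ • symOp n (2 * r) (permAct n (2 * r) _ (permAct n (2 * r)
    (colPerm (bordTab n (2 * r)) fun j => g (pairOf j)) (formTensor n r))) = _
  rw [permAct_formTensor, colTerm]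

theorem colTerm_leftPerm_mul {g a : Fin r → Equiv.Perm (Fin (n + 1))}
    (ha : ∀ q, a q (Fin.last n) = Fin.last n) :
    colTerm n r (leftPerm (g * a)) = colTerm n r (leftPerm g) := by
  rw [leftPerm_mul_eq, colTerm_mul_left, colTerm_mul_dupPerm]
  refine forall_columns.2 fun q => ⟨?_, ?_⟩
  · rw [rightPerm_lc]; rfl
  · rw [rightPerm_rc, Pi.inv_apply, Equiv.Perm.inv_eq_iff_eq, ha]

/-- With `colTerm_leftPerm_mul`: for each q the term depends only on the double coset of `g q`
modulo the stabilizer of the last row. -/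
theorem colTerm_mul_leftPerm {g a : Fin r → Equiv.Perm (Fin (n + 1))}
    (ha : ∀ q, a q (Fin.last n) = Fin.last n) :
    colTerm n r (leftPerm (a * g)) = colTerm n r (leftPerm g) := by
  rw [leftPerm_mul, colTerm_mul_left]
  refine forall_columns.2 fun q => ⟨?_, ?_⟩
  · rw [leftPerm_lc, ha]
  · rw [leftPerm_rc]; rfl

/-- Every f is uniquely `leftPerm g * dupPerm h`, and h does not affect the term. -/
theorem sum_colTerm : ∑ f, colTerm n r f =
    (Fintype.card (Fin r → Equiv.Perm (Fin (n + 1))) : ℂ) •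
      ∑ g : Fin r → Equiv.Perm (Fin (n + 1)), colTerm n r (leftPerm g) := by
  let E : (Fin r → Equiv.Perm (Fin (n + 1))) × (Fin r → Equiv.Perm (Fin (n + 1))) ≃
      (Fin (2 * r) → Equiv.Perm (Fin (n + 1))) :=
    { toFun := fun p => leftPerm p.1 * dupPerm p.2
      invFun := fun f => (fun q => f (lc q) * (f (rc q))⁻¹, fun q => f (rc q))
      left_inv := by
        rintro ⟨g, h⟩
        refine Prod.ext (funext fun q => ?_) (funext fun q => ?_)
        · simp only [Pi.mul_apply, leftPerm_lc, leftPerm_rc, dupPerm_lc, dupPerm_rc, one_mul,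
            mul_inv_cancel_right]
        · simp only [Pi.mul_apply, leftPerm_rc, dupPerm_rc, one_mul]
      right_inv := by
        intro f
        refine columns_ext (fun q => ?_) fun q => ?_
        · simp only [Pi.mul_apply, leftPerm_lc, dupPerm_lc, inv_mul_cancel_right]
        · simp only [Pi.mul_apply, leftPerm_rc, dupPerm_rc, one_mul] }
  rw [← Equiv.sum_comp E, Fintype.sum_prod_type_right, Nat.cast_smul_eq_nsmul, ← Finset.card_univ,
    ← Finset.sum_const]
  exact Finset.sum_congr rfl fun h _ => Finset.sum_congr rfl fun g _ => colTerm_mul_dupPerm _ _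

/-- The last row of the smaller tableau. -/
def lastIdx (n : ℕ) [NeZero n] : Fin n := ⟨n - 1, Nat.sub_lt (NeZero.pos n) one_pos⟩

/-- The interchanges of the last two rows in the columns of `S`. -/
def swapLast (n : ℕ) [NeZero n] (S : Finset (Fin r)) (q : Fin r) : Equiv.Perm (Fin (n + 1)) :=
  if q ∈ S then Equiv.swap (lastIdx n).castSucc (Fin.last n) else 1

/-- The stabilizer of the last row has at most two double cosets, with representatives 1 and the
interchange of the last two rows. -/
theorem colTerm_leftPerm_eq [NeZero n] (g : Fin r → Equiv.Perm (Fin (n + 1))) :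
    colTerm n r (leftPerm g) =
      colTerm n r (leftPerm (swapLast n ({q | g q (Fin.last n) ≠ Fin.last n} : Finset (Fin r)))) := by
  set S : Finset (Fin r) := {q | g q (Fin.last n) ≠ Fin.last n} with hS
  have hmem : ∀ q, q ∈ S ↔ g q (Fin.last n) ≠ Fin.last n := by simp [hS]
  have hp : (lastIdx n).castSucc ≠ Fin.last n := (Fin.castSucc_lt_last _).ne
  -- Chosen so that `g q` after `b q` after the interchange fixes the last row: the interchange
  -- sends it to the row above, `b q` sends that to the preimage of the last row under `g q`.
  set b : Fin r → Equiv.Perm (Fin (n + 1)) := fun q =>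
    if q ∈ S then Equiv.swap ((g q).symm (Fin.last n)) (lastIdx n).castSucc else 1 with hb
  have hfix : ∀ q, b q (Fin.last n) = Fin.last n := by
    intro q
    simp only [hb]
    split_ifs with h
    · rw [Equiv.swap_apply_of_ne_of_ne _ hp.symm]
      intro h'
      rw [hmem] at h
      exact h (((Equiv.symm_apply_eq _).1 h'.symm).symm)
    · rfl
  have hsq : ∀ q, swapLast n S q * swapLast n S q = 1 := by
    intro q
    rw [swapLast]
    split_ifs <;> simp
  have hbq : ∀ q, b q * b q = 1 := by
    intro q
    simp only [hb]
    split_ifs <;> simp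
  have hg : g = (g * (b * swapLast n S)) * (swapLast n S * b) := by
    funext q
    simp only [Pi.mul_apply]
    rw [mul_assoc, mul_assoc (b q), ← mul_assoc (swapLast n S q), hsq, one_mul, hbq, mul_one]
  have hgfix : ∀ q, (g * (b * swapLast n S)) q (Fin.last n) = Fin.last n := by
    intro q
    simp only [Pi.mul_apply, Equiv.Perm.mul_apply]
    by_cases h : q ∈ S
    · simp only [swapLast, hb, if_pos h, Equiv.swap_apply_right, Equiv.apply_symm_apply]
    · simp only [swapLast, hb, if_neg h, Equiv.Perm.one_apply]
      rw [hmem, not_not] at h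
      exact h
  conv_lhs => rw [hg, colTerm_mul_leftPerm hgfix, colTerm_leftPerm_mul hfix]

/-- The number of permutations that fix the last element. -/
def fixCount (n : ℕ) : ℕ :=
  (Finset.univ.filter fun σ : Equiv.Perm (Fin (n + 1)) => σ (Fin.last n) = Fin.last n).card

theorem fixCount_ne_zero (n : ℕ) : fixCount n ≠ 0 := by
  rw [fixCount, ← Nat.pos_iff_ne_zero, Finset.card_pos]
  exact ⟨1, by simp⟩

/-- The last element has n other possible images, each as frequent as itself. This ratio of the
double cosets is the origin of the powers of n in K. -/
theorem card_move_last (n : ℕ) : (Finset.univ.filter fun σ : Equiv.Perm (Fin (n + 1)) =>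
    σ (Fin.last n) ≠ Fin.last n).card = n * fixCount n := by
  rw [Finset.card_eq_sum_card_fiberwise (f := fun σ : Equiv.Perm (Fin (n + 1)) => σ (Fin.last n))
    (t := {Fin.last n}ᶜ) (fun σ hσ => by simpa using hσ)]
  have h : ∀ i ∈ ({Fin.last n}ᶜ : Finset (Fin (n + 1))),
      (((Finset.univ.filter fun σ : Equiv.Perm (Fin (n + 1)) => σ (Fin.last n) ≠ Fin.last n)).filter
        fun σ => σ (Fin.last n) = i).card = fixCount n := by
    intro i hi
    have hi : i ≠ Fin.last n := by simpa using hi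
    refine Finset.card_bij' (fun σ _ => Equiv.swap (Fin.last n) i * σ)
      (fun σ _ => Equiv.swap (Fin.last n) i * σ) ?_ ?_ ?_ ?_
    · intro σ hσ
      simp only [Finset.mem_filter, Finset.mem_univ, true_and] at hσ ⊢
      rw [Equiv.Perm.mul_apply, hσ.2, Equiv.swap_apply_right]
    · intro σ hσ
      simp only [Finset.mem_filter, Finset.mem_univ, true_and] at hσ ⊢
      rw [Equiv.Perm.mul_apply, hσ, Equiv.swap_apply_left]
      exact ⟨hi, rfl⟩
    · intro σ _; simp [← mul_assoc]
    · intro σ _; simp [← mul_assoc]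
  rw [Finset.sum_congr rfl h, Finset.sum_const, Finset.card_compl, Finset.card_singleton,
    Fintype.card_fin, Nat.add_sub_cancel, smul_eq_mul]

theorem card_move_set (S : Finset (Fin r)) :
    (Finset.univ.filter fun g : Fin r → Equiv.Perm (Fin (n + 1)) =>
      (Finset.univ.filter fun q => g q (Fin.last n) ≠ Fin.last n) = S).card =
      n ^ S.card * fixCount n ^ r := by
  have h : (Finset.univ.filter fun g : Fin r → Equiv.Perm (Fin (n + 1)) =>
      (Finset.univ.filter fun q => g q (Fin.last n) ≠ Fin.last n) = S) =
      Fintype.piFinset fun q => Finset.univ.filter fun σ : Equiv.Perm (Fin (n + 1)) =>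
        (σ (Fin.last n) ≠ Fin.last n ↔ q ∈ S) := by
    ext g
    simp [Finset.ext_iff]
  rw [h, Fintype.card_piFinset]
  have hq : ∀ q, (Finset.univ.filter fun σ : Equiv.Perm (Fin (n + 1)) =>
      (σ (Fin.last n) ≠ Fin.last n ↔ q ∈ S)).card = (if q ∈ S then n else 1) * fixCount n := by
    intro q
    by_cases hq : q ∈ S
    · simp only [hq, iff_true, if_true, card_move_last]
    · simp only [hq, iff_false, not_not, if_false, one_mul]; rfl
  simp only [hq, Finset.prod_mul_distrib, Finset.prod_const, Finset.card_univ, Fintype.card_fin]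
  congr 1
  rw [Finset.prod_ite_mem, Finset.univ_inter, Finset.prod_const]

/-- The value of the operator on the power of the form, as a sum over sets of pairs of columns. -/
theorem exists_invOp_formTensor (n r : ℕ) [NeZero n] : ∃ c : ℂ, c ≠ 0 ∧
    invOp n (2 * r) (formTensor n r) =
      c • ∑ S : Finset (Fin r), ((n ^ S.card : ℕ) : ℂ) • colTerm n r (leftPerm (swapLast n S)) := by
  obtain ⟨c, hc, h⟩ := exists_invOp_eq n (2 * r)
  -- The second factor counts the simultaneous permutations h, the third is the common part of the
  -- sizes of the double cosets.
  refine ⟨c * Fintype.card (Fin r → Equiv.Perm (Fin (n + 1))) * (fixCount n ^ r : ℕ), ?_, ?_⟩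
  · refine mul_ne_zero (mul_ne_zero hc ?_) ?_
    · exact Nat.cast_ne_zero.2 Fintype.card_ne_zero
    · exact Nat.cast_ne_zero.2 (pow_ne_zero _ (fixCount_ne_zero n))
  · rw [h, symOp_colSum, sum_colTerm, smul_smul, mul_smul (c * _) (_ : ℂ)]
    congr 1
    rw [← Finset.sum_fiberwise Finset.univ fun g : Fin r → Equiv.Perm (Fin (n + 1)) =>
      (Finset.univ.filter fun q => g q (Fin.last n) ≠ Fin.last n), Finset.smul_sum]
    refine Finset.sum_congr rfl fun S _ => ?_
    rw [smul_smul, ← Nat.cast_mul, mul_comm (fixCount n ^ r), ← card_move_set,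
      Nat.cast_smul_eq_nsmul, ← Finset.sum_const]
    refine Finset.sum_congr rfl fun g hg => ?_
    rw [colTerm_leftPerm_eq, (Finset.mem_filter.1 hg).2]

end

section


variable {n m k l r N : ℕ}

/-! ### The contraction of a monomial -/

/-- The sign of the inversions of a word between the positions of a set. -/
def wordInv (J : Fin m → Idx n k) (D : Finset (Fin m)) : ℤ :=
  ∏ x ∈ D, ∏ y ∈ D, if x < y ∧ place (J y) < place (J x) then -1 else 1

/-- All letters of a word are odd and distinct. -/
def OddInj (J : Fin m → Idx n k) : Prop := (∀ x, par (J x) = 1) ∧ Function.Injective J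

instance (J : Fin m → Idx n k) : Decidable (OddInj J) := by
  unfold OddInj; infer_instance

theorem oddInj_iff {J : Fin m → Idx n m} :
    OddInj J ↔ ∃ π : Equiv.Perm (Fin m), ∀ x, J x = Sum.inr (π x) := by
  constructor
  · rintro ⟨h1, h2⟩
    have h3 : ∀ x, ∃ y, J x = Sum.inr y := by
      intro x
      have := h1 x
      rcases hx : J x with y | y
      · rw [hx] at this; exact absurd this (by simp [par])
      · exact ⟨y, rfl⟩
    choose f hf using h3
    have hinj : Function.Injective f := fun x y h => h2 (by rw [hf, hf, h])
    exact ⟨Equiv.ofBijective f (Finite.injective_iff_bijective.1 hinj), hf⟩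
  · rintro ⟨π, h⟩
    refine ⟨fun x => by rw [h]; rfl, fun x y hxy => ?_⟩
    rw [h, h] at hxy
    exact π.injective (Sum.inr_injective hxy)

theorem contract_joinPerm_vec (π : Equiv.Perm (Fin m)) (K : Fin (n + 1) → Fin m → Idx n m) :
    contract n m (permAct n m (joinPerm 1 π) (vec (cellWord K))) =
      if ∀ x, K (Fin.last n) x = Sum.inr (π x) then
        (wordInv (K (Fin.last n)) Finset.univ : ℂ) • vec (seqOf fun i => K i.castSucc) else 0 := by
  have hlast : ∀ y, cellWord K (Fin.natAdd (n * m) y) = K (Fin.last n) y := by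
    intro y
    rw [← bordTab_last, cellWord_cell]
  have h1 : ∀ y, (cellWord K ∘ (joinPerm 1 π).symm) (Fin.natAdd (n * m) y) =
      K (Fin.last n) (π.symm y) := by
    intro y
    rw [Function.comp_apply, joinPerm_symm, joinPerm_natAdd, hlast]
  have h2 : (fun x => (cellWord K ∘ (joinPerm 1 π).symm) (Fin.castAdd m x)) =
      seqOf fun i => K i.castSucc := by
    funext x
    obtain ⟨⟨i, j⟩, rfl⟩ := (colTab n m).surjective x
    rw [Function.comp_apply, joinPerm_symm, joinPerm_castAdd]
    change cellWord K (Fin.castAdd m (colTab n m (i, j))) = _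
    rw [← bordTab_castSucc, cellWord_cell, seqOf, Equiv.symm_apply_apply]
  rw [permAct_vec, map_smul, contract_vec, h2]
  simp only [h1]
  by_cases h : ∀ x, K (Fin.last n) x = Sum.inr (π x)
  · rw [if_pos h, if_pos fun j => by rw [h, Equiv.apply_symm_apply]]
    congr 2
    rw [permSign_joinPerm]
    have h3 : permSign (1 : Equiv.Perm (Fin (n * m)))
        (fun x => cellWord K (Fin.castAdd m x)) = 1 := by
      rw [permSign_eq]; exact invSign_self _ _
    rw [h3, one_mul]
    unfold permSign wordInv
    refine Finset.prod_congr rfl fun x _ => Finset.prod_congr rfl fun y _ => ?_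
    simp only [hlast, h]
    simp [par, place]
  · rw [if_neg h, if_neg, smul_zero]
    intro h'
    apply h
    intro x
    have := h' (π x)
    rwa [Equiv.symm_apply_apply] at this

/-- At most one permutation of the last row brings it to 1̄, 2̄, …, m̄, and one exists exactly if
the row lists the odd letters in some order; its super sign is the sign of that order. -/
theorem symOp_cellWord (K : Fin (n + 1) → Fin m → Idx n m) : symOp n m (vec (cellWord K)) =
    if OddInj (K (Fin.last n)) then (wordInv (K (Fin.last n)) Finset.univ : ℂ) •
      young n m (colTab n (m + 1)) (vec (prependSeq (seqOf fun i => K i.castSucc))) else 0 := by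
  rw [symOp_apply, contractSym_apply]
  simp only [contract_joinPerm_vec]
  by_cases h : OddInj (K (Fin.last n))
  · rw [if_pos h]
    obtain ⟨π, hπ⟩ := oddInj_iff.1 h
    rw [Fintype.sum_eq_single π, if_pos hπ, map_smul, map_smul, prepend_vec]
    intro π' hne
    rw [if_neg]
    intro h'
    apply hne
    ext1 x
    have := (h' x).symm.trans (hπ x)
    exact Sum.inr_injective this
  · rw [if_neg h, Finset.sum_eq_zero, map_zero, map_zero]
    intro π _
    rw [if_neg]
    exact fun hπ => h (oddInj_iff.2 ⟨π, hπ⟩)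

/-! ### The interchange of the last rows -/

theorem swapLast_symm [NeZero n] (S : Finset (Fin r)) (q : Fin r) :
    (swapLast n S q).symm = swapLast n S q := by
  rw [swapLast]
  split_ifs
  · exact Equiv.symm_swap _ _
  · rfl

theorem colPerm_leftPerm_insert [NeZero n] {S : Finset (Fin r)} {q : Fin r} (hq : q ∉ S) :
    colPerm (bordTab n (2 * r)) (leftPerm (swapLast n (insert q S))) =
      (Equiv.swap (bordTab n (2 * r) ((lastIdx n).castSucc, lc q))
        (bordTab n (2 * r) (Fin.last n, lc q))).trans
      (colPerm (bordTab n (2 * r)) (leftPerm (swapLast n S))) := by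
  refine perm_ext_cells (bordTab n (2 * r)) fun i j => ?_
  rw [colPerm_apply, Equiv.trans_apply]
  by_cases hj : j = lc q
  · subst hj
    have h1 : ∀ i, colPerm (bordTab n (2 * r)) (leftPerm (swapLast n S))
        (bordTab n (2 * r) (i, lc q)) = bordTab n (2 * r) (i, lc q) := by
      intro i
      rw [colPerm_apply, leftPerm_lc, swapLast, if_neg hq]; rfl
    rw [leftPerm_lc, swapLast, if_pos (Finset.mem_insert_self _ _), Equiv.swap_apply_def,
      Equiv.swap_apply_def]
    simp only [EmbeddingLike.apply_eq_iff_eq, Prod.mk.injEq, and_true]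
    split_ifs <;> rw [h1]
  · rw [Equiv.swap_apply_of_ne_of_ne, colPerm_apply]
    · congr 3
      rcases eq_lc_or_eq_rc j with h | h
      · rw [h] at hj ⊢
        rw [leftPerm_lc, leftPerm_lc, swapLast, swapLast]
        have hne : pairOf j ≠ q := fun h' => hj (by rw [h'])
        simp only [Finset.mem_insert, hne, false_or]
      · rw [h, leftPerm_rc, leftPerm_rc]
    · intro h
      exact hj (Prod.mk.inj ((bordTab n (2 * r)).injective h)).2
    · intro h
      exact hj (Prod.mk.inj ((bordTab n (2 * r)).injective h)).2

/-- Each exchange is a transposition of two odd letters, whose sign is -1 whatever stands between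
them. -/
theorem permSign_swapLast [NeZero n] (S : Finset (Fin r))
    (I : Fin (n * (2 * r) + 2 * r) → Idx n (2 * r))
    (h : ∀ q ∈ S, par (I (bordTab n (2 * r) ((lastIdx n).castSucc, lc q))) = 1 ∧
      par (I (bordTab n (2 * r) (Fin.last n, lc q))) = 1) :
    permSign (colPerm (bordTab n (2 * r)) (leftPerm (swapLast n S))) I = (-1) ^ S.card := by
  induction S using Finset.induction_on generalizing I with
  | empty =>
    have : leftPerm (swapLast n (∅ : Finset (Fin r))) = 1 := by
      refine columns_ext (fun q => ?_) fun q => ?_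
      · rw [leftPerm_lc, swapLast, if_neg (Finset.notMem_empty _)]; rfl
      · rw [leftPerm_rc]; rfl
    rw [this, colPerm_one, permSign_eq, Finset.card_empty, pow_zero]
    exact invSign_self _ _
  | insert q S hq ih =>
    have hne : bordTab n (2 * r) ((lastIdx n).castSucc, lc q) ≠
        bordTab n (2 * r) (Fin.last n, lc q) := by
      intro h'
      exact (Fin.castSucc_lt_last _).ne (Prod.mk.inj ((bordTab n (2 * r)).injective h')).1
    have hq' := h q (Finset.mem_insert_self _ _)
    rw [colPerm_leftPerm_insert hq, permSign_trans,
      permSign_swap_of_par_eq I hne (hq'.1.trans hq'.2.symm), hq'.1, sgn_one, ih,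
      Finset.card_insert_of_notMem hq, pow_succ]
    intro q' hmem
    have hqq : q' ≠ q := by rintro rfl; exact hq hmem
    have h1 : ∀ i, (Equiv.swap (bordTab n (2 * r) ((lastIdx n).castSucc, lc q))
        (bordTab n (2 * r) (Fin.last n, lc q))).symm (bordTab n (2 * r) (i, lc q')) =
        bordTab n (2 * r) (i, lc q') := by
      intro i
      rw [Equiv.symm_swap, Equiv.swap_apply_of_ne_of_ne]
      · intro h'
        exact hqq (lc_inj.1 (Prod.mk.inj ((bordTab n (2 * r)).injective h')).2)
      · intro h'
        exact hqq (lc_inj.1 (Prod.mk.inj ((bordTab n (2 * r)).injective h')).2)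
    rw [Function.comp_apply, Function.comp_apply, h1, h1]
    exact h q' (Finset.mem_insert_of_mem hmem)

/-- The filling with conjugate pairs `Z` after the interchange of the last rows in the left columns
of the pairs in `S`. -/
def exch [NeZero n] (S : Finset (Fin r)) (Z : Fin (n + 1) → Fin r → Idx n (2 * r))
    (i : Fin (n + 1)) (j : Fin (2 * r)) : Idx n (2 * r) :=
  pairRow (Z (leftPerm (swapLast n S) j i)) j

theorem exch_lc [NeZero n] (S : Finset (Fin r)) (Z : Fin (n + 1) → Fin r → Idx n (2 * r))
    (i : Fin (n + 1)) (q : Fin r) : exch S Z i (lc q) = Z (swapLast n S q i) q := by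
  rw [exch, pairRow_lc, leftPerm_lc]

theorem exch_rc [NeZero n] (S : Finset (Fin r)) (Z : Fin (n + 1) → Fin r → Idx n (2 * r))
    (i : Fin (n + 1)) (q : Fin r) : exch S Z i (rc q) = conj (Z i q) := by
  rw [exch, pairRow_rc, leftPerm_rc]; rfl

theorem leftPerm_symm_apply [NeZero n] (S : Finset (Fin r)) (j : Fin (2 * r)) :
    (leftPerm (swapLast n S) j).symm = leftPerm (swapLast n S) j := by
  rw [leftPerm]
  split_ifs
  · exact swapLast_symm _ _
  · rfl

/-- The sign (-1)^|S| of the antisymmetrization cancels the super sign of the exchanges: in a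
surviving term the last row is odd, so the exchanged letters are odd. -/
theorem colTerm_swapLast [NeZero n] (S : Finset (Fin r)) : colTerm n r (leftPerm (swapLast n S)) =
    ∑ Z : Fin (n + 1) → Fin r → Idx n (2 * r), if OddInj (exch S Z (Fin.last n)) then
      (((∏ p, ∏ q, cSign (Z p q)) * (∏ q, dCol fun i : Fin n => Z i.castSucc q) *
        wordInv (exch S Z (Fin.last n)) Finset.univ : ℤ) : ℂ) •
      young n (2 * r) (colTab n (2 * r + 1)) (vec (prependSeq (seqOf fun i => exch S Z i.castSucc)))
      else 0 := by
  have hsign : (∏ j, (Equiv.Perm.sign (leftPerm (swapLast n S) j) : ℤ)) = (-1) ^ S.card := by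
    rw [prod_columns]
    have : ∀ q, (Equiv.Perm.sign (leftPerm (swapLast n S) (lc q)) : ℤ) *
        (Equiv.Perm.sign (leftPerm (swapLast n S) (rc q)) : ℤ) = if q ∈ S then -1 else 1 := by
      intro q
      rw [leftPerm_lc, leftPerm_rc, swapLast]
      split_ifs
      · rw [Equiv.Perm.sign_swap (Fin.castSucc_lt_last _).ne]; simp
      · simp
    rw [Finset.prod_congr rfl fun q _ => this q, Finset.prod_ite_mem, Finset.univ_inter,
      Finset.prod_const]
  rw [colTerm, hsign, formTensor_eq, map_sum, map_sum, Finset.smul_sum]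
  refine Finset.sum_congr rfl fun Z _ => ?_
  have hw : cellWord (fun p => pairRow (Z p)) ∘
      (colPerm (bordTab n (2 * r)) (leftPerm (swapLast n S))).symm = cellWord (exch S Z) := by
    rw [cellWord_comp_colPerm]
    simp only [leftPerm_symm_apply]
    rfl
  rw [map_smul, map_smul, permAct_vec, map_smul, hw, symOp_cellWord]
  by_cases hodd : OddInj (exch S Z (Fin.last n))
  · rw [if_pos hodd, if_pos hodd, permSign_swapLast, smul_smul, smul_smul, smul_smul]
    · congr 1
      have h2 : ((-1 : ℂ) ^ S.card) * (-1) ^ S.card = 1 := by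
        rw [← mul_pow]; norm_num
      push_cast
      linear_combination (∏ p, ∏ q, (cSign (Z p q) : ℂ)) *
        (∏ q, (dCol fun i : Fin n => Z i.castSucc q : ℂ)) *
        (wordInv (exch S Z (Fin.last n)) Finset.univ : ℂ) * h2
    · intro q hq
      rw [cellWord_cell, cellWord_cell, pairRow_lc, pairRow_lc]
      have h1 := hodd.1 (lc q)
      have h2 := hodd.1 (rc q)
      rw [exch_lc, swapLast, if_pos hq, Equiv.swap_apply_right] at h1
      rw [exch_rc, par_conj] at h2
      exact ⟨h1, h2⟩
  · rw [if_neg hodd, if_neg hodd, smul_zero, smul_zero, smul_zero]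

end

/-! ### Signs of odd words that are stable under conjugation. -/

section


variable {n m k l r N : ℕ}

/-! ### Odd words that are stable under conjugation -/

theorem place_conj_lt_iff {a b : Idx n m} (ha : par a = 1) (hb : par b = 1) :
    place (conj a) < place (conj b) ↔ place b < place a := by
  rcases a with a | a
  · exact absurd ha (by simp [par])
  rcases b with b | b
  · exact absurd hb (by simp [par])
  simp only [conj, place, Fin.val_rev]
  omega

theorem place_injective : Function.Injective (place : Idx n m → ℕ) := by
  intro a b h
  rcases a with a | a <;> rcases b with b | b <;> simp only [place] at h
  · exact congrArg _ (Fin.ext h)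
  · omega
  · omega
  · exact congrArg _ (Fin.ext (by omega))

theorem conj_injective : Function.Injective (conj : Idx n m → Idx n m) := fun a b h => by
  rw [← conj_conj a, h, conj_conj]

theorem conj_ne_self {a : Idx n (2 * r)} (ha : par a = 1) : conj a ≠ a := by
  rcases a with a | a
  · exact absurd ha (by simp [par])
  intro h
  have := congrArg Fin.val (Sum.inr_injective h)
  rw [Fin.val_rev] at this
  omega

theorem cSign_odd {a : Idx n m} (ha : par a = 1) :
    cSign a = if place a < place (conj a) then 1 else -1 := by
  rw [cSign]
  simp [ha]

theorem cSign_conj_odd {a : Idx n (2 * r)} (ha : par a = 1) : cSign (conj a) = -cSign a := by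
  have h : place (conj a) ≠ place a := fun h => conj_ne_self ha (place_injective h)
  rw [cSign_odd ha, cSign_odd ((par_conj a).trans ha), conj_conj]
  rcases lt_or_gt_of_ne h with h | h
  · rw [if_pos h, if_neg h.not_gt]; rfl
  · rw [if_neg h.not_gt, if_pos h]

/-- The columns of the pairs in a set. -/
def cols (S : Finset (Fin r)) : Finset (Fin (2 * r)) := {x | pairOf x ∈ S}

theorem mem_cols {S : Finset (Fin r)} {x : Fin (2 * r)} : x ∈ cols S ↔ pairOf x ∈ S := by
  simp [cols]

theorem lc_mem_cols {S : Finset (Fin r)} {q : Fin r} : lc q ∈ cols S ↔ q ∈ S := by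
  rw [mem_cols, pairOf_lc]

theorem rc_mem_cols {S : Finset (Fin r)} {q : Fin r} : rc q ∈ cols S ↔ q ∈ S := by
  rw [mem_cols, pairOf_rc]

theorem prod_cols {M : Type*} [CommMonoid M] (S : Finset (Fin r)) (f : Fin (2 * r) → M) :
    ∏ x ∈ cols S, f x = ∏ q ∈ S, f (lc q) * f (rc q) := by
  rw [cols, Finset.prod_filter, prod_columns]
  simp only [pairOf_lc, pairOf_rc]
  rw [← Finset.univ_inter S, ← Finset.prod_ite_mem]
  refine Finset.prod_congr rfl fun q _ => ?_
  simp only [Finset.univ_inter]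
  split_ifs <;> simp

theorem card_cols (S : Finset (Fin r)) : (cols S).card = 2 * S.card := by
  have h := prod_cols S fun _ => Multiplicative.ofAdd (1 : ℕ)
  rw [Finset.prod_const, Finset.prod_const] at h
  have h2 := congrArg Multiplicative.toAdd h
  simp only [toAdd_pow, toAdd_mul, toAdd_ofAdd, smul_eq_mul, mul_one] at h2
  omega

/-- The other column of the pair. -/
def partner (x : Fin (2 * r)) : Fin (2 * r) := if x.val % 2 = 0 then rc (pairOf x) else lc (pairOf x)

theorem partner_lc (q : Fin r) : partner (lc q) = rc q := by
  rw [partner, if_pos (by simp [lc]), pairOf_lc]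

theorem partner_rc (q : Fin r) : partner (rc q) = lc q := by
  rw [partner, if_neg (by simp only [rc]; omega), pairOf_rc]

theorem pairOf_partner (x : Fin (2 * r)) : pairOf (partner x) = pairOf x := by
  rcases eq_lc_or_eq_rc x with h | h
  · rw [h, partner_lc, pairOf_lc, pairOf_rc]
  · rw [h, partner_rc, pairOf_lc, pairOf_rc]

theorem partner_partner (x : Fin (2 * r)) : partner (partner x) = x := by
  rcases eq_lc_or_eq_rc x with h | h
  · rw [h, partner_lc, partner_rc]
  · rw [h, partner_rc, partner_lc]

theorem apply_partner {J : Fin (2 * r) → Idx n m} {x : Fin (2 * r)}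
    (h : ConjPair J (pairOf x)) : J (partner x) = conj (J x) := by
  rcases eq_lc_or_eq_rc x with hx | hx
  · conv_lhs => rw [hx, partner_lc]
    conv_rhs => rw [hx]
    exact h
  · conv_lhs => rw [hx, partner_rc]
    conv_rhs => rw [hx, h, conj_conj]

/-- The entries of a row in the pairs of columns of `S` are odd, distinct, and form a set that is
stable under conjugation. -/
structure StableOn (S : Finset (Fin r)) (J : Fin (2 * r) → Idx n m) : Prop where
  odd : ∀ x ∈ cols S, par (J x) = 1
  inj : ∀ x ∈ cols S, ∀ y ∈ cols S, J x = J y → x = y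
  conj : ∀ x ∈ cols S, ∃ y ∈ cols S, J y = OspInv.conj (J x)

/-- If the conjugate of a letter at x in S stood in the conjugate pair q, its partner there would
repeat the letter at x. -/
theorem StableOn.of_insert {S : Finset (Fin r)} {J : Fin (2 * r) → Idx n m} {q : Fin r}
    (h : StableOn (insert q S) J) (hq : ConjPair J q) (hqS : q ∉ S) : StableOn S J := by
  have hsub : ∀ x ∈ cols S, x ∈ cols (insert q S) := fun x hx => by
    rw [mem_cols] at *; exact Finset.mem_insert_of_mem hx
  refine ⟨fun x hx => h.odd x (hsub x hx), fun x hx y hy => h.inj x (hsub x hx) y (hsub y hy),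
    fun x hx => ?_⟩
  obtain ⟨y, hy, hyx⟩ := h.conj x (hsub x hx)
  refine ⟨y, ?_, hyx⟩
  by_contra hyS
  have hy' : pairOf y = q := by
    rw [mem_cols] at hy hyS
    exact (Finset.mem_insert.1 hy).resolve_right hyS
  have h1 : J (partner y) = J x := by
    rw [apply_partner (J := J) (by rw [hy']; exact hq), hyx, conj_conj]
  have h2 := h.inj (partner y) (by rw [mem_cols, pairOf_partner, hy']; simp) x (hsub x hx) h1
  rw [mem_cols, ← h2, pairOf_partner, hy'] at hx
  exact hqS hx

theorem StableOn.of_union {S U : Finset (Fin r)} {J : Fin (2 * r) → Idx n m}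
    (h : StableOn (S ∪ U) J) (hU : ∀ q ∈ U, ConjPair J q) (hd : Disjoint S U) : StableOn S J := by
  induction U using Finset.induction_on with
  | empty => rwa [Finset.union_empty] at h
  | insert q U hq ih =>
    rw [Finset.disjoint_insert_right] at hd
    rw [Finset.union_insert] at h
    refine ih (h.of_insert (hU q (Finset.mem_insert_self _ _)) ?_)
      (fun q' hq' => hU q' (Finset.mem_insert_of_mem hq')) hd.2
    rw [Finset.mem_union]
    exact fun h' => h'.elim hd.1 hq

/-- A product over the letters of a stable word is one if the factors of conjugate letters are
inverse to each other. -/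
theorem StableOn.prod_eq_one {S : Finset (Fin r)} {J : Fin (2 * r) → Idx n (2 * k)}
    (h : StableOn S J) (f : Idx n (2 * k) → ℤ)
    (hf : ∀ x ∈ cols S, f (J x) * f (OspInv.conj (J x)) = 1) : ∏ x ∈ cols S, f (J x) = 1 := by
  choose g hg hgJ using h.conj
  refine Finset.prod_involution g (fun x hx => ?_) (fun x hx _ => ?_) (fun x hx => hg x hx)
    (fun x hx => ?_)
  · rw [hgJ]; exact hf x hx
  · intro h'
    have := hgJ x hx
    rw [h'] at this
    exact conj_ne_self (h.odd x hx) this.symm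
  · refine h.inj _ (hg _ _) _ hx ?_
    rw [hgJ, hgJ, conj_conj]

/-- Conjugation matches the letters with c = 1 and those with c = -1, so |S| of the 2|S| letters
have c = -1. -/
theorem StableOn.prod_neg_cSign {S : Finset (Fin r)} {J : Fin (2 * r) → Idx n (2 * k)}
    (h : StableOn S J) : ∏ q ∈ S, (-(cSign (J (lc q)) * cSign (J (rc q)))) = 1 := by
  choose g hg hgJ using h.conj
  have hcard : ((cols S).filter fun x => cSign (J x) = 1).card =
      ((cols S).filter fun x => ¬ cSign (J x) = 1).card := by
    refine Finset.card_bij' (fun x hx => g x (Finset.mem_filter.1 hx).1)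
      (fun x hx => g x (Finset.mem_filter.1 hx).1) ?_ ?_ ?_ ?_
    · intro x hx
      rw [Finset.mem_filter] at hx ⊢
      refine ⟨hg _ _, ?_⟩
      rw [hgJ, cSign_conj_odd (h.odd x hx.1), hx.2]; decide
    · intro x hx
      rw [Finset.mem_filter] at hx ⊢
      refine ⟨hg _ _, ?_⟩
      rw [hgJ, cSign_conj_odd (h.odd x hx.1)]
      have h2 := hx.2
      rw [cSign] at h2 ⊢
      split_ifs at h2 ⊢ <;> simp_all
    · intro x hx
      have hx' := (Finset.mem_filter.1 hx).1
      refine h.inj _ (hg _ _) _ hx' ?_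
      rw [hgJ, hgJ, conj_conj]
    · intro x hx
      have hx' := (Finset.mem_filter.1 hx).1
      refine h.inj _ (hg _ _) _ hx' ?_
      rw [hgJ, hgJ, conj_conj]
  have h1 : ∏ x ∈ cols S, cSign (J x) = (-1) ^ S.card := by
    have h2 : ∀ x, cSign (J x) = if cSign (J x) = 1 then 1 else -1 := by
      intro x
      rw [cSign]
      split_ifs <;> simp_all
    rw [Finset.prod_congr rfl fun x _ => h2 x, Finset.prod_ite, Finset.prod_const_one, one_mul,
      Finset.prod_const]
    congr 1
    have h3 := Finset.card_filter_add_card_filter_not (s := cols S) (fun x => cSign (J x) = 1)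
    rw [card_cols] at h3
    omega
  rw [prod_cols] at h1
  have h2 : ∀ q, -(cSign (J (lc q)) * cSign (J (rc q))) =
      -1 * (cSign (J (lc q)) * cSign (J (rc q))) := fun q => by ring
  rw [Finset.prod_congr rfl fun q _ => h2 q, Finset.prod_mul_distrib, h1, Finset.prod_const,
    ← mul_pow]
  norm_num

/-- The sign of an inversion. -/
def invFactor (J : Fin m → Idx n k) (x y : Fin m) : ℤ :=
  if x < y ∧ place (J y) < place (J x) then -1 else 1

theorem lc_lt_rc (q : Fin r) : lc q < rc q := by
  rw [Fin.lt_def]; simp only [lc, rc]; omega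

/-- The columns of a pair are adjacent. -/
theorem lt_lc_or_rc_lt {x : Fin (2 * r)} {q : Fin r} (h : pairOf x ≠ q) :
    (x < lc q ∧ x < rc q) ∨ (lc q < x ∧ rc q < x) := by
  have h' : (pairOf x).val ≠ q.val := fun h' => h (Fin.ext h')
  simp only [pairOf] at h'
  simp only [Fin.lt_def, lc, rc]
  omega

/-- Removal of a conjugate pair from a stable word. -/
theorem wordInv_insert {S : Finset (Fin r)} {J : Fin (2 * r) → Idx n (2 * k)} {q : Fin r}
    (h : StableOn (insert q S) J) (hq : ConjPair J q) (hqS : q ∉ S) :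
    wordInv J (cols (insert q S)) = wordInv J (cols S) * cSign (J (lc q)) := by
  have hprod : ∀ f : Fin (2 * r) → ℤ,
      ∏ x ∈ cols (insert q S), f x = f (lc q) * f (rc q) * ∏ x ∈ cols S, f x := by
    intro f
    rw [prod_cols, Finset.prod_insert hqS, prod_cols]
  have hsub : ∀ x ∈ cols S, x ∈ cols (insert q S) := fun x hx => by
    rw [mem_cols] at *; exact Finset.mem_insert_of_mem hx
  have hl : lc q ∈ cols (insert q S) := lc_mem_cols.2 (Finset.mem_insert_self _ _)
  have hr : rc q ∈ cols (insert q S) := rc_mem_cols.2 (Finset.mem_insert_self _ _)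
  have hS := h.of_insert hq hqS
  set A := J (lc q) with hA
  have hB : J (rc q) = conj A := hq
  have hAodd : par A = 1 := h.odd _ hl
  -- The sign of the inversions of a letter b with the two letters of the pair q. As the columns of
  -- q are adjacent, it does not matter on which side b stands: the sign is -1 exactly if b lies
  -- between A and its conjugate.
  let f : Idx n (2 * k) → ℤ := fun b =>
    (if place A < place b then -1 else 1) * (if place (conj A) < place b then -1 else 1)
  have hne : ∀ x ∈ cols S, place (J x) ≠ place A ∧ place (J x) ≠ place (conj A) := by
    intro x hx
    rw [mem_cols] at hx
    constructor
    · intro h'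
      have := h.inj x (hsub x (mem_cols.2 hx)) _ hl (place_injective h')
      rw [this, pairOf_lc] at hx
      exact hqS hx
    · intro h'
      have := h.inj x (hsub x (mem_cols.2 hx)) _ hr ((place_injective h').trans hB.symm)
      rw [this, pairOf_rc] at hx
      exact hqS hx
  have hcross : ∀ x ∈ cols S, (invFactor J x (lc q) * invFactor J x (rc q)) *
      (invFactor J (lc q) x * invFactor J (rc q) x) = f (J x) := by
    intro x hx
    obtain ⟨h1, h2⟩ := hne x hx
    simp only [invFactor, f, hB, ← hA]
    rcases lt_lc_or_rc_lt (x := x) (q := q) (by rintro rfl; exact hqS (mem_cols.1 hx)) with h3 | h3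
    · simp only [h3.1, h3.2, h3.1.not_gt, h3.2.not_gt, true_and, false_and, if_false, mul_one]
    · simp only [h3.1, h3.2, h3.1.not_gt, h3.2.not_gt, true_and, false_and, if_false, one_mul]
      rcases lt_or_gt_of_ne h1 with h1 | h1 <;> rcases lt_or_gt_of_ne h2 with h2 | h2 <;>
        simp only [h1, h2, h1.not_gt, h2.not_gt, if_true, if_false] <;> rfl
  -- Conjugation reverses the order of the odd letters, so b and its conjugate both lie between A
  -- and its conjugate or both do not.
  have hone : ∏ x ∈ cols S, f (J x) = 1 := by
    refine hS.prod_eq_one f fun x hx => ?_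
    obtain ⟨h1, h2⟩ := hne x hx
    have hxo := hS.odd x hx
    have e1 : place (conj A) < place (conj (J x)) ↔ place (J x) < place A :=
      place_conj_lt_iff hAodd hxo
    have e2 : place A < place (conj (J x)) ↔ place (J x) < place (conj A) := by
      have := place_conj_lt_iff ((par_conj A).trans hAodd) hxo
      rwa [conj_conj] at this
    simp only [f, e1, e2]
    rcases lt_or_gt_of_ne h1 with h1 | h1 <;> rcases lt_or_gt_of_ne h2 with h2 | h2 <;>
      simp only [h1, h2, h1.not_gt, h2.not_gt, if_true, if_false] <;> rfl
  have hpair : invFactor J (lc q) (rc q) = cSign A := by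
    have : place (conj A) ≠ place A := fun h => conj_ne_self hAodd (place_injective h)
    rw [cSign_odd hAodd, invFactor, hB, ← hA]
    simp only [lc_lt_rc, true_and]
    rcases lt_or_gt_of_ne this with h | h
    · rw [if_pos h, if_neg h.not_gt]
    · rw [if_neg h.not_gt, if_pos h]
  have hself : ∀ x, invFactor J x x = 1 := fun x => by simp [invFactor]
  have hback : invFactor J (rc q) (lc q) = 1 := by
    rw [invFactor, if_neg]
    exact fun h => absurd h.1 (lc_lt_rc q).not_gt
  change ∏ x ∈ cols (insert q S), ∏ y ∈ cols (insert q S), invFactor J x y =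
    (∏ x ∈ cols S, ∏ y ∈ cols S, invFactor J x y) * _
  simp only [hprod, Finset.prod_mul_distrib]
  rw [hself, hself, hpair, hback]
  have hc : (∏ x ∈ cols S, invFactor J x (lc q)) * (∏ x ∈ cols S, invFactor J x (rc q)) *
      ((∏ x ∈ cols S, invFactor J (lc q) x) * ∏ x ∈ cols S, invFactor J (rc q) x) = 1 := by
    rw [← hone, ← Finset.prod_mul_distrib, ← Finset.prod_mul_distrib, ← Finset.prod_mul_distrib]
    exact Finset.prod_congr rfl hcross
  linear_combination (cSign A * ∏ x ∈ cols S, ∏ y ∈ cols S, invFactor J x y) * hc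

theorem wordInv_union {S U : Finset (Fin r)} {J : Fin (2 * r) → Idx n (2 * k)}
    (h : StableOn (S ∪ U) J) (hU : ∀ q ∈ U, ConjPair J q) (hd : Disjoint S U) :
    wordInv J (cols (S ∪ U)) = wordInv J (cols S) * ∏ q ∈ U, cSign (J (lc q)) := by
  induction U using Finset.induction_on with
  | empty => rw [Finset.union_empty, Finset.prod_empty, mul_one]
  | insert q U hq ih =>
    rw [Finset.disjoint_insert_right] at hd
    rw [Finset.union_insert] at h ⊢
    have hqU : q ∉ S ∪ U := by
      rw [Finset.mem_union]
      exact fun h' => h'.elim hd.1 hq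
    have hq' := hU q (Finset.mem_insert_self _ _)
    rw [wordInv_insert h hq' hqU, ih (h.of_insert hq' hqU)
      (fun q' hq' => hU q' (Finset.mem_insert_of_mem hq')) hd.2, Finset.prod_insert hq]
    ring

theorem wordInv_cols (J : Fin (2 * r) → Idx n m) (S : Finset (Fin r)) : wordInv J (cols S) =
    ∏ q ∈ S, ∏ q' ∈ S, (invFactor J (lc q) (lc q') * invFactor J (lc q) (rc q')) *
      (invFactor J (rc q) (lc q') * invFactor J (rc q) (rc q')) := by
  change ∏ x ∈ cols S, ∏ y ∈ cols S, invFactor J x y = _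
  rw [prod_cols]
  simp only [prod_cols, ← Finset.prod_mul_distrib]

/-- Conjugation of all the letters and interchange of the members of all the pairs preserve the sign
of an odd word. -/
theorem wordInv_conj_partner {S : Finset (Fin r)} {J W : Fin (2 * r) → Idx n m}
    (hodd : ∀ x ∈ cols S, par (W x) = 1) (hinj : ∀ x ∈ cols S, ∀ y ∈ cols S, W x = W y → x = y)
    (hJ : ∀ x ∈ cols S, J x = conj (W (partner x))) :
    wordInv J (cols S) = wordInv W (cols S) := by
  rw [wordInv_cols, wordInv_cols]
  refine Finset.prod_congr rfl fun q hq => Finset.prod_congr rfl fun q' hq' => ?_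
  have l := lc_mem_cols.2 hq
  have l' := lc_mem_cols.2 hq'
  have r1 := rc_mem_cols.2 hq
  have r' := rc_mem_cols.2 hq'
  have e1 : J (lc q) = conj (W (rc q)) := by rw [hJ _ l, partner_lc]
  have e2 : J (rc q) = conj (W (lc q)) := by rw [hJ _ r1, partner_rc]
  have e1' : J (lc q') = conj (W (rc q')) := by rw [hJ _ l', partner_lc]
  have e2' : J (rc q') = conj (W (lc q')) := by rw [hJ _ r', partner_rc]
  simp only [invFactor, e1, e2, e1', e2', place_conj_lt_iff (hodd _ l') (hodd _ l),
    place_conj_lt_iff (hodd _ l') (hodd _ r1), place_conj_lt_iff (hodd _ r') (hodd _ l),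
    place_conj_lt_iff (hodd _ r') (hodd _ r1)]
  -- Within a pair the two changes undo each other. For two different pairs of columns all four
  -- comparisons are reversed, which preserves the parity of the number of inversions.
  rcases eq_or_ne q q' with h | h
  · subst h
    simp [lc_lt_rc, (lc_lt_rc q).not_gt]
  · have hp : ∀ x ∈ cols S, ∀ y ∈ cols S, pairOf x = q → pairOf y = q' →
        place (W x) ≠ place (W y) := by
      intro x hx y hy hx' hy' hc
      have := hinj x hx y hy (place_injective hc)
      rw [← hx', ← hy', this] at h
      exact h rfl
    have n1 := hp _ l _ l' (pairOf_lc q) (pairOf_lc q')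
    have n2 := hp _ l _ r' (pairOf_lc q) (pairOf_rc q')
    have n3 := hp _ r1 _ l' (pairOf_rc q) (pairOf_lc q')
    have n4 := hp _ r1 _ r' (pairOf_rc q) (pairOf_rc q')
    have o1 := lt_lc_or_rc_lt (x := lc q) (q := q') (by rwa [pairOf_lc])
    have o2 := lt_lc_or_rc_lt (x := rc q) (q := q') (by rwa [pairOf_rc])
    have o3 : lc q < lc q' ↔ rc q < lc q' := by
      have h' : q.val ≠ q'.val := fun h' => h (Fin.ext h')
      simp only [Fin.lt_def, lc, rc]; omega
    by_cases ho : lc q < lc q'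
    · have ho2 := o3.1 ho
      have ho3 := (o1.resolve_right fun h => absurd ho h.1.not_gt).2
      have ho4 := (o2.resolve_right fun h => absurd ho2 h.1.not_gt).2
      simp only [ho, ho2, ho3, ho4, true_and]
      rcases lt_or_gt_of_ne n1 with n1 | n1 <;> rcases lt_or_gt_of_ne n2 with n2 | n2 <;>
      rcases lt_or_gt_of_ne n3 with n3 | n3 <;> rcases lt_or_gt_of_ne n4 with n4 | n4 <;>
      simp only [n1, n2, n3, n4, n1.not_gt, n2.not_gt, n3.not_gt, n4.not_gt, if_true, if_false] <;>
      rfl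
    · have ho2 : ¬ rc q < lc q' := fun h => ho (o3.2 h)
      have ho3 := (o1.resolve_left fun h => ho h.1).2.not_gt
      have ho4 := (o2.resolve_left fun h => ho2 h.1).2.not_gt
      simp only [ho, ho2, ho3, ho4, false_and]

end

section


variable {n m k l r N : ℕ}

/-! ### The signs of the fillings -/

/-- The pairs of a row outside `S` are conjugate, and its entries in the columns of `S` are odd,
distinct, and form a set that is stable under conjugation. -/
def AdmOn (S : Finset (Fin r)) (J : Fin (2 * r) → Idx n m) : Prop :=
  (∀ q ∉ S, ConjPair J q) ∧ StableOn S J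

/-- The non-conjugate pairs of a row. -/
def badPairs (J : Fin (2 * r) → Idx n m) : Finset (Fin r) := {q | ¬ ConjPair J q}

theorem mem_badPairs {J : Fin (2 * r) → Idx n m} {q : Fin r} :
    q ∈ badPairs J ↔ ¬ ConjPair J q := by simp [badPairs]

theorem badCols_eq (J : Fin (2 * r) → Idx n m) : badCols J = cols (badPairs J) := by
  ext x
  rw [mem_cols, mem_badPairs]
  simp [badCols]

theorem AdmOn.badPairs_subset {S : Finset (Fin r)} {J : Fin (2 * r) → Idx n m} (h : AdmOn S J) :
    badPairs J ⊆ S := by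
  intro q hq
  by_contra hqS
  exact mem_badPairs.1 hq (h.1 q hqS)

theorem conjPair_of_mem_sdiff {S : Finset (Fin r)} {J : Fin (2 * r) → Idx n m} :
    ∀ q ∈ S \ badPairs J, ConjPair J q := by
  intro q hq
  rw [Finset.mem_sdiff, mem_badPairs, not_not] at hq
  exact hq.2

theorem AdmOn.stableOn_badPairs {S : Finset (Fin r)} {J : Fin (2 * r) → Idx n m}
    (h : AdmOn S J) : StableOn (badPairs J) J := by
  have h2 := h.2
  rw [← Finset.union_sdiff_of_subset h.badPairs_subset] at h2
  exact h2.of_union conjPair_of_mem_sdiff Finset.disjoint_sdiff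

theorem lastRowAdm_iff {J : Fin (2 * r) → Idx n m} :
    LastRowAdm J ↔ StableOn (badPairs J) J := by
  unfold LastRowAdm
  rw [badCols_eq]
  exact ⟨fun h => ⟨h.1, h.2.1, h.2.2⟩, fun h => ⟨h.odd, h.inj, h.conj⟩⟩

/-- A word of 2r distinct odd letters contains all of them. -/
theorem OddInj.stableOn {W : Fin (2 * r) → Idx n (2 * r)} (h : OddInj W) :
    StableOn Finset.univ W := by
  obtain ⟨π, hπ⟩ := oddInj_iff.1 h
  refine ⟨fun x _ => h.1 x, fun x _ y _ hxy => h.2 hxy, fun x _ => ?_⟩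
  refine ⟨π.symm (π x).rev, ?_, ?_⟩
  · rw [mem_cols]; exact Finset.mem_univ _
  · rw [hπ, hπ, Equiv.apply_symm_apply]; rfl

/-- The last rows of the two tableaux correspond to each other. -/
structure Exchanged (S : Finset (Fin r)) (J W : Fin (2 * r) → Idx n m) : Prop where
  pair_fst : ∀ q ∉ S, ConjPair J q
  pair_snd : ∀ q ∉ S, ConjPair W q
  eq_conj : ∀ x ∈ cols S, J x = conj (W (partner x))

theorem Exchanged.symm {S : Finset (Fin r)} {J W : Fin (2 * r) → Idx n m}
    (h : Exchanged S J W) : Exchanged S W J := by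
  refine ⟨h.pair_snd, h.pair_fst, fun x hx => ?_⟩
  rw [h.eq_conj (partner x) (by rw [mem_cols, pairOf_partner]; exact mem_cols.1 hx),
    partner_partner, conj_conj]

theorem Exchanged.stableOn {S : Finset (Fin r)} {J W : Fin (2 * r) → Idx n m}
    (h : Exchanged S J W) (hW : StableOn S W) : StableOn S J := by
  have hp : ∀ x ∈ cols S, partner x ∈ cols S := fun x hx => by
    rw [mem_cols, pairOf_partner]; exact mem_cols.1 hx
  refine ⟨fun x hx => ?_, fun x hx y hy hxy => ?_, fun x hx => ?_⟩
  · rw [h.eq_conj x hx, par_conj]; exact hW.odd _ (hp x hx)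
  · rw [h.eq_conj x hx, h.eq_conj y hy] at hxy
    have := hW.inj _ (hp x hx) _ (hp y hy) (conj_injective hxy)
    rw [← partner_partner x, this, partner_partner]
  · obtain ⟨y, hy, hyx⟩ := hW.conj _ (hp x hx)
    refine ⟨partner y, hp y hy, ?_⟩
    rw [h.eq_conj _ (hp y hy), partner_partner, hyx, h.eq_conj x hx]

theorem OddInj.stableOn_of_pairs {S : Finset (Fin r)} {W : Fin (2 * r) → Idx n (2 * r)}
    (h : OddInj W) (hW : ∀ q ∉ S, ConjPair W q) : StableOn S W := by
  have h2 := h.stableOn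
  rw [← Finset.union_compl S] at h2
  exact h2.of_union (fun q hq => hW q (Finset.mem_compl.1 hq)) disjoint_compl_right

theorem Exchanged.admOn {S : Finset (Fin r)} {J W : Fin (2 * r) → Idx n (2 * r)}
    (h : Exchanged S J W) (hW : OddInj W) : AdmOn S J :=
  ⟨h.pair_fst, h.stableOn (hW.stableOn_of_pairs h.pair_snd)⟩

theorem cols_univ : cols (Finset.univ : Finset (Fin r)) = Finset.univ := by
  ext x; simp [mem_cols]

theorem prod_cSign_mul_self (S : Finset (Fin r)) (f : Fin r → Idx n m) :
    (∏ q ∈ S, cSign (f q)) * (∏ q ∈ S, cSign (f q)) = 1 := by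
  rw [← Finset.prod_mul_distrib]
  exact Finset.prod_eq_one fun q _ => cSign_mul_self _

/-- Remove from W the conjugate pairs outside S, pass from W to J on S (`wordInv_conj_partner`), and
remove from J the conjugate pairs inside S. The signs c of W outside S then occur twice, and the
product of the signs c over S is 1 by `StableOn.prod_neg_cSign`. -/
theorem Exchanged.sign_eq {S : Finset (Fin r)} {J W : Fin (2 * r) → Idx n (2 * r)}
    (h : Exchanged S J W) (hW : OddInj W) :
    ((∏ q ∈ S, cSign (W (lc q)) * cSign (conj (W (rc q)))) *
      ∏ q ∈ Sᶜ, cSign (J (lc q)) * cSign (W (lc q))) * wordInv W Finset.univ =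
    badSign J * ∏ q, if ConjPair J q then cSign (J (lc q)) else 1 := by
  have hadm := h.admOn hW
  have h1 : wordInv W Finset.univ = wordInv J (cols S) * ∏ q ∈ Sᶜ, cSign (W (lc q)) := by
    have h2 := hW.stableOn
    rw [← Finset.union_compl S] at h2
    have h3 := wordInv_union h2 (fun q hq => h.pair_snd q (Finset.mem_compl.1 hq))
      disjoint_compl_right
    rw [Finset.union_compl, cols_univ] at h3
    have hS := hW.stableOn_of_pairs h.pair_snd
    rw [h3, wordInv_conj_partner hS.odd hS.inj h.eq_conj]
  have h4 : wordInv J (cols S) = badSign J * ∏ q ∈ S \ badPairs J, cSign (J (lc q)) := by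
    have h5 := hadm.2
    rw [← Finset.union_sdiff_of_subset hadm.badPairs_subset] at h5
    have h6 := wordInv_union h5 conjPair_of_mem_sdiff Finset.disjoint_sdiff
    rw [Finset.union_sdiff_of_subset hadm.badPairs_subset] at h6
    rw [h6, badSign, badCols_eq]; rfl
  have h7 : (∏ q, if ConjPair J q then cSign (J (lc q)) else 1) =
      (∏ q ∈ Sᶜ, cSign (J (lc q))) * ∏ q ∈ S \ badPairs J, cSign (J (lc q)) := by
    rw [← Finset.prod_union]
    · rw [← Finset.prod_filter]
      refine Finset.prod_congr ?_ fun _ _ => rfl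
      ext q
      simp only [Finset.mem_filter, Finset.mem_univ, true_and, Finset.mem_union,
        Finset.mem_compl, Finset.mem_sdiff, mem_badPairs, not_not]
      have := h.pair_fst q
      tauto
    · exact disjoint_compl_left.mono_right Finset.sdiff_subset
  have h8 : (∏ q ∈ S, cSign (W (lc q)) * cSign (conj (W (rc q)))) = 1 := by
    rw [← hadm.2.prod_neg_cSign]
    refine Finset.prod_congr rfl fun q hq => ?_
    have hl := h.eq_conj _ (lc_mem_cols.2 hq)
    have hr := h.eq_conj _ (rc_mem_cols.2 hq)
    rw [partner_lc] at hl
    rw [partner_rc] at hr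
    rw [hl, hr, cSign_conj_odd (hW.1 (lc q))]
    ring
  rw [h8, h1, h4, h7, Finset.prod_mul_distrib]
  linear_combination (badSign J * (∏ q ∈ Sᶜ, cSign (J (lc q))) *
    ∏ q ∈ S \ badPairs J, cSign (J (lc q))) * prod_cSign_mul_self Sᶜ fun q => W (lc q)

theorem dCol_congr {A B : Fin n → Idx n m} (h : ∀ i, par (A i) = par (B i)) : dCol A = dCol B := by
  simp only [dCol, h]

variable [NeZero n]

theorem lastRow_eq (F : Fin n → Fin (2 * r) → Idx n m) : lastRow F = F (lastIdx n) := rfl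

theorem swapLast_of_ne (S : Finset (Fin r)) (q : Fin r) {i : Fin n} (hi : i ≠ lastIdx n) :
    swapLast n S q i.castSucc = i.castSucc := by
  rw [swapLast]
  split_ifs
  · exact Equiv.swap_apply_of_ne_of_ne (fun h => hi (Fin.castSucc_injective n h))
      (Fin.castSucc_lt_last i).ne
  · rfl

theorem exch_of_ne (S : Finset (Fin r)) (Z : Fin (n + 1) → Fin r → Idx n (2 * r)) {i : Fin n}
    (hi : i ≠ lastIdx n) : exch S Z i.castSucc = pairRow (Z i.castSucc) := by
  refine columns_ext (fun q => ?_) fun q => ?_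
  · rw [exch_lc, swapLast_of_ne S q hi, pairRow_lc]
  · rw [exch_rc, pairRow_rc]

theorem exch_last_lc (S : Finset (Fin r)) (Z : Fin (n + 1) → Fin r → Idx n (2 * r)) (q : Fin r) :
    exch S Z (Fin.last n) (lc q) =
      if q ∈ S then Z (lastIdx n).castSucc q else Z (Fin.last n) q := by
  rw [exch_lc, swapLast]
  split_ifs
  · rw [Equiv.swap_apply_right]
  · rfl

theorem exch_lastIdx_lc (S : Finset (Fin r)) (Z : Fin (n + 1) → Fin r → Idx n (2 * r))
    (q : Fin r) : exch S Z (lastIdx n).castSucc (lc q) =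
      if q ∈ S then Z (Fin.last n) q else Z (lastIdx n).castSucc q := by
  rw [exch_lc, swapLast]
  split_ifs
  · rw [Equiv.swap_apply_left]
  · rfl

theorem exchanged_exch (S : Finset (Fin r)) (Z : Fin (n + 1) → Fin r → Idx n (2 * r)) :
    Exchanged S (exch S Z (lastIdx n).castSucc) (exch S Z (Fin.last n)) := by
  refine ⟨fun q hq => ?_, fun q hq => ?_, fun x hx => ?_⟩
  · rw [ConjPair, exch_lastIdx_lc, if_neg hq, exch_rc]
  · rw [ConjPair, exch_last_lc, if_neg hq, exch_rc]
  · rw [mem_cols] at hx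
    rcases eq_lc_or_eq_rc x with h | h
    · rw [h, partner_lc, exch_lastIdx_lc, if_pos hx, exch_rc, conj_conj]
    · rw [h, partner_rc, exch_last_lc, if_pos hx, exch_rc]

/-- Rows above the last two keep their pairs, and the last two are handled by `Exchanged.sign_eq`.
The factor d does not change because the exchanged letters are both odd. -/
theorem exch_sign_eq (S : Finset (Fin r)) (Z : Fin (n + 1) → Fin r → Idx n (2 * r))
    (hW : OddInj (exch S Z (Fin.last n))) :
    (∏ p, ∏ q, cSign (Z p q)) * (∏ q, dCol fun i : Fin n => Z i.castSucc q) *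
        wordInv (exch S Z (Fin.last n)) Finset.univ =
      cHat (fun i => exch S Z i.castSucc) * dSign fun i => exch S Z i.castSucc := by
  have hd : (∏ q, dCol fun i : Fin n => Z i.castSucc q) =
      dSign fun i => exch S Z i.castSucc := by
    refine Finset.prod_congr rfl fun q _ => dCol_congr fun i => ?_
    change par (Z i.castSucc q) = par (exch S Z i.castSucc (lc q))
    rcases eq_or_ne i (lastIdx n) with hi | hi
    · rw [hi, exch_lastIdx_lc]
      split_ifs with hq
      · have h1 := hW.1 (lc q)
        have h2 := hW.1 (rc q)
        rw [exch_last_lc, if_pos hq] at h1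
        rw [exch_rc, par_conj] at h2
        rw [h1, h2]
      · rfl
    · rw [exch_of_ne S Z hi, pairRow_lc]
  have h1 := (exchanged_exch S Z).sign_eq hW
  have h2 : ((∏ q ∈ S, cSign (exch S Z (Fin.last n) (lc q)) *
      cSign (conj (exch S Z (Fin.last n) (rc q)))) *
      ∏ q ∈ Sᶜ, cSign (exch S Z (lastIdx n).castSucc (lc q)) *
        cSign (exch S Z (Fin.last n) (lc q))) =
      (∏ q, cSign (Z (lastIdx n).castSucc q)) * ∏ q, cSign (Z (Fin.last n) q) := by
    rw [← Finset.prod_mul_distrib, ← Finset.prod_mul_prod_compl S]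
    congr 1
    · refine Finset.prod_congr rfl fun q hq => ?_
      rw [exch_last_lc, if_pos hq, exch_rc, conj_conj]
    · refine Finset.prod_congr rfl fun q hq => ?_
      rw [Finset.mem_compl] at hq
      rw [exch_last_lc, if_neg hq, exch_lastIdx_lc, if_neg hq]
  have h3 : ∀ i ∈ ({lastIdx n}ᶜ : Finset (Fin n)),
      (∏ q, if ConjPair (exch S Z i.castSucc) q then cSign (exch S Z i.castSucc (lc q)) else 1) =
      ∏ q, cSign (Z i.castSucc q) := by
    intro i hi
    have hi : i ≠ lastIdx n := by simpa using hi
    refine Finset.prod_congr rfl fun q _ => ?_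
    rw [exch_of_ne S Z hi, if_pos (by rw [ConjPair, pairRow_rc, pairRow_lc]), pairRow_lc]
  rw [h2] at h1
  rw [hd, cHat, lastRow_eq, Fin.prod_univ_castSucc,
    Fintype.prod_eq_mul_prod_compl (lastIdx n) (fun i : Fin n => ∏ q, cSign (Z i.castSucc q)),
    Fintype.prod_eq_mul_prod_compl (lastIdx n), Finset.prod_congr rfl h3]
  linear_combination ((∏ i ∈ ({lastIdx n}ᶜ : Finset (Fin n)), ∏ q, cSign (Z i.castSucc q)) *
    dSign fun i => exch S Z i.castSucc) * h1

end

/-! ### Counting the contributions to a filling: the coefficient K. -/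

section


variable {n m k l r N : ℕ}

/-! ### The number of fillings with given last rows -/

theorem card_odd_letters : (Finset.univ.filter fun a : Idx n m => par a = 1).card = m :=
  (Fintype.card_subtype _).symm.trans card_par_one

theorem cols_insert_cases {S : Finset (Fin r)} {q : Fin r} {x : Fin (2 * r)}
    (hx : x ∈ cols (insert q S)) : x ∈ cols S ∨ x = lc q ∨ x = rc q := by
  rw [mem_cols, Finset.mem_insert] at hx
  rcases hx with hx | hx
  · right; rw [← hx]; exact eq_lc_or_eq_rc x
  · left; exact mem_cols.2 hx

/-- A stable word may be extended by a conjugate pair of new letters. -/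
theorem stableOn_extend {S : Finset (Fin r)} {W : Fin (2 * r) → Idx n (2 * r)} (h : StableOn S W)
    {q : Fin r} (hq : q ∉ S) {a : Idx n (2 * r)} (ha : par a = 1) (hne : ∀ x ∈ cols S, W x ≠ a) :
    StableOn (insert q S) fun x => if x ∈ cols S then W x else pairRow (fun _ => a) x := by
  have hl : lc q ∉ cols S := fun h => hq (lc_mem_cols.1 h)
  have hr : rc q ∉ cols S := fun h => hq (rc_mem_cols.1 h)
  have hne' : ∀ x ∈ cols S, W x ≠ conj a := by
    intro x hx hxa
    obtain ⟨y, hy, hyx⟩ := h.conj x hx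
    exact hne y hy (by rw [hyx, hxa, conj_conj])
  have hsub : ∀ x ∈ cols S, x ∈ cols (insert q S) := fun x hx => by
    rw [mem_cols] at *; exact Finset.mem_insert_of_mem hx
  have hl' : lc q ∈ cols (insert q S) := lc_mem_cols.2 (Finset.mem_insert_self _ _)
  have hr' : rc q ∈ cols (insert q S) := rc_mem_cols.2 (Finset.mem_insert_self _ _)
  have hca := conj_ne_self ha
  refine ⟨fun x hx => ?_, fun x hx y hy hxy => ?_, fun x hx => ?_⟩
  · rcases cols_insert_cases hx with hx | rfl | rfl
    · rw [if_pos hx]; exact h.odd x hx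
    · rw [if_neg hl, pairRow_lc]; exact ha
    · rw [if_neg hr, pairRow_rc, par_conj]; exact ha
  · rcases cols_insert_cases hx with hx | rfl | rfl <;>
      rcases cols_insert_cases hy with hy | rfl | rfl <;>
      simp only [hx, hy, hl, hr, if_true, if_false, pairRow_lc, pairRow_rc] at hxy
    · exact h.inj x hx y hy hxy
    · exact absurd hxy (hne x hx)
    · exact absurd hxy (hne' x hx)
    · exact absurd hxy.symm (hne y hy)
    · rfl
    · exact absurd hxy.symm hca
    · exact absurd hxy.symm (hne' y hy)
    · exact absurd hxy hca
    · rfl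
  · rcases cols_insert_cases hx with hx | rfl | rfl
    · obtain ⟨y, hy, hyx⟩ := h.conj x hx
      exact ⟨y, hsub y hy, by rw [if_pos hx, if_pos hy, hyx]⟩
    · exact ⟨rc q, hr', by rw [if_neg hl, if_neg hr, pairRow_lc, pairRow_rc]⟩
    · exact ⟨lc q, hl', by rw [if_neg hl, if_neg hr, pairRow_lc, pairRow_rc, conj_conj]⟩

theorem StableOn.oddInj {W : Fin (2 * r) → Idx n m} (h : StableOn Finset.univ W) : OddInj W :=
  ⟨fun x => h.odd x (by rw [cols_univ]; exact Finset.mem_univ _),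
    fun x y => h.inj x (by rw [cols_univ]; exact Finset.mem_univ _) y
      (by rw [cols_univ]; exact Finset.mem_univ _)⟩

/-- The number of extensions of a stable word by conjugate pairs to a word that contains all the odd
letters. -/
theorem card_extensions (k : ℕ) : ∀ (S : Finset (Fin r)) (W₀ : Fin (2 * r) → Idx n (2 * r)),
    StableOn S W₀ → Sᶜ.card = k →
    (Finset.univ.filter fun W : Fin (2 * r) → Idx n (2 * r) =>
      OddInj W ∧ (∀ q ∉ S, ConjPair W q) ∧ ∀ x ∈ cols S, W x = W₀ x).card =
      2 ^ k * k.factorial := by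
  induction k with
  | zero =>
    intro S W₀ h hS
    rw [Finset.card_eq_zero, Finset.compl_eq_empty_iff] at hS
    subst hS
    rw [pow_zero, Nat.factorial_zero, mul_one, Finset.card_eq_one]
    refine ⟨W₀, ?_⟩
    ext W
    simp only [Finset.mem_filter, Finset.mem_univ, true_and, Finset.mem_singleton, not_true_eq_false,
      false_imp_iff, implies_true, cols_univ, true_imp_iff]
    constructor
    · exact fun h' => funext h'.2
    · rintro rfl
      exact ⟨h.oddInj, fun _ => rfl⟩
  | succ k ih =>
    intro S W₀ h hS
    obtain ⟨q, hq⟩ : Sᶜ.Nonempty := by rw [← Finset.card_pos, hS]; omega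
    have hqS : q ∉ S := Finset.mem_compl.1 hq
    -- The letters available for the left column of q: the 2(k+1) odd letters not yet used. The
    -- conjugate of such a letter is unused as well and fills the right column.
    set G : Finset (Idx n (2 * r)) :=
      (Finset.univ.filter fun a : Idx n (2 * r) => par a = 1) \ (cols S).image W₀ with hG
    have hGcard : G.card = 2 * (k + 1) := by
      rw [hG, Finset.card_sdiff_of_subset, card_odd_letters,
        Finset.card_image_of_injOn (fun x hx y hy hxy => h.inj x hx y hy hxy), card_cols, ← hS,
        Finset.card_compl, Fintype.card_fin, Nat.mul_sub]
      intro a ha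
      obtain ⟨x, hx, rfl⟩ := Finset.mem_image.1 ha
      simpa using h.odd x hx
    have hmemG : ∀ a, a ∈ G ↔ par a = 1 ∧ ∀ x ∈ cols S, W₀ x ≠ a := by
      intro a; simp [hG]
    rw [Finset.card_eq_sum_card_fiberwise (f := fun W => W (lc q)) (t := G)]
    · have hfib : ∀ a ∈ G, ((Finset.univ.filter fun W : Fin (2 * r) → Idx n (2 * r) =>
          OddInj W ∧ (∀ q ∉ S, ConjPair W q) ∧ ∀ x ∈ cols S, W x = W₀ x).filter
          fun W => W (lc q) = a).card = 2 ^ k * k.factorial := by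
        intro a ha
        rw [hmemG] at ha
        rw [← ih (insert q S) _ (stableOn_extend h hqS ha.1 ha.2)
          (by rw [Finset.compl_insert, Finset.card_erase_of_mem hq, hS]; rfl)]
        congr 1
        have hl : lc q ∉ cols S := fun h => hqS (lc_mem_cols.1 h)
        have hr : rc q ∉ cols S := fun h => hqS (rc_mem_cols.1 h)
        ext W
        simp only [Finset.mem_filter, Finset.mem_univ, true_and]
        constructor
        · rintro ⟨⟨h1, h2, h3⟩, h4⟩
          refine ⟨h1, fun q' hq' => h2 q' fun h' => hq' (Finset.mem_insert_of_mem h'),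
            fun x hx => ?_⟩
          rcases cols_insert_cases hx with hx | rfl | rfl
          · rw [if_pos hx, h3 x hx]
          · rw [if_neg hl, pairRow_lc, h4]
          · rw [if_neg hr, pairRow_rc, ← h4]; exact h2 q hqS
        · rintro ⟨h1, h2, h3⟩
          have e1 : W (lc q) = a := by
            rw [h3 _ (lc_mem_cols.2 (Finset.mem_insert_self _ _)), if_neg hl, pairRow_lc]
          refine ⟨⟨h1, fun q' hq' => ?_, fun x hx => ?_⟩, e1⟩
          · rcases eq_or_ne q' q with rfl | hne
            · rw [ConjPair, e1, h3 _ (rc_mem_cols.2 (Finset.mem_insert_self _ _)), if_neg hr,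
                pairRow_rc]
            · exact h2 q' fun h' => (Finset.mem_insert.1 h').elim hne hq'
          · rw [h3 x (by rw [mem_cols] at *; exact Finset.mem_insert_of_mem hx), if_pos hx]
      rw [Finset.sum_congr rfl hfib, Finset.sum_const, hGcard, smul_eq_mul, Nat.factorial_succ]
      ring
    · intro W hW
      simp only [Finset.coe_filter, Finset.mem_univ, true_and, Set.mem_ofPred_eq] at hW
      rw [Finset.mem_coe, hmemG]
      refine ⟨hW.1.1 _, fun x hx hxa => ?_⟩
      rw [← hW.2.2 x hx] at hxa
      have := hW.1.2 hxa
      rw [this] at hx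
      exact hqS (lc_mem_cols.1 hx)

/-- On S the word W is forced by J; outside S it is any completion by conjugate pairs to all the odd
letters. -/
theorem card_exchanged {S : Finset (Fin r)} {J : Fin (2 * r) → Idx n (2 * r)} (h : AdmOn S J) :
    (Finset.univ.filter fun W : Fin (2 * r) → Idx n (2 * r) =>
      OddInj W ∧ (∀ q ∉ S, ConjPair W q) ∧ ∀ x ∈ cols S, W x = conj (J (partner x))).card =
      2 ^ (r - S.card) * (r - S.card).factorial := by
  let W₀ : Fin (2 * r) → Idx n (2 * r) := fun x =>
    if x ∈ cols S then conj (J (partner x)) else J x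
  have hex : Exchanged S W₀ J := by
    refine ⟨fun q hq => ?_, h.1, fun x hx => if_pos hx⟩
    have hl : lc q ∉ cols S := fun h => hq (lc_mem_cols.1 h)
    have hr : rc q ∉ cols S := fun h => hq (rc_mem_cols.1 h)
    simp only [W₀, ConjPair, if_neg hl, if_neg hr]
    exact h.1 q hq
  rw [← card_extensions (r - S.card) S W₀ (hex.stableOn h.2)
    (by rw [Finset.card_compl, Fintype.card_fin])]
  congr 1
  ext W
  simp only [Finset.mem_filter, Finset.mem_univ, true_and]
  refine and_congr_right fun _ => and_congr_right fun _ => forall_congr' fun x =>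
    imp_congr_right fun hx => ?_
  rw [show W₀ x = conj (J (partner x)) from if_pos hx]

variable [NeZero n]

/-- The entries of the fillings with conjugate pairs that lead to a given filling `F`. -/
def preFill (S : Finset (Fin r)) (F : Fin n → Fin (2 * r) → Idx n (2 * r))
    (W : Fin (2 * r) → Idx n (2 * r)) (i : Fin (n + 1)) (q : Fin r) : Idx n (2 * r) :=
  Fin.lastCases (motive := fun _ => Idx n (2 * r))
    (if q ∈ S then F (lastIdx n) (lc q) else W (lc q))
    (fun i => if i = lastIdx n ∧ q ∈ S then W (lc q) else F i (lc q)) i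

theorem preFill_last (S : Finset (Fin r)) (F : Fin n → Fin (2 * r) → Idx n (2 * r))
    (W : Fin (2 * r) → Idx n (2 * r)) (q : Fin r) : preFill S F W (Fin.last n) q =
      if q ∈ S then F (lastIdx n) (lc q) else W (lc q) := by
  simp [preFill]

theorem preFill_castSucc (S : Finset (Fin r)) (F : Fin n → Fin (2 * r) → Idx n (2 * r))
    (W : Fin (2 * r) → Idx n (2 * r)) (i : Fin n) (q : Fin r) : preFill S F W i.castSucc q =
      if i = lastIdx n ∧ q ∈ S then W (lc q) else F i (lc q) := by
  simp [preFill]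

/-- Once F is fixed, Z and its last row W after the exchange determine each other, with `preFill` as
the inverse. -/
theorem card_preFill {S : Finset (Fin r)} {F : Fin n → Fin (2 * r) → Idx n (2 * r)}
    (hF : ∀ i, i ≠ lastIdx n → ∀ q, ConjPair (F i) q) (hS : AdmOn S (F (lastIdx n))) :
    (Finset.univ.filter fun Z : Fin (n + 1) → Fin r → Idx n (2 * r) =>
      OddInj (exch S Z (Fin.last n)) ∧ (fun i : Fin n => exch S Z i.castSucc) = F).card =
      2 ^ (r - S.card) * (r - S.card).factorial := by
  rw [← card_exchanged hS]
  have hexch : ∀ W : Fin (2 * r) → Idx n (2 * r), (∀ q ∉ S, ConjPair W q) →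
      (∀ x ∈ cols S, W x = conj (F (lastIdx n) (partner x))) →
      exch S (preFill S F W) (Fin.last n) = W ∧
      (fun i : Fin n => exch S (preFill S F W) i.castSucc) = F := by
    intro W h1 h2
    have hl : ∀ q ∈ S, W (lc q) = conj (F (lastIdx n) (rc q)) := fun q hq => by
      rw [h2 _ (lc_mem_cols.2 hq), partner_lc]
    have hr : ∀ q ∈ S, W (rc q) = conj (F (lastIdx n) (lc q)) := fun q hq => by
      rw [h2 _ (rc_mem_cols.2 hq), partner_rc]
    constructor
    · refine columns_ext (fun q => ?_) fun q => ?_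
      · rw [exch_last_lc, preFill_last, preFill_castSucc]
        by_cases hq : q ∈ S <;> simp [hq]
      · rw [exch_rc, preFill_last]
        by_cases hq : q ∈ S
        · rw [if_pos hq, hr q hq]
        · rw [if_neg hq]; exact (h1 q hq).symm
    · funext i
      rcases eq_or_ne i (lastIdx n) with hi | hi
      · rw [hi]
        refine columns_ext (fun q => ?_) fun q => ?_
        · rw [exch_lastIdx_lc, preFill_last, preFill_castSucc]
          by_cases hq : q ∈ S <;> simp [hq]
        · rw [exch_rc, preFill_castSucc]
          by_cases hq : q ∈ S
          · rw [if_pos ⟨rfl, hq⟩, hl q hq, conj_conj]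
          · rw [if_neg fun h => hq h.2]; exact (hS.1 q hq).symm
      · rw [exch_of_ne _ _ hi]
        refine columns_ext (fun q => ?_) fun q => ?_
        · rw [pairRow_lc, preFill_castSucc, if_neg fun h => hi h.1]
        · rw [pairRow_rc, preFill_castSucc, if_neg fun h => hi h.1]
          exact (hF i hi q).symm
  refine Finset.card_bij' (fun Z _ => exch S Z (Fin.last n)) (fun W _ => preFill S F W) ?_ ?_ ?_ ?_
  · intro Z hZ
    simp only [Finset.mem_filter, Finset.mem_univ, true_and] at hZ ⊢
    obtain ⟨h1, rfl⟩ := hZ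
    have := (exchanged_exch S Z).symm
    exact ⟨h1, this.pair_fst, this.eq_conj⟩
  · intro W hW
    simp only [Finset.mem_filter, Finset.mem_univ, true_and] at hW ⊢
    have := hexch W hW.2.1 hW.2.2
    rw [this.1]
    exact ⟨hW.1, this.2⟩
  · intro Z hZ
    simp only [Finset.mem_filter, Finset.mem_univ, true_and] at hZ
    obtain ⟨_, rfl⟩ := hZ
    funext i q
    refine Fin.lastCases ?_ (fun i => ?_) i
    · rw [preFill_last, exch_lastIdx_lc, exch_last_lc]
      split_ifs <;> rfl
    · rw [preFill_castSucc, exch_last_lc]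
      rcases eq_or_ne i (lastIdx n) with hi | hi
      · rw [hi, exch_lastIdx_lc]
        by_cases hq : q ∈ S <;> simp [hq]
      · rw [if_neg fun h => hi h.1, exch_of_ne _ _ hi, pairRow_lc]
  · intro W hW
    simp only [Finset.mem_filter, Finset.mem_univ, true_and] at hW
    exact (hexch W hW.2.1 hW.2.2).1

end

section


variable {n m k l r N : ℕ}

/-! ### The sum over the admissible sets of pairs -/

/-- The smaller one of a letter and its conjugate. -/
def minLetter (a : Idx n m) : Idx n m := if place a < place (conj a) then a else conj a

theorem minLetter_eq_or (a : Idx n m) : minLetter a = a ∨ minLetter a = conj a := by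
  rw [minLetter]; split_ifs <;> simp

theorem eq_or_eq_conj_of_minLetter {a b : Idx n m} (h : minLetter a = minLetter b) :
    a = b ∨ a = conj b := by
  rcases minLetter_eq_or a with ha | ha <;> rcases minLetter_eq_or b with hb | hb <;>
    rw [ha, hb] at h
  · exact Or.inl h
  · exact Or.inr h
  · right; rw [← h, conj_conj]
  · exact Or.inl (conj_injective h)

theorem minLetter_of_lt {a : Idx n m} (h : place a < place (conj a)) : minLetter a = a := if_pos h

theorem minLetter_conj {a : Idx n m} (h : place a < place (conj a)) : minLetter (conj a) = a := by
  rw [minLetter, conj_conj, if_neg h.not_gt]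

theorem par_minLetter (a : Idx n m) : par (minLetter a) = par a := by
  rcases minLetter_eq_or a with h | h <;> rw [h]
  exact par_conj a

theorem minLetter_lt {a : Idx n (2 * r)} (ha : par a = 1) :
    place (minLetter a) < place (conj (minLetter a)) := by
  have h : place (conj a) ≠ place a := fun h => conj_ne_self ha (place_injective h)
  rw [minLetter]
  split_ifs with h'
  · exact h'
  · rw [conj_conj]; omega

/-- The conjugate pairs of a row with given letters. -/
def pairsOf (J : Fin (2 * r) → Idx n m) (a : Idx n m) : Finset (Fin r) :=
  {q | ConjPair J q ∧ (J (lc q) = a ∨ J (lc q) = conj a)}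

theorem mem_pairsOf {J : Fin (2 * r) → Idx n m} {a : Idx n m} {q : Fin r} :
    q ∈ pairsOf J a ↔ ConjPair J q ∧ (J (lc q) = a ∨ J (lc q) = conj a) := by simp [pairsOf]

theorem mem_types {J : Fin (2 * r) → Idx n m} {a : Idx n m} : a ∈ types J ↔
    par a = 1 ∧ place a < place (conj a) ∧ 0 < mult J a ∧ ∀ x ∈ badCols J, J x ≠ a := by
  simp [types]

/-- The types of the conjugate pairs in a set. -/
def typeSet (J : Fin (2 * r) → Idx n m) (S : Finset (Fin r)) : Finset (Idx n m) :=
  (S \ badPairs J).image fun q => minLetter (J (lc q))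

theorem minLetter_of_mem_pairsOf {J : Fin (2 * r) → Idx n m} {a : Idx n m} {q : Fin r}
    (ha : place a < place (conj a)) (hq : q ∈ pairsOf J a) : minLetter (J (lc q)) = a := by
  rcases (mem_pairsOf.1 hq).2 with h | h
  · rw [h, minLetter_of_lt ha]
  · rw [h, minLetter_conj ha]

theorem mem_pairsOf_minLetter {J : Fin (2 * r) → Idx n m} {q : Fin r} (hq : ConjPair J q) :
    q ∈ pairsOf J (minLetter (J (lc q))) := by
  rw [mem_pairsOf]
  refine ⟨hq, ?_⟩
  rcases minLetter_eq_or (J (lc q)) with h | h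
  · left; exact h.symm
  · right; rw [h, conj_conj]

/-- A conjugate pair uses up both letters of its type, and letters in S are distinct; so S contains
at most one conjugate pair of each type. -/
theorem AdmOn.minLetter_injOn {S : Finset (Fin r)} {J : Fin (2 * r) → Idx n m} (h : AdmOn S J)
    {q q' : Fin r} (hq : q ∈ S) (hq' : q' ∈ S \ badPairs J)
    (he : minLetter (J (lc q)) = minLetter (J (lc q'))) : q = q' := by
  have hp := conjPair_of_mem_sdiff q' hq'
  have hq'S := (Finset.mem_sdiff.1 hq').1
  rcases eq_or_eq_conj_of_minLetter he with h1 | h1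
  · exact lc_inj.1 (h.2.inj _ (lc_mem_cols.2 hq) _ (lc_mem_cols.2 hq'S) h1)
  · exact absurd (h.2.inj _ (lc_mem_cols.2 hq) _ (rc_mem_cols.2 hq'S) (h1.trans hp.symm))
      (lc_ne_rc q q')

/-- Here |S| becomes the summation index q = p + l of K, with l the number of the types in S. -/
theorem AdmOn.card_eq {S : Finset (Fin r)} {J : Fin (2 * r) → Idx n m} (h : AdmOn S J) :
    S.card = (badPairs J).card + (typeSet J S).card := by
  rw [typeSet, Finset.card_image_of_injOn, Finset.card_sdiff_of_subset h.badPairs_subset]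
  · have := Finset.card_le_card h.badPairs_subset
    omega
  · intro q hq q' hq' he
    exact h.minLetter_injOn (Finset.mem_sdiff.1 hq).1 hq' he

theorem AdmOn.typeSet_subset {S : Finset (Fin r)} {J : Fin (2 * r) → Idx n (2 * k)}
    (h : AdmOn S J) : typeSet J S ⊆ types J := by
  intro a ha
  obtain ⟨q, hq, rfl⟩ := Finset.mem_image.1 ha
  have hp := conjPair_of_mem_sdiff q hq
  have hqS := (Finset.mem_sdiff.1 hq).1
  have hodd := h.2.odd _ (lc_mem_cols.2 hqS)
  rw [mem_types]
  refine ⟨(par_minLetter _).trans hodd, minLetter_lt hodd, ?_, fun x hx hxa => ?_⟩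
  · exact Finset.card_pos.2 ⟨q, mem_pairsOf_minLetter hp⟩
  · rw [badCols_eq, mem_cols] at hx
    have hxS := mem_cols.2 (h.badPairs_subset hx)
    have hxq : pairOf x = q := by
      rcases minLetter_eq_or (J (lc q)) with h1 | h1
      · rw [h.2.inj _ hxS _ (lc_mem_cols.2 hqS) (hxa.trans h1), pairOf_lc]
      · rw [h.2.inj _ hxS _ (rc_mem_cols.2 hqS) (hxa.trans (h1.trans hp.symm)), pairOf_rc]
    rw [hxq] at hx
    exact (Finset.mem_sdiff.1 hq).2 hx

/-- The set of pairs of columns with a choice of pairs of given types. -/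
def chosenSet (J : Fin (2 * r) → Idx n m) (A : Finset (Idx n m)) (φ : ∀ a ∈ A, Fin r) :
    Finset (Fin r) :=
  badPairs J ∪ A.attach.image fun a => φ a.1 a.2

theorem mem_chosenSet {J : Fin (2 * r) → Idx n m} {A : Finset (Idx n m)} {φ : ∀ a ∈ A, Fin r}
    {q : Fin r} : q ∈ chosenSet J A φ ↔ q ∈ badPairs J ∨ ∃ a, ∃ ha : a ∈ A, φ a ha = q := by
  simp [chosenSet]

theorem chosen_notMem_badPairs {J : Fin (2 * r) → Idx n m} {A : Finset (Idx n m)}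
    {φ : ∀ a ∈ A, Fin r} (hφ : ∀ a ha, φ a ha ∈ pairsOf J a) {a : Idx n m} (ha : a ∈ A) :
    φ a ha ∉ badPairs J := by
  rw [mem_badPairs, not_not]
  exact (mem_pairsOf.1 (hφ a ha)).1

theorem eq_or_eq_conj_of_mem_pairsOf {J : Fin (2 * r) → Idx n m} {a : Idx n m} {x : Fin (2 * r)}
    (h : pairOf x ∈ pairsOf J a) : J x = a ∨ J x = conj a := by
  obtain ⟨h1, h2⟩ := mem_pairsOf.1 h
  rcases eq_lc_or_eq_rc x with hx | hx
  · rwa [← hx] at h2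
  · rw [hx, h1]
    rcases h2 with h2 | h2
    · right; rw [h2]
    · left; rw [h2, conj_conj]

theorem ne_of_mem_types {J : Fin (2 * r) → Idx n (2 * k)} (hJ : StableOn (badPairs J) J)
    {a : Idx n (2 * k)} (ha : a ∈ types J) {x y : Fin (2 * r)} (hx : x ∈ cols (badPairs J))
    (hy : pairOf y ∈ pairsOf J a) : J x ≠ J y := by
  have hne := (mem_types.1 ha).2.2.2
  rw [badCols_eq] at hne
  intro hxy
  rcases eq_or_eq_conj_of_mem_pairsOf hy with h | h
  · exact hne x hx (hxy.trans h)
  · obtain ⟨x', hx', hxx⟩ := hJ.conj x hx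
    exact hne x' hx' (by rw [hxx, hxy, h, conj_conj])

/-- The letter of a type does not occur in the non-conjugate pairs by the definition of `types`, nor
does its conjugate by stability. Hence one conjugate pair of each chosen type can be added without a
repetition. -/
theorem admOn_chosenSet {J : Fin (2 * r) → Idx n (2 * k)} (hJ : StableOn (badPairs J) J)
    {A : Finset (Idx n (2 * k))} (hA : A ⊆ types J) {φ : ∀ a ∈ A, Fin r}
    (hφ : ∀ a ha, φ a ha ∈ pairsOf J a) : AdmOn (chosenSet J A φ) J := by
  have hcases : ∀ x ∈ cols (chosenSet J A φ), x ∈ cols (badPairs J) ∨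
      ∃ a, ∃ ha : a ∈ A, φ a ha = pairOf x ∧ pairOf x ∈ pairsOf J a := by
    intro x hx
    rw [mem_cols, mem_chosenSet] at hx
    rcases hx with hx | ⟨a, ha, hx⟩
    · exact Or.inl (mem_cols.2 hx)
    · exact Or.inr ⟨a, ha, hx, by rw [← hx]; exact hφ a ha⟩
  have hodd : ∀ a ∈ A, ∀ x, pairOf x ∈ pairsOf J a → par (J x) = 1 := by
    intro a ha x hx
    rcases eq_or_eq_conj_of_mem_pairsOf hx with h | h
    · rw [h]; exact (mem_types.1 (hA ha)).1
    · rw [h, par_conj]; exact (mem_types.1 (hA ha)).1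
  have hmin : ∀ a ∈ A, ∀ x, pairOf x ∈ pairsOf J a → minLetter (J x) = a := by
    intro a ha x hx
    have hlt := (mem_types.1 (hA ha)).2.1
    rcases eq_or_eq_conj_of_mem_pairsOf hx with h | h
    · rw [h, minLetter_of_lt hlt]
    · rw [h, minLetter_conj hlt]
  refine ⟨fun q hq => ?_, fun x hx => ?_, fun x hx y hy hxy => ?_, fun x hx => ?_⟩
  · by_contra h
    exact hq (mem_chosenSet.2 (Or.inl (mem_badPairs.2 h)))
  · rcases hcases x hx with h | ⟨a, ha, _, hx⟩
    · exact hJ.odd x h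
    · exact hodd a ha x hx
  · rcases hcases x hx with h | ⟨a, ha, hax, hx⟩ <;> rcases hcases y hy with h' | ⟨b, hb, hby, hy⟩
    · exact hJ.inj x h y h' hxy
    · exact absurd hxy (ne_of_mem_types hJ (hA hb) h hy)
    · exact absurd hxy.symm (ne_of_mem_types hJ (hA ha) h' hx)
    · have hab : a = b := by rw [← hmin a ha x hx, hxy, hmin b hb y hy]
      subst hab
      have hp : pairOf x = pairOf y := hax.symm.trans hby
      by_contra hne
      have hpart : y = partner x := by
        rcases eq_lc_or_eq_rc x with h1 | h1 <;> rcases eq_lc_or_eq_rc y with h2 | h2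
        · exact absurd (by rw [h1, h2, hp]) hne
        · rw [h1, partner_lc, h2, hp]
        · rw [h1, partner_rc, h2, hp]
        · exact absurd (by rw [h1, h2, hp]) hne
      rw [hpart, apply_partner (J := J) (mem_pairsOf.1 hx).1] at hxy
      exact conj_ne_self (hodd a ha x hx) hxy.symm
  · rcases hcases x hx with h | ⟨a, ha, _, hx'⟩
    · obtain ⟨y, hy, hyx⟩ := hJ.conj x h
      exact ⟨y, mem_cols.2 (mem_chosenSet.2 (Or.inl (mem_cols.1 hy))), hyx⟩
    · refine ⟨partner x, ?_, apply_partner (J := J) (mem_pairsOf.1 hx').1⟩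
      rw [mem_cols, pairOf_partner]
      exact mem_cols.1 hx

theorem typeSet_chosenSet {J : Fin (2 * r) → Idx n m} {A : Finset (Idx n m)} (hA : A ⊆ types J)
    {φ : ∀ a ∈ A, Fin r} (hφ : ∀ a ha, φ a ha ∈ pairsOf J a) :
    typeSet J (chosenSet J A φ) = A := by
  have hmin : ∀ a (ha : a ∈ A), minLetter (J (lc (φ a ha))) = a := fun a ha =>
    minLetter_of_mem_pairsOf (mem_types.1 (hA ha)).2.1 (hφ a ha)
  ext a
  rw [typeSet, Finset.mem_image]
  constructor
  · rintro ⟨q, hq, rfl⟩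
    rw [Finset.mem_sdiff, mem_chosenSet] at hq
    obtain ⟨a, ha, rfl⟩ := hq.1.resolve_left hq.2
    rw [hmin a ha]; exact ha
  · intro ha
    exact ⟨φ a ha, Finset.mem_sdiff.2 ⟨mem_chosenSet.2 (Or.inr ⟨a, ha, rfl⟩),
      chosen_notMem_badPairs hφ ha⟩, hmin a ha⟩

open Classical in
/-- The number of admissible sets of pairs with given types. -/
theorem card_admOn_typeSet {J : Fin (2 * r) → Idx n (2 * k)} (hJ : StableOn (badPairs J) J)
    {A : Finset (Idx n (2 * k))} (hA : A ⊆ types J) :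
    (Finset.univ.filter fun S : Finset (Fin r) => AdmOn S J ∧ typeSet J S = A).card =
      ∏ a ∈ A, mult J a := by
  have h1 : (A.pi fun a => pairsOf J a).card = ∏ a ∈ A, mult J a := by
    rw [Finset.card_pi]; rfl
  rw [← h1]
  symm
  refine Finset.card_bij (fun φ _ => chosenSet J A φ) ?_ ?_ ?_
  · intro φ hφ
    rw [Finset.mem_pi] at hφ
    rw [Finset.mem_filter]
    exact ⟨Finset.mem_univ _, admOn_chosenSet hJ hA hφ, typeSet_chosenSet hA hφ⟩
  · intro φ hφ φ' hφ' h
    rw [Finset.mem_pi] at hφ hφ'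
    funext a ha
    have hmem : φ a ha ∈ chosenSet J A φ' := by
      rw [← h]; exact mem_chosenSet.2 (Or.inr ⟨a, ha, rfl⟩)
    obtain ⟨b, hb, hba⟩ := (mem_chosenSet.1 hmem).resolve_left (chosen_notMem_badPairs hφ ha)
    have e1 := minLetter_of_mem_pairsOf (mem_types.1 (hA ha)).2.1 (hφ a ha)
    have e2 := minLetter_of_mem_pairsOf (mem_types.1 (hA hb)).2.1 (hφ' b hb)
    rw [hba, e1] at e2
    subst e2
    exact hba.symm
  · intro S hS
    obtain ⟨hS, hSA⟩ := (Finset.mem_filter.1 hS).2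
    have hex : ∀ a ∈ A, ∃ q ∈ S \ badPairs J, minLetter (J (lc q)) = a := by
      intro a ha
      rw [← hSA] at ha
      exact Finset.mem_image.1 ha
    choose φ hφ hφa using hex
    have hpi : ∀ a ha, φ a ha ∈ pairsOf J a := by
      intro a ha
      have := mem_pairsOf_minLetter (conjPair_of_mem_sdiff _ (hφ a ha))
      rwa [hφa] at this
    refine ⟨φ, Finset.mem_pi.2 hpi, ?_⟩
    ext q
    rw [mem_chosenSet]
    constructor
    · rintro (h | ⟨a, ha, rfl⟩)
      · exact hS.badPairs_subset h
      · exact (Finset.mem_sdiff.1 (hφ a ha)).1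
    · intro hq
      by_cases hqb : q ∈ badPairs J
      · exact Or.inl hqb
      · have hqA : minLetter (J (lc q)) ∈ A := by
          rw [← hSA]
          exact Finset.mem_image_of_mem _ (Finset.mem_sdiff.2 ⟨hq, hqb⟩)
        exact Or.inr ⟨_, hqA, (hS.minLetter_injOn hq (hφ _ hqA) (hφa _ hqA).symm).symm⟩

open Classical in
-- An admissible S amounts to a set A of types and, for each type in A, one of its `mult` pairs;
-- summation over the A of a given size yields the elementary symmetric function.
theorem sum_admOn {J : Fin (2 * r) → Idx n (2 * k)} (hJ : LastRowAdm J) (g : ℕ → ℕ) :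
    ∑ S : Finset (Fin r), (if AdmOn S J then g S.card else 0) =
      ∑ q ∈ Finset.Icc (numBad J) (numBad J + (types J).card),
        g q * esymmMult J (q - numBad J) := by
  have hJ' := lastRowAdm_iff.1 hJ
  have hp : numBad J = (badPairs J).card := rfl
  rw [← Finset.sum_filter, ← Finset.sum_fiberwise_of_maps_to (g := typeSet J)
    (t := (types J).powerset)
    (fun S hS => Finset.mem_powerset.2 (Finset.mem_filter.1 hS).2.typeSet_subset)]
  have h1 : ∀ A ∈ (types J).powerset, ∑ S ∈ (Finset.univ.filter fun S : Finset (Fin r) =>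
      AdmOn S J) with typeSet J S = A, g S.card = g (numBad J + A.card) * ∏ a ∈ A, mult J a := by
    intro A hA
    rw [← card_admOn_typeSet hJ' (Finset.mem_powerset.1 hA), Finset.filter_filter, mul_comm (g _)]
    refine Finset.sum_const_nat fun S hS => ?_
    obtain ⟨h, h2⟩ := (Finset.mem_filter.1 hS).2
    rw [h.card_eq, h2, hp]
  rw [Finset.sum_congr rfl h1, Finset.sum_powerset]
  have h2 : Finset.Icc (numBad J) (numBad J + (types J).card) =
      (Finset.range ((types J).card + 1)).map (addLeftEmbedding (numBad J)) := by
    ext q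
    simp only [Finset.mem_Icc, Finset.mem_map, Finset.mem_range, addLeftEmbedding_apply]
    constructor
    · intro h; exact ⟨q - numBad J, by omega, by omega⟩
    · rintro ⟨l, hl, rfl⟩; omega
  rw [h2, Finset.sum_map]
  refine Finset.sum_congr rfl fun l _ => ?_
  rw [addLeftEmbedding_apply, Nat.add_sub_cancel_left, esymmMult, Finset.mul_sum]
  refine Finset.sum_congr rfl fun A hA => ?_
  rw [(Finset.mem_powersetCard.1 hA).2]

variable [NeZero n]

theorem mem_fillings {F : Fin n → Fin (2 * r) → Idx n (2 * r)} : F ∈ fillings n r ↔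
    (∀ i, i ≠ lastIdx n → ∀ q, ConjPair (F i) q) ∧ LastRowAdm (F (lastIdx n)) := by
  have h : ∀ i : Fin n, (i : ℕ) + 1 < n ↔ i ≠ lastIdx n := by
    intro i
    have := i.isLt
    rw [Ne, Fin.ext_iff, lastIdx]
    simp only
    omega
  simp only [fillings, Finset.mem_filter, Finset.mem_univ, true_and, h, lastRow_eq]

/-- The weighted number of the terms that lead to a filling. -/
theorem sum_card_preFill (F : Fin n → Fin (2 * r) → Idx n (2 * r)) :
    (n + 1) ^ r * ∑ S : Finset (Fin r), n ^ S.card *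
      (Finset.univ.filter fun Z : Fin (n + 1) → Fin r → Idx n (2 * r) =>
        OddInj (exch S Z (Fin.last n)) ∧ (fun i : Fin n => exch S Z i.castSucc) = F).card =
      if F ∈ fillings n r then kCoeff F else 0 := by
  classical
  have hnec : ∀ S : Finset (Fin r), (∃ Z : Fin (n + 1) → Fin r → Idx n (2 * r),
      OddInj (exch S Z (Fin.last n)) ∧ (fun i : Fin n => exch S Z i.castSucc) = F) →
      (∀ i, i ≠ lastIdx n → ∀ q, ConjPair (F i) q) ∧ AdmOn S (F (lastIdx n)) := by
    rintro S ⟨Z, h1, rfl⟩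
    refine ⟨fun i hi q => ?_, (exchanged_exch S Z).admOn h1⟩
    simp only [exch_of_ne S Z hi, ConjPair, pairRow_lc, pairRow_rc]
  by_cases hF : ∀ i, i ≠ lastIdx n → ∀ q, ConjPair (F i) q
  · have hcard : ∀ S : Finset (Fin r),
        (Finset.univ.filter fun Z : Fin (n + 1) → Fin r → Idx n (2 * r) =>
          OddInj (exch S Z (Fin.last n)) ∧ (fun i : Fin n => exch S Z i.castSucc) = F).card =
        if AdmOn S (F (lastIdx n)) then 2 ^ (r - S.card) * (r - S.card).factorial else 0 := by
      intro S
      split_ifs with h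
      · exact card_preFill hF h
      · rw [Finset.card_eq_zero, Finset.filter_eq_empty_iff]
        intro Z _ hZ
        exact h (hnec S ⟨Z, hZ⟩).2
    simp only [hcard]
    by_cases hJ : LastRowAdm (F (lastIdx n))
    · rw [if_pos (mem_fillings.2 ⟨hF, hJ⟩), kCoeff, lastRow_eq]
      -- The weight of a set S of size q: the ratio of double cosets to the power q, times the
      -- number of last rows.
      have h2 := sum_admOn hJ fun q => n ^ q * (2 ^ (r - q) * (r - q).factorial)
      simp only [mul_ite, mul_zero]
      rw [h2, Finset.mul_sum]
      refine Finset.sum_congr rfl fun q _ => ?_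
      ring
    · rw [if_neg fun h => hJ (mem_fillings.1 h).2, Finset.sum_eq_zero, mul_zero]
      intro S _
      rw [if_neg, mul_zero]
      exact fun h => hJ (lastRowAdm_iff.2 h.stableOn_badPairs)
  · rw [if_neg fun h => hF (mem_fillings.1 h).1, Finset.sum_eq_zero, mul_zero]
    intro S _
    rw [mul_eq_zero]
    right
    rw [Finset.card_eq_zero, Finset.filter_eq_empty_iff]
    intro Z _ hZ
    exact hF (hnec S ⟨Z, hZ⟩).1

/-- The value of the operator on the power of the form. -/
theorem exists_invOp_formTensor_eq (n r : ℕ) [NeZero n] : ∃ c : ℂ, c ≠ 0 ∧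
    invOp n (2 * r) (formTensor n r) = c • nabla n r := by
  obtain ⟨c, hc, h⟩ := exists_invOp_formTensor n r
  have hn : ((n : ℂ) + 1) ^ r ≠ 0 := pow_ne_zero _ (Nat.cast_add_one_ne_zero n)
  -- The factor (n+1)^r in `kCoeff` is a normalization that this reduction does not produce; the
  -- constant absorbs it.
  refine ⟨c * (((n : ℂ) + 1) ^ r)⁻¹, mul_ne_zero hc (inv_ne_zero hn), ?_⟩
  rw [h, mul_smul]
  congr 1
  rw [eq_inv_smul_iff₀ hn]
  let E : (Fin n → Fin (2 * r) → Idx n (2 * r)) → T n (2 * r) (n * (2 * r + 1)) := fun F =>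
    ((cHat F * dSign F : ℤ) : ℂ) •
      young n (2 * r) (colTab n (2 * r + 1)) (vec (prependSeq (seqOf F)))
  have h1 : ∀ S : Finset (Fin r), colTerm n r (leftPerm (swapLast n S)) =
      ∑ F, ((Finset.univ.filter fun Z : Fin (n + 1) → Fin r → Idx n (2 * r) =>
        OddInj (exch S Z (Fin.last n)) ∧ (fun i : Fin n => exch S Z i.castSucc) = F).card : ℂ) •
        E F := by
    intro S
    rw [colTerm_swapLast, ← Finset.sum_filter,
      ← Finset.sum_fiberwise _ fun Z => fun i : Fin n => exch S Z i.castSucc]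
    refine Finset.sum_congr rfl fun F _ => ?_
    rw [Finset.filter_filter, Nat.cast_smul_eq_nsmul, ← Finset.sum_const]
    refine Finset.sum_congr rfl fun Z hZ => ?_
    obtain ⟨hZ1, rfl⟩ := (Finset.mem_filter.1 hZ).2
    rw [exch_sign_eq S Z hZ1]
  simp only [h1, Finset.smul_sum]
  rw [Finset.sum_comm, nabla, ← Finset.univ_inter (fillings n r), ← Finset.sum_ite_mem]
  refine Finset.sum_congr rfl fun F _ => ?_
  have h2 := congrArg (fun x : ℕ => (x : ℂ)) (sum_card_preFill F)
  simp only [smul_smul]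
  rw [← Finset.sum_smul]
  have h3 : ∑ S : Finset (Fin r), ((n : ℂ) + 1) ^ r * (((n ^ S.card : ℕ) : ℂ) *
      ((Finset.univ.filter fun Z : Fin (n + 1) → Fin r → Idx n (2 * r) =>
        OddInj (exch S Z (Fin.last n)) ∧ (fun i : Fin n => exch S Z i.castSucc) = F).card : ℂ)) =
      ((if F ∈ fillings n r then kCoeff F else 0 : ℕ) : ℂ) := by
    rw [← h2, ← Finset.mul_sum]
    push_cast
    rfl
  rw [h3]
  split_ifs
  · simp only [E]
    rw [smul_smul]
    congr 1
    push_cast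
    ring
  · rw [Nat.cast_zero, zero_smul]

end

end OspInv

theorem theorem5p1 (n r : ℕ) [NeZero n] :
    (∀ (a : ZMod 2) (X : OspInv.V n (2 * r) →ₗ[ℂ] OspInv.V n (2 * r)), OspInv.IsOsp a X →
      OspInv.act a X (OspInv.nabla n r) = 0) ∧
    (∀ (a : ZMod 2) (X : OspInv.V n (2 * r) →ₗ[ℂ] OspInv.V n (2 * r)), OspInv.IsOsp a X →
      OspInv.act a X (OspInv.formTensor n r) = 0) ∧
    (∀ (a : ZMod 2) (X : OspInv.V n (2 * r) →ₗ[ℂ] OspInv.V n (2 * r)), OspInv.IsOsp a X →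
      OspInv.invOp n (2 * r) ∘ₗ OspInv.act a X = OspInv.act a X ∘ₗ OspInv.invOp n (2 * r)) ∧
    ∃ κ : ℂ, κ ≠ 0 ∧
      OspInv.invOp n (2 * r) (OspInv.formTensor n r) = κ • OspInv.nabla n r := by
  obtain ⟨κ, hκ, h⟩ := OspInv.exists_invOp_formTensor_eq n r
  refine ⟨fun a X hX => ?_, fun a X hX => OspInv.act_formTensor hX,
    fun a X hX => OspInv.invOp_act hX, κ, hκ, h⟩
  -- X kills the power of the form, hence also its image κ∇, and κ ≠ 0 cancels.
  have h1 := LinearMap.congr_fun (OspInv.invOp_act hX) (OspInv.formTensor n r)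
  rw [LinearMap.comp_apply, LinearMap.comp_apply, OspInv.act_formTensor hX, map_zero, h,
    map_smul] at h1
  exact (smul_eq_zero.1 h1.symm).resolve_left hκ
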